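/- **Setting.** Fix a horizon $L$. The min-player has finite state and action spaces $X,A$ and an unknown transition function $P_1$. The states are split into disjoint layers $X_0=\{x_0\},X_1,\dots,X_L=\{x_L\}$, and transitions lead from $X_\ell$ to $X_{\ell+1}$ only (loop-free). The max-player has $Y,B,P_2$ of the same kind; the two transitions are independent. For a transition function $P$ let $\Delta(P)$ be the set of occupancy measures $q(x,a,x')=\mathrm{Prob}(x_\ell=x,a_\ell=a,x_{\ell+1}=x')$ for $x\in X_\ell$ (mass one in each layer, flow conservation, $q(x,a,x')=q(x,a)P(x'|x,a)$ with $q(x,a)=\sum_{x'}q(x,a,x')$). Put $\langle q_1,g\rangle=\sum_{\ell<L}\sum_{x\in X_\ell,a}q_1(x,a)g(x,a)$, similarly $\langle q_2,h\rangle$, and $\langle q_1\cdot q_2,r\rangle=\sum_{\ell<L}\sum_{x\in X_\ell,y\in Y_\ell,a,b}q_1(x,a)q_2(y,b)r(x,y,a,b)$. In the episodes $t=1,\dots,T$ the rewards $r^t\in[0,1]$ form an arbitrary sequence fixed in advance (independent of the transitions and utilities). The utilities $g^t:X\times A\to[0,1]$, $h^t:Y\times B\to[0,1]$ are random, independent of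 everything that happened in earlier episodes, with means $g,h$. The budget is $\beta\in(0,2L]$. *Strict feasibility*: there are $\xi>0$ and $(\bar q_1,\bar q_2)\in\Delta(P_1)\times\Delta(P_2)$ with $\langle\bar q_1,g\rangle+\langle\bar q_2,h\rangle+\xi\le \beta$. **Algorithm UCB-CSAPO** (parameters $V,\eta,\theta,\delta$). Start with $\hat q_1^{\,0}(x,a,x')=1/(|X_\ell||A||X_{\ell+1}|)$ on $X_\ell\times A\times X_{\ell+1}$, the analogous $\hat q_2^{\,0}$, $\lambda^0=0$ and $r^0=g^0=h^0=0$. For $t=1,\dots,T$: 1. $(\hat q_1^{\,t},\hat q_2^{\,t})$ is a saddle point (min over $q_1\in\Delta_1^t$, max over $q_2\in\Delta_2^t$) of $$V\langle q_1\cdot\hat q_2^{\,t-1}+\hat q_1^{\,t-1}\cdot q_2,r^{t-1}\rangle+\lambda^{t-1}\big(\langle q_1,g^{t-1}\rangle-\langle q_2,h^{t-1}\rangle\big)+\eta^{-1}\big(D(q_1|\tilde q_1^{\,t-1})-D(q_2|\tilde q_2^{\,t-1})\big),$$ where $D(p|q)=\sum_i p_i\ln\frac{p_i}{q_i}-\sum_i(p_i-q_i)$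 is taken over state-action pairs and $\tilde q_1^{\,t-1}(x,a)=(1-\theta)\hat q_1^{\,t-1}(x,a)+\theta/(|X_\ell||A|)$ for $x\in X_\ell$, similarly $\tilde q_2^{\,t-1}$. 2. $\lambda^t=\max\{\lambda^{t-1}+\langle\hat q_1^{\,t},g^{t-1}\rangle+\langle\hat q_2^{\,t},h^{t-1}\rangle-\beta,\,0\}$. 3. The players execute $\pi^t(a|x)=\hat q_1^{\,t}(x,a)/\sum_{a'}\hat q_1^{\,t}(x,a')$ and the analogous $\mu^t$ (uniform where the denominator is $0$), and observe the trajectories and $r^t,g^t,h^t$. 4. Each player separately keeps visit counts of the current epoch ($n(x,a)$, $m(x,a,x')$) and of all earlier epochs ($N$, $M$, initially $0$). If after the episode $n(x,a)\ge\max\{1,N(x,a)\}$ for some $(x,a)$, a new epoch starts: $N\leftarrow N+n$, $M\leftarrow M+m$, $n,m\leftarrow0$. Here $\Delta_1^t$ is the union of $\Delta(\hat P)$ over all loop-free transition functions $\hat P$ with $\sum_{x'}|\hat P(x'|x,a)-\frac{M(x,a,x')}{\max(1,N(x,a))}|\le\sqrt{\frac{2|X_{\ell+1}|\log(T|X||A|/\delta)}{\max(1,N(x,a))}}$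 for all $x\in X_\ell$, $\ell<L$, $a\in A$, with the counts at the start of episode $t$; $\Delta_2^t$ is defined in the same way. **Performance.** A constrained Nash equilibrium in hindsight is a pair $(q_1^\star,q_2^\star)\in\Delta(P_1)\times\Delta(P_2)$ with $\langle q_1^\star,g\rangle+\langle q_2^\star,h\rangle\le \beta$ such that $q_1^\star$ minimizes $\sum_{t=1}^T\langle q_1\cdot q_2^\star,r^t\rangle$ over the $q_1\in\Delta(P_1)$ with $\langle q_1,g\rangle+\langle q_2^\star,h\rangle\le \beta$, and $q_2^\star$ maximizes $\sum_{t=1}^T\langle q_1^\star\cdot q_2,r^t\rangle$ over the $q_2\in\Delta(P_2)$ with $\langle q_1^\star,g\rangle+\langle q_2,h\rangle\le \beta$. With $q_1^t,q_2^t$ the occupancy measures of $\pi^t,\mu^t$ under $P_1,P_2$, let $$\mathrm{Regret}(T)=\sum_{t=1}^T\big(\langle q_1^t\cdot q_2^\star,r^t\rangle-\langle q_1^\star\cdot q_2^t,r^t\rangle\big),\qquad \mathrm{Violation}(T)=\Big[\sum_{t=1}^T\big(\langle q_1^t,g^t\rangle+\langle q_2^t,h^t\rangle-\beta\big)\Big]_+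 .$$ **Theorem 1.** There is an absolute constant $k\in\mathbb N$, and for every $\xi>0$ a constant $C>0$ depending only on $\xi$, such that for every game as above that is strictly feasible with slack $\xi$, every $p\in(0,1)$ and every $T\ge\max(|X||A|,|Y||B|)$: if UCB-CSAPO is run with $V=L\sqrt T$, $\eta=1/(TL)$, $\theta=1/T$ and $\delta=p/(2T)$, then for every constrained Nash equilibrium in hindsight $(q_1^\star,q_2^\star)$, with probability at least $1-p$, $$\mathrm{Regret}(T)\le C\,(|X|+|Y|)\,L\sqrt{T(|A|+|B|)}\,\log^k(T/p)\quad\text{and}\quad \mathrm{Violation}(T)\le C\,(|X|+|Y|)\,L\sqrt{T(|A|+|B|)}\,\log^k(T/p).$$ -/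

import Mathlib

open MeasureTheory ProbabilityTheory

noncomputable section

namespace CMG

/-! ### Loop-free layered Markov decision processes -/

/-- A finite state space split into the layers `0, …, L`, whose first and last layers
are single states (the initial and the terminal state). -/
structure Layering (X : Type*) (L : ℕ) where
  layer : X → ℕ
  layer_le : ∀ x, layer x ≤ L
  start : X
  terminal : X
  layer_eq_zero_iff : ∀ x, layer x = 0 ↔ x = start
  layer_eq_last_iff : ∀ x, layer x = L ↔ x = terminal

section Single

variable {X A : Type*} [Fintype X] [Fintype A] {L : ℕ}

/-- The number of states in layer `l`. -/
def Layering.size (S : Layering X L) (l : ℕ) : ℕ :=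
  (Finset.univ.filter fun x => S.layer x = l).card

/-- `P x a x'` is the probability of moving from `x` to `x'` under the action `a`. Each
`P x a` is a probability vector for nonterminal `x`, and transitions lead from a layer to
the next one (so there are none out of the terminal state). -/
structure IsTransition (S : Layering X L) (P : X → A → X → ℝ) : Prop where
  nonneg : ∀ x a x', 0 ≤ P x a x'
  sum_eq_one : ∀ x a, S.layer x < L → ∑ x', P x a x' = 1
  loop_free : ∀ x a x', 0 < P x a x' → S.layer x' = S.layer x + 1

/-- State-action marginal `q(x,a)` of `q(x,a,x')`. -/
def marginal (q : X → A → X → ℝ) (x : X) (a : A) : ℝ := ∑ x', q x a x'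

/-- Occupancy measures on consecutive layers: total mass one in each layer, and
conservation of flow in the intermediate layers. -/
structure IsOccupancy (S : Layering X L) (q : X → A → X → ℝ) : Prop where
  mem_unit : ∀ x a x', q x a x' ∈ Set.Icc (0 : ℝ) 1
  support : ∀ x a x', q x a x' ≠ 0 → S.layer x' = S.layer x + 1
  mass : ∀ l < L, ∑ x, ∑ a, ∑ x', (if S.layer x = l then q x a x' else 0) = 1
  flow : ∀ x', 0 < S.layer x' → S.layer x' < L →
    ∑ x, ∑ a, q x a x' = ∑ a, ∑ x'', q x' a x''

/-- `Δ(P)`: the occupancy measures whose associated transition function is `P`. -/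
def occupancySet (S : Layering X L) (P : X → A → X → ℝ) : Set (X → A → X → ℝ) :=
  {q | IsOccupancy S q ∧ ∀ x a x', q x a x' = marginal q x a * P x a x'}

open Classical in
/-- The policy associated with `q`: `π(a|x) = q(x,a) / ∑_a q(x,a)`. At states of zero
mass, where the quotient is undefined, the policy is uniform. -/
def policy (q : X → A → X → ℝ) (x : X) (a : A) : ℝ :=
  if ∑ a', marginal q x a' = 0 then 1 / (Fintype.card A : ℝ)
  else marginal q x a / ∑ a', marginal q x a'

/-- Trajectories `(x_0, …, x_L)`, `(a_0, …, a_{L-1})` of an episode. -/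
abbrev Traj (X A : Type*) (L : ℕ) := (Fin (L + 1) → X) × (Fin L → A)

open Classical in
/-- Probability of a trajectory when the policy `π` is executed from the initial state
under the transition function `P`. -/
def trajProb (S : Layering X L) (P : X → A → X → ℝ) (π : X → A → ℝ) (u : Traj X A L) : ℝ :=
  (if u.1 0 = S.start then 1 else 0) *
    ∏ l : Fin L, π (u.1 l.castSucc) (u.2 l) * P (u.1 l.castSucc) (u.2 l) (u.1 l.succ)

open Classical in
/-- The occupancy measure of the policy `π` under `P`:
`q(x,a,x') = Prob(x_l = x, a_l = a, x_{l+1} = x')`, where `l` is the layer of `x`. -/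
def occupancy (S : Layering X L) (P : X → A → X → ℝ) (π : X → A → ℝ)
    (x : X) (a : A) (x' : X) : ℝ :=
  ∑ u : Traj X A L, trajProb S P π u *
    (if ∃ l : Fin L, (l : ℕ) = S.layer x ∧ u.1 l.castSucc = x ∧ u.2 l = a ∧ u.1 l.succ = x'
      then 1 else 0)

/-- `⟨q, g⟩`: the expected total utility over an episode. -/
def utility (S : Layering X L) (q : X → A → X → ℝ) (g : X → A → ℝ) : ℝ :=
  ∑ x, ∑ a, if S.layer x < L then marginal q x a * g x a else 0

/-! ### Visitation counters, epochs and confidence sets -/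

/-- Counters of one player: `N`, `M` count the visits to `(x,a)` and `(x,a,x')` before the
current epoch, `n`, `m` count those inside the current epoch `epoch`. -/
structure Counters (X A : Type*) where
  epoch : ℕ
  N : X → A → ℕ
  M : X → A → X → ℕ
  n : X → A → ℕ
  m : X → A → X → ℕ

/-- The counters at the beginning of the first episode. -/
def Counters.initial : Counters X A where
  epoch := 1
  N := fun _ _ => 0
  M := fun _ _ _ => 0
  n := fun _ _ => 0
  m := fun _ _ _ => 0

open Classical in
/-- Update after an episode with trajectory `u`: increase the local counters along `u`; if
afterwards some `(x,a)` visited in this epoch has `n(x,a) ≥ N(x,a)`, start a new epoch. -/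
def Counters.step (c : Counters X A) (u : Traj X A L) : Counters X A :=
  let n' : X → A → ℕ := fun x a => c.n x a +
    (Finset.univ.filter fun l : Fin L => u.1 l.castSucc = x ∧ u.2 l = a).card
  let m' : X → A → X → ℕ := fun x a x' => c.m x a x' +
    (Finset.univ.filter fun l : Fin L =>
      u.1 l.castSucc = x ∧ u.2 l = a ∧ u.1 l.succ = x').card
  if ∃ x a, max 1 (c.N x a) ≤ n' x a then
    { epoch := c.epoch + 1
      N := fun x a => c.N x a + n' x a
      M := fun x a x' => c.M x a x' + m' x a x'
      n := fun _ _ => 0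
      m := fun _ _ _ => 0 }
  else { c with n := n', m := m' }

/-- Counters after `t` episodes (in force during episode `t + 1`); `u t` is the trajectory
of episode `t`, and the episodes are numbered `1, 2, …`. -/
def counters (u : ℕ → Traj X A L) : ℕ → Counters X A
  | 0 => Counters.initial
  | t + 1 => (counters u t).step (u (t + 1))

/-- The empirical transition function. -/
def Counters.empirical (c : Counters X A) (x : X) (a : A) (x' : X) : ℝ :=
  (c.M x a x' : ℝ) / max 1 (c.N x a : ℝ)

/-- The confidence width `ε(x,a)`. -/
def Counters.width (c : Counters X A) (S : Layering X L) (T : ℕ) (δ : ℝ) (x : X) (a : A) : ℝ :=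
  Real.sqrt (2 * (S.size (S.layer x + 1) : ℝ) *
    Real.log ((T : ℝ) * Fintype.card A * Fintype.card X / δ) / max 1 (c.N x a : ℝ))

/-- The transition functions at `L¹`-distance at most `ε(x,a)` from the empirical one. -/
def Counters.confidenceSet (c : Counters X A) (S : Layering X L) (T : ℕ) (δ : ℝ) :
    Set (X → A → X → ℝ) :=
  {P | IsTransition S P ∧ ∀ x a, S.layer x < L →
    ∑ x', |P x a x' - c.empirical x a x'| ≤ c.width S T δ x a}

/-- The occupancy measures induced by the transition functions in the confidence set. -/
def Counters.domain (c : Counters X A) (S : Layering X L) (T : ℕ) (δ : ℝ) :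
    Set (X → A → X → ℝ) :=
  {q | ∃ P ∈ c.confidenceSet S T δ, q ∈ occupancySet S P}

/-! ### Mirror descent ingredients -/

/-- The initial iterate, uniform over the consecutive triples of each layer. -/
def uniformOccupancy (S : Layering X L) (x : X) (_a : A) (x' : X) : ℝ :=
  if S.layer x' = S.layer x + 1 then
    1 / ((S.size (S.layer x) : ℝ) * Fintype.card A * S.size (S.layer x + 1))
  else 0

/-- The mixing step: `(1 - θ) q(x,a) + θ / (|X_l| |A|)` with `l` the layer of `x`. -/
def mixing (S : Layering X L) (θ : ℝ) (q : X → A → X → ℝ) (x : X) (a : A) : ℝ :=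
  (1 - θ) * marginal q x a + θ * (1 / ((S.size (S.layer x) : ℝ) * Fintype.card A))

/-- The unnormalized Kullback-Leibler divergence `∑ p ln (p / p') - ∑ (p - p')` of
functions on state-action pairs (with `x` nonterminal). -/
def klDiv (S : Layering X L) (p p' : X → A → ℝ) : ℝ :=
  ∑ x, ∑ a, if S.layer x < L then
    p x a * Real.log (p x a / p' x a) - (p x a - p' x a) else 0

end Single

/-! ### The constrained Markov game -/

variable {X A Y B : Type*} [Fintype X] [Fintype A] [Fintype Y] [Fintype B] {L : ℕ}

/-- `⟨q₁ · q₂, r⟩`: the expected total reward over an episode. -/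
def reward (S₁ : Layering X L) (S₂ : Layering Y L)
    (q₁ : X → A → X → ℝ) (q₂ : Y → B → Y → ℝ) (r : X → Y → A → B → ℝ) : ℝ :=
  ∑ x, ∑ y, ∑ a, ∑ b, if S₁.layer x = S₂.layer y ∧ S₁.layer x < L then
    marginal q₁ x a * marginal q₂ y b * r x y a b else 0

variable (X A Y B L) in
/-- An episodic two-player zero-sum constrained Markov game with horizon `L`, independent
loop-free transitions, an arbitrary reward sequence (`r t` is the reward function of
episode `t ≥ 1`), mean utilities `g`, `h`, and a budget for the sum of the utilities. -/
structure Game where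
  S₁ : Layering X L
  S₂ : Layering Y L
  P₁ : X → A → X → ℝ
  P₂ : Y → B → Y → ℝ
  isTransition₁ : IsTransition S₁ P₁
  isTransition₂ : IsTransition S₂ P₂
  r : ℕ → X → Y → A → B → ℝ
  r_mem : ∀ t x y a b, r t x y a b ∈ Set.Icc (0 : ℝ) 1
  g : X → A → ℝ
  h : Y → B → ℝ
  budget : ℝ
  budget_pos : 0 < budget
  budget_le : budget ≤ 2 * L

/-- Joint feasibility `⟨q₁, g⟩ + ⟨q₂, h⟩ ≤ b` of a pair of occupancy measures. -/
def Game.Feasible (G : Game X A Y B L) (q₁ : X → A → X → ℝ) (q₂ : Y → B → Y → ℝ) : Prop :=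
  q₁ ∈ occupancySet G.S₁ G.P₁ ∧ q₂ ∈ occupancySet G.S₂ G.P₂ ∧
    utility G.S₁ q₁ G.g + utility G.S₂ q₂ G.h ≤ G.budget

/-- Feasibility with slack `ξ`. -/
def Game.StrictlyFeasible (G : Game X A Y B L) (ξ : ℝ) : Prop :=
  ∃ q₁ ∈ occupancySet G.S₁ G.P₁, ∃ q₂ ∈ occupancySet G.S₂ G.P₂,
    utility G.S₁ q₁ G.g + utility G.S₂ q₂ G.h + ξ ≤ G.budget

/-- `∑_{t=1}^T ⟨q₁ · q₂, r^t⟩`. -/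
def Game.totalReward (G : Game X A Y B L) (T : ℕ)
    (q₁ : X → A → X → ℝ) (q₂ : Y → B → Y → ℝ) : ℝ :=
  ∑ t ∈ Finset.Icc 1 T, reward G.S₁ G.S₂ q₁ q₂ (G.r t)

/-- Constrained Nash equilibrium in hindsight over `T` episodes: a feasible pair from which
no unilateral deviation that stays feasible is profitable. -/
structure Game.IsConstrainedNash (G : Game X A Y B L) (T : ℕ)
    (q₁ : X → A → X → ℝ) (q₂ : Y → B → Y → ℝ) : Prop where
  feasible : G.Feasible q₁ q₂
  min_player : ∀ q₁', G.Feasible q₁' q₂ → G.totalReward T q₁ q₂ ≤ G.totalReward T q₁' q₂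
  max_player : ∀ q₂', G.Feasible q₁ q₂' → G.totalReward T q₁ q₂' ≤ G.totalReward T q₁ q₂

/-! ### The algorithm -/

/-- The sequence `f` with its term of index `0` replaced by zero. -/
def zeroAtZero {E : Type*} [Zero E] (f : ℕ → E) (t : ℕ) : E := if t = 0 then 0 else f t

/-- The objective of the primal update, minimized over `q₁` and maximized over `q₂`, given
the iterates `p₁`, `p₂`, `lam` and the functions `r`, `g`, `h` of the preceding episode. -/
def primalObjective (S₁ : Layering X L) (S₂ : Layering Y L) (V η θ : ℝ)
    (r : X → Y → A → B → ℝ) (g : X → A → ℝ) (h : Y → B → ℝ)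
    (p₁ : X → A → X → ℝ) (p₂ : Y → B → Y → ℝ) (lam : ℝ)
    (q₁ : X → A → X → ℝ) (q₂ : Y → B → Y → ℝ) : ℝ :=
  V * (reward S₁ S₂ q₁ p₂ r + reward S₁ S₂ p₁ q₂ r)
    + lam * (utility S₁ q₁ g - utility S₂ q₂ h)
    + η⁻¹ * (klDiv S₁ (marginal q₁) (mixing S₁ θ p₁) - klDiv S₂ (marginal q₂) (mixing S₂ θ p₂))

/-- `UCB-CSAPO` over the episodes `1, …, T`. The sequences `r`, `g`, `h`, `u₁`, `u₂` are what
the players observe (reward and utility functions and trajectories of the episodes `t ≥ 1`;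
the functions of "episode 0" are zero); `q₁`, `q₂`, `lam` are the iterates of the algorithm.
In episode `t` the players execute `policy (q₁ t)` and `policy (q₂ t)`. -/
structure IsUCBCSAPO (S₁ : Layering X L) (S₂ : Layering Y L) (b : ℝ)
    (T : ℕ) (V η θ δ : ℝ)
    (r : ℕ → X → Y → A → B → ℝ) (g : ℕ → X → A → ℝ) (h : ℕ → Y → B → ℝ)
    (u₁ : ℕ → Traj X A L) (u₂ : ℕ → Traj Y B L)
    (q₁ : ℕ → X → A → X → ℝ) (q₂ : ℕ → Y → B → Y → ℝ) (lam : ℕ → ℝ) : Prop where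
  init₁ : q₁ 0 = uniformOccupancy S₁
  init₂ : q₂ 0 = uniformOccupancy S₂
  init_dual : lam 0 = 0
  mem₁ : ∀ t < T, q₁ (t + 1) ∈ (counters u₁ t).domain S₁ T δ
  mem₂ : ∀ t < T, q₂ (t + 1) ∈ (counters u₂ t).domain S₂ T δ
  primal : ∀ t < T,
    IsSaddlePointOn ((counters u₁ t).domain S₁ T δ) ((counters u₂ t).domain S₂ T δ)
      (primalObjective S₁ S₂ V η θ (zeroAtZero r t) (zeroAtZero g t) (zeroAtZero h t)
        (q₁ t) (q₂ t) (lam t))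
      (q₁ (t + 1)) (q₂ (t + 1))
  dual : ∀ t < T, lam (t + 1) = max (lam t +
    (utility S₁ (q₁ (t + 1)) (zeroAtZero g t) + utility S₂ (q₂ (t + 1)) (zeroAtZero h t) - b)) 0

/-! ### The interaction with the environment -/

/-- The random process generated when the players run `UCB-CSAPO` on the game `G`. In
episode `t` the environment draws the utility functions `g t`, `h t`, independently of
the past and with means `G.g`, `G.h`; the players execute the policies of `q₁ t`, `q₂ t`,
which are determined by the past; given the past and the utility functions of the episode,
the trajectories `u₁ t`, `u₂ t` are independent, with the laws given by the transitions. The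
filtration `ℱ t` is the information available after `t` episodes. -/
structure IsInteraction {Ω : Type*} {mΩ : MeasurableSpace Ω} (G : Game X A Y B L)
    (T : ℕ) (V η θ δ : ℝ) (μ : Measure Ω) (ℱ : Filtration ℕ mΩ)
    (g : ℕ → Ω → X → A → ℝ) (h : ℕ → Ω → Y → B → ℝ)
    (u₁ : ℕ → Ω → Traj X A L) (u₂ : ℕ → Ω → Traj Y B L)
    (q₁ : ℕ → Ω → X → A → X → ℝ) (q₂ : ℕ → Ω → Y → B → Y → ℝ) (lam : ℕ → Ω → ℝ) : Prop where
  /- the players follow the algorithm -/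
  algorithm : ∀ ω, IsUCBCSAPO G.S₁ G.S₂ G.budget T V η θ δ G.r
    (fun t => g t ω) (fun t => h t ω) (fun t => u₁ t ω) (fun t => u₂ t ω)
    (fun t => q₁ t ω) (fun t => q₂ t ω) (fun t => lam t ω)
  /- the iterates used in episode `t + 1` are known after episode `t` -/
  measurable_q₁ : ∀ t < T, Measurable[ℱ t] (q₁ (t + 1))
  measurable_q₂ : ∀ t < T, Measurable[ℱ t] (q₂ (t + 1))
  /- the observations of episode `t + 1` are known after it -/
  measurable_g : ∀ t < T, Measurable[ℱ (t + 1)] (g (t + 1))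
  measurable_h : ∀ t < T, Measurable[ℱ (t + 1)] (h (t + 1))
  measurable_u₁ : ∀ t < T, ∀ u, MeasurableSet[ℱ (t + 1)] {ω | u₁ (t + 1) ω = u}
  measurable_u₂ : ∀ t < T, ∀ u, MeasurableSet[ℱ (t + 1)] {ω | u₂ (t + 1) ω = u}
  /- stochastic utilities -/
  g_mem : ∀ t ω x a, g t ω x a ∈ Set.Icc (0 : ℝ) 1
  h_mem : ∀ t ω y b, h t ω y b ∈ Set.Icc (0 : ℝ) 1
  mean_g : ∀ t < T, ∀ x a, ∫ ω, g (t + 1) ω x a ∂μ = G.g x a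
  mean_h : ∀ t < T, ∀ y b, ∫ ω, h (t + 1) ω y b ∂μ = G.h y b
  indep : ∀ t < T, Indep
    (MeasurableSpace.comap (fun ω => (g (t + 1) ω, h (t + 1) ω)) inferInstance) (ℱ t) μ
  /- conditional law of the trajectories of an episode -/
  trajectories : ∀ t < T, ∀ E : Set Ω,
    MeasurableSet[ℱ t ⊔
      MeasurableSpace.comap (fun ω => (g (t + 1) ω, h (t + 1) ω)) inferInstance] E →
    ∀ (v₁ : Traj X A L) (v₂ : Traj Y B L),
      μ.real (E ∩ {ω | u₁ (t + 1) ω = v₁ ∧ u₂ (t + 1) ω = v₂}) =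
        ∫ ω in E, trajProb G.S₁ G.P₁ (policy (q₁ (t + 1) ω)) v₁ *
          trajProb G.S₂ G.P₂ (policy (q₂ (t + 1) ω)) v₂ ∂μ

/-! ### Performance measures -/

/-- `Regret(T)` against `(s₁, s₂)` of the policies `π t`, `ν t` played in the episodes `t`. -/
def Game.regret (G : Game X A Y B L) (T : ℕ) (s₁ : X → A → X → ℝ) (s₂ : Y → B → Y → ℝ)
    (π : ℕ → X → A → ℝ) (ν : ℕ → Y → B → ℝ) : ℝ :=
  ∑ t ∈ Finset.Icc 1 T,
    (reward G.S₁ G.S₂ (occupancy G.S₁ G.P₁ (π t)) s₂ (G.r t) -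
      reward G.S₁ G.S₂ s₁ (occupancy G.S₂ G.P₂ (ν t)) (G.r t))

/-- `Violation(T)` of the policies `π t`, `ν t` for the realized utility functions `g t`, `h t`. -/
def Game.violation (G : Game X A Y B L) (T : ℕ) (g : ℕ → X → A → ℝ) (h : ℕ → Y → B → ℝ)
    (π : ℕ → X → A → ℝ) (ν : ℕ → Y → B → ℝ) : ℝ :=
  max (∑ t ∈ Finset.Icc 1 T,
    (utility G.S₁ (occupancy G.S₁ G.P₁ (π t)) (g t) +
      utility G.S₂ (occupancy G.S₂ G.P₂ (ν t)) (h t) - G.budget)) 0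

end CMG

end

/-!
Regret and violation are bounded on an event of probability at least `1 - p`, on which the
comparators used below belong to the domain of every primal update.

*Mirror descent and cancellation.* A saddle point of the primal objective is a mirror descent step
of each player, for the losses `V ρ + lam g`, where `ρ` is the reward against the opponent's old
iterate. In the sum of the two inequalities the reward of the old pair of iterates cancels, and the
dual update contributes a difference of squares. For comparators `(c₁, c₂)` with divergence `D t`
from the mixed iterates this gives (`IsRun.primal_dual_step`)
`V (⟨q₁ᵗ · c₂, rᵗ⟩ - ⟨c₁ · q₂ᵗ, rᵗ⟩) + (lamₜ₊₁² - lamₜ²) / 2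
  ≤ lamₜ (⟨c₁, gᵗ⟩ + ⟨c₂, hᵗ⟩ - b) + T L (D t - D (t + 1)) + 12 L²`.
Mixing with the uniform distribution keeps `D` below `4 L log T`, and it also allows the optimality
of a step to be tested at a point of the segment towards the comparator instead of by a derivative
(`mirror_step`).

*The dual variable.* With the strictly feasible pair as comparator, the potential
`√(lam² + 2 T L D)` has drift of order `-ξ` wherever it is large. The noise of the utilities,
weighted by `lam` over the potential, obeys the Azuma-Hoeffding inequality on every window of
episodes, so that `lam` stays of order `L² √T log (T / p)` (`drift_bound`, `IsRun.lam_le`).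

*Regret and violation of the iterates.* Summing the step inequality for the equilibrium leaves the
noise of its utilities, weighted by the bounded dual variables (`IsRun.sum_reward_sub_le`). The dual
variable collects the violation up to the shift between consecutive iterates. This is of order
`η L (V + lam)` inside an epoch, and there are at most `3 |X||A| log T` epoch changes
(`IsRun.sum_utility_le`, `card_domain_changes_le`).

*Executed policies.* By Weissman's bound, a union of Hoeffding bounds over sign vectors, the true
transitions lie in all confidence sets (`IsPlayer.measureReal_not_mem_confidenceSet_le`). The
occupancy measure of the policy of `q₁ᵗ` then differs from `q₁ᵗ` by at most `L` times the expected
confidence radius along a trajectory (`l1Dist_occupancy_le`). The realized radii add up to order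
`|X| √(T |A|)` since no count more than doubles within an epoch (`sum_width_le`), and the expected
ones exceed them by a martingale (`IsPlayer.exists_bad_event`).
-/

noncomputable section

namespace CMG

/-! ### Layered distributions and the Kullback-Leibler divergence -/

section Layered

variable {X A : Type*} [Fintype X] [Fintype A] {L : ℕ}

/-- The state-action pairs whose state is not terminal. -/
def Layering.pairs (S : Layering X L) (A : Type*) [Fintype A] : Finset (X × A) :=
  Finset.univ.filter fun z => S.layer z.1 < L

/-- The state-action pairs whose state lies in layer `l`. -/
def Layering.pairsAt (S : Layering X L) (A : Type*) [Fintype A] (l : ℕ) : Finset (X × A) :=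
  Finset.univ.filter fun z => S.layer z.1 = l

@[simp] lemma Layering.mem_pairs {S : Layering X L} {z : X × A} :
    z ∈ S.pairs A ↔ S.layer z.1 < L := by simp [Layering.pairs]

@[simp] lemma Layering.mem_pairsAt {S : Layering X L} {l : ℕ} {z : X × A} :
    z ∈ S.pairsAt A l ↔ S.layer z.1 = l := by simp [Layering.pairsAt]

lemma sum_ite_lt_eq_sum_pairs (S : Layering X L) (f : X → A → ℝ) :
    (∑ x, ∑ a, if S.layer x < L then f x a else 0) = ∑ z ∈ S.pairs A, f z.1 z.2 := by
  rw [Layering.pairs, Finset.sum_filter, Fintype.sum_prod_type]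

lemma sum_ite_eq_eq_sum_pairsAt (S : Layering X L) (l : ℕ) (f : X → A → ℝ) :
    (∑ x, ∑ a, if S.layer x = l then f x a else 0) = ∑ z ∈ S.pairsAt A l, f z.1 z.2 := by
  rw [Layering.pairsAt, Finset.sum_filter, Fintype.sum_prod_type]

lemma sum_pairs_eq_sum_pairsAt (S : Layering X L) (f : X × A → ℝ) :
    ∑ z ∈ S.pairs A, f z = ∑ l ∈ Finset.range L, ∑ z ∈ S.pairsAt A l, f z := by
  rw [← Finset.sum_fiberwise_of_maps_to (s := S.pairs A) (t := Finset.range L)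
    (g := fun z => S.layer z.1) (by simp)]
  refine Finset.sum_congr rfl fun l hl => Finset.sum_congr ?_ fun _ _ => rfl
  ext z
  simp only [Finset.mem_filter, Layering.mem_pairs, Layering.mem_pairsAt, and_iff_right_iff_imp]
  rintro rfl
  simpa using hl

lemma Layering.card_pairsAt (S : Layering X L) (l : ℕ) :
    (S.pairsAt A l).card = S.size l * Fintype.card A := by
  have : S.pairsAt A l = (Finset.univ.filter fun x => S.layer x = l) ×ˢ Finset.univ := by
    ext z; simp
  rw [this, Finset.card_product]
  rfl

lemma utility_eq (S : Layering X L) (q : X → A → X → ℝ) (g : X → A → ℝ) :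
    utility S q g = ∑ z ∈ S.pairs A, marginal q z.1 z.2 * g z.1 z.2 :=
  sum_ite_lt_eq_sum_pairs S fun x a => marginal q x a * g x a

lemma klDiv_eq (S : Layering X L) (p p' : X → A → ℝ) :
    klDiv S p p' = ∑ z ∈ S.pairs A, (p z.1 z.2 * Real.log (p z.1 z.2 / p' z.1 z.2)
      - (p z.1 z.2 - p' z.1 z.2)) :=
  sum_ite_lt_eq_sum_pairs S fun x a => p x a * Real.log (p x a / p' x a) - (p x a - p' x a)

/-- Nonnegative functions on state-action pairs with total mass one in every layer `l < L`. -/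
structure IsLayered (S : Layering X L) (p : X → A → ℝ) : Prop where
  nonneg : ∀ x a, 0 ≤ p x a
  mass : ∀ l < L, ∑ z ∈ S.pairsAt A l, p z.1 z.2 = 1

/-- The `L¹`-distance over nonterminal state-action pairs. -/
def l1Dist (S : Layering X L) (p p' : X → A → ℝ) : ℝ :=
  ∑ z ∈ S.pairs A, |p z.1 z.2 - p' z.1 z.2|

variable {S : Layering X L} {p p' p'' : X → A → ℝ}

lemma l1Dist_nonneg : 0 ≤ l1Dist S p p' := Finset.sum_nonneg fun _ _ => abs_nonneg _

lemma l1Dist_comm (p p' : X → A → ℝ) : l1Dist S p p' = l1Dist S p' p := by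
  simp only [l1Dist, abs_sub_comm]

lemma l1Dist_triangle (p p' p'' : X → A → ℝ) :
    l1Dist S p p'' ≤ l1Dist S p p' + l1Dist S p' p'' := by
  rw [l1Dist, l1Dist, l1Dist, ← Finset.sum_add_distrib]
  exact Finset.sum_le_sum fun z _ => abs_sub_le _ _ _

lemma IsLayered.sum_pairs (hp : IsLayered S p) : ∑ z ∈ S.pairs A, p z.1 z.2 = L := by
  rw [sum_pairs_eq_sum_pairsAt, Finset.sum_congr rfl fun l hl => hp.mass l (by simpa using hl)]
  simp

lemma IsLayered.le_one (hp : IsLayered S p) {x : X} (hx : S.layer x < L) (a : A) :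
    p x a ≤ 1 := by
  rw [← hp.mass _ hx]
  exact Finset.single_le_sum (f := fun z : X × A => p z.1 z.2) (fun z _ => hp.nonneg z.1 z.2)
    (show (x, a) ∈ S.pairsAt A (S.layer x) by simp)

lemma l1Dist_le (hp : IsLayered S p) (hp' : IsLayered S p') : l1Dist S p p' ≤ 2 * L := by
  calc l1Dist S p p' ≤ ∑ z ∈ S.pairs A, (p z.1 z.2 + p' z.1 z.2) :=
        Finset.sum_le_sum fun z _ => abs_sub_le_iff.2
          ⟨by linarith [hp'.nonneg z.1 z.2], by linarith [hp.nonneg z.1 z.2]⟩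
    _ = 2 * L := by rw [Finset.sum_add_distrib, hp.sum_pairs, hp'.sum_pairs]; ring

/-- Between distributions of equal mass the correction term of the divergence cancels. -/
lemma klDiv_eq_of_isLayered (hp : IsLayered S p) (hp' : IsLayered S p') :
    klDiv S p p' = ∑ z ∈ S.pairs A, p z.1 z.2 * Real.log (p z.1 z.2 / p' z.1 z.2) := by
  rw [klDiv_eq, Finset.sum_sub_distrib, Finset.sum_sub_distrib, hp.sum_pairs, hp'.sum_pairs]
  ring

/-- A term of the divergence dominates the corresponding squared Hellinger distance. -/
lemma sq_sqrt_sub_sqrt_le {a b : ℝ} (ha : 0 ≤ a) (hb : 0 < b) :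
    (√a - √b) ^ 2 ≤ a * Real.log (a / b) - (a - b) := by
  rcases ha.eq_or_lt with rfl | ha
  · simp [Real.sq_sqrt hb.le]
  have hsa := Real.sqrt_pos.2 ha
  have hsb := Real.sqrt_pos.2 hb
  have h1 : Real.log (a / b) = 2 * Real.log (√a / √b) := by
    rw [← Real.sqrt_div ha.le, Real.log_sqrt (by positivity)]; ring
  have h2 := Real.one_sub_inv_le_log_of_pos (div_pos hsa hsb)
  have h3 : a * (1 - (√a / √b)⁻¹) = a - √a * √b := by
    rw [inv_div, mul_sub, mul_one]
    congr 1
    rw [mul_div_assoc', div_eq_iff hsa.ne']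
    nlinarith [Real.mul_self_sqrt ha.le]
  have h4 := mul_le_mul_of_nonneg_left h2 ha.le
  rw [h3] at h4
  rw [h1]
  nlinarith [Real.sq_sqrt ha.le, Real.sq_sqrt hb.le]

lemma klDiv_nonneg (hp : ∀ x a, 0 ≤ p x a) (hp' : ∀ x a, S.layer x < L → 0 < p' x a) :
    0 ≤ klDiv S p p' := by
  rw [klDiv_eq]
  refine Finset.sum_nonneg fun z hz => ?_
  exact (sq_nonneg _).trans
    (sq_sqrt_sub_sqrt_le (hp z.1 z.2) (hp' z.1 z.2 (Layering.mem_pairs.1 hz)))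

/-- A Pinsker inequality for layered distributions (with a suboptimal constant): the squared
Hellinger distance lies below the divergence, and Cauchy-Schwarz compares it with `L¹`. -/
lemma sq_l1Dist_le_klDiv (hp : IsLayered S p) (hp' : IsLayered S p')
    (hpos : ∀ x a, S.layer x < L → 0 < p' x a) :
    l1Dist S p p' ^ 2 ≤ 4 * L * klDiv S p p' := by
  have h1 : l1Dist S p p' = ∑ z ∈ S.pairs A,
      |√(p z.1 z.2) - √(p' z.1 z.2)| * (√(p z.1 z.2) + √(p' z.1 z.2)) := by
    refine Finset.sum_congr rfl fun z _ => ?_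
    have h : p z.1 z.2 - p' z.1 z.2 = (√(p z.1 z.2) - √(p' z.1 z.2)) *
        (√(p z.1 z.2) + √(p' z.1 z.2)) := by
      nlinarith [Real.mul_self_sqrt (hp.nonneg z.1 z.2), Real.mul_self_sqrt (hp'.nonneg z.1 z.2)]
    rw [h, abs_mul, abs_of_nonneg (add_nonneg (Real.sqrt_nonneg _) (Real.sqrt_nonneg _))]
  have h2 : ∑ z ∈ S.pairs A, |√(p z.1 z.2) - √(p' z.1 z.2)| ^ 2 ≤ klDiv S p p' := by
    rw [klDiv_eq]
    refine Finset.sum_le_sum fun z hz => ?_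
    rw [sq_abs]
    exact sq_sqrt_sub_sqrt_le (hp.nonneg _ _) (hpos z.1 z.2 (Layering.mem_pairs.1 hz))
  have h3 : ∑ z ∈ S.pairs A, (√(p z.1 z.2) + √(p' z.1 z.2)) ^ 2 ≤ 4 * L := by
    calc _ ≤ ∑ z ∈ S.pairs A, (2 * p z.1 z.2 + 2 * p' z.1 z.2) := by
          refine Finset.sum_le_sum fun z _ => ?_
          nlinarith [Real.sq_sqrt (hp.nonneg z.1 z.2), Real.sq_sqrt (hp'.nonneg z.1 z.2),
            sq_nonneg (√(p z.1 z.2) - √(p' z.1 z.2))]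
      _ = 4 * L := by
          rw [Finset.sum_add_distrib, ← Finset.mul_sum, ← Finset.mul_sum, hp.sum_pairs,
            hp'.sum_pairs]
          ring
  rw [h1]
  refine (Finset.sum_mul_sq_le_sq_mul_sq _ _ _).trans ?_
  rw [mul_comm]
  exact mul_le_mul h3 h2 (Finset.sum_nonneg fun _ _ => by positivity) (by positivity)

/-! ### The mixing step -/

lemma IsOccupancy.isLayered {q : X → A → X → ℝ} (hq : IsOccupancy S q) :
    IsLayered S (marginal q) where
  nonneg x a := Finset.sum_nonneg fun x' _ => (hq.mem_unit x a x').1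
  mass l hl := by
    rw [← sum_ite_eq_eq_sum_pairsAt, ← hq.mass l hl]
    refine Finset.sum_congr rfl fun x _ => Finset.sum_congr rfl fun a _ => ?_
    split_ifs <;> simp [marginal]

/-- The mixing step as an operation on state-action functions. -/
def mix (S : Layering X L) (θ : ℝ) (p : X → A → ℝ) (x : X) (a : A) : ℝ :=
  (1 - θ) * p x a + θ * (1 / ((S.size (S.layer x) : ℝ) * Fintype.card A))

lemma Layering.size_pos (S : Layering X L) (x : X) : 0 < S.size (S.layer x) :=
  Finset.card_pos.2 ⟨x, by simp⟩

lemma Layering.size_le_card (S : Layering X L) (l : ℕ) : S.size l ≤ Fintype.card X :=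
  Finset.card_le_univ _

/-- A layered distribution forces every layer and the action set to be nonempty. -/
lemma IsLayered.card_pos (hp : IsLayered S p) {l : ℕ} (hl : l < L) :
    0 < (S.size l : ℝ) * Fintype.card A := by
  have : (S.pairsAt A l).Nonempty := by
    by_contra h
    have h0 := hp.mass l hl
    rw [Finset.not_nonempty_iff_eq_empty.1 h] at h0
    simp at h0
  have := Finset.card_pos.2 this
  rw [S.card_pairsAt] at this
  exact_mod_cast this

lemma mix_pos (hp : IsLayered S p) {θ : ℝ} (h0 : 0 < θ) (h1 : θ ≤ 1) (x : X) (a : A)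
    (hx : S.layer x < L) : 0 < mix S θ p x a := by
  have h2 := hp.card_pos hx
  have h3 := mul_nonneg (sub_nonneg.2 h1) (hp.nonneg x a)
  have h4 : 0 < θ * (1 / ((S.size (S.layer x) : ℝ) * Fintype.card A)) := by positivity
  unfold mix
  linarith

lemma sum_pairsAt_uniform (hp : IsLayered S p) {l : ℕ} (hl : l < L) :
    ∑ z ∈ S.pairsAt A l, (1 / ((S.size (S.layer z.1) : ℝ) * Fintype.card A)) = 1 := by
  have h := hp.card_pos hl
  rw [Finset.sum_congr rfl (g := fun _ => 1 / ((S.size l : ℝ) * Fintype.card A))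
    fun z hz => by rw [Layering.mem_pairsAt.1 hz]]
  rw [Finset.sum_const, S.card_pairsAt, nsmul_eq_mul]
  push_cast
  rw [mul_one_div, div_self h.ne']

lemma IsLayered.mix (hp : IsLayered S p) {θ : ℝ} (h0 : 0 ≤ θ) (h1 : θ ≤ 1) :
    IsLayered S (mix S θ p) where
  nonneg x a := add_nonneg (mul_nonneg (sub_nonneg.2 h1) (hp.nonneg x a)) (by positivity)
  mass l hl := by
    simp only [CMG.mix]
    rw [Finset.sum_add_distrib, ← Finset.mul_sum, ← Finset.mul_sum, hp.mass l hl,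
      sum_pairsAt_uniform hp hl]
    ring

lemma isLayered_uniform (hp : IsLayered S p) :
    IsLayered S (fun (x : X) (_ : A) => 1 / ((S.size (S.layer x) : ℝ) * Fintype.card A)) where
  nonneg x a := by positivity
  mass l hl := sum_pairsAt_uniform hp hl

lemma l1Dist_mix_le (hp : IsLayered S p) {θ : ℝ} (h0 : 0 ≤ θ) :
    l1Dist S (mix S θ p) p ≤ 2 * θ * L := by
  have h : l1Dist S (mix S θ p) p = θ * l1Dist S
      (fun (x : X) (_ : A) => 1 / ((S.size (S.layer x) : ℝ) * Fintype.card A)) p := by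
    rw [l1Dist, l1Dist, Finset.mul_sum]
    refine Finset.sum_congr rfl fun z _ => ?_
    rw [← abs_of_nonneg h0, ← abs_mul, abs_of_nonneg h0]
    congr 1
    simp only [mix]
    ring
  rw [h]
  nlinarith [l1Dist_le (isLayered_uniform hp) hp]

lemma neg_log_one_sub_le {θ : ℝ} (h0 : 0 ≤ θ) (h1 : θ ≤ 1 / 2) : -Real.log (1 - θ) ≤ 2 * θ := by
  have h := Real.one_sub_inv_le_log_of_pos (x := 1 - θ) (by linarith)
  have h2 : (1 - θ)⁻¹ ≤ 1 + 2 * θ := by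
    rw [inv_le_iff_one_le_mul₀ (by linarith)]
    nlinarith
  linarith

/-- Replacing the reference `c` by some `r ≥ (1 - θ) c` increases the divergence from `q` by
at most `2θL`. -/
lemma sum_mul_log_div_le {q c r : X → A → ℝ} (hq : IsLayered S q) {θ : ℝ}
    (h0 : 0 ≤ θ) (h1 : θ ≤ 1 / 2) (hr : ∀ x a, S.layer x < L → 0 < r x a)
    (hc : ∀ x a, 0 < q x a → 0 < c x a) (hle : ∀ x a, S.layer x < L → (1 - θ) * c x a ≤ r x a) :
    ∑ z ∈ S.pairs A, q z.1 z.2 * Real.log (q z.1 z.2 / r z.1 z.2) ≤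
      ∑ z ∈ S.pairs A, q z.1 z.2 * Real.log (q z.1 z.2 / c z.1 z.2) + 2 * θ * L := by
  rw [← hq.sum_pairs, Finset.mul_sum, ← Finset.sum_add_distrib]
  refine Finset.sum_le_sum fun z hz => ?_
  rw [Layering.mem_pairs] at hz
  rcases (hq.nonneg z.1 z.2).eq_or_lt with h | h
  · simp [← h]
  have hcp := hc _ _ h
  have hrp := hr z.1 z.2 hz
  rw [Real.log_div h.ne' hrp.ne', Real.log_div h.ne' hcp.ne']
  have h2 : Real.log (1 - θ) + Real.log (c z.1 z.2) ≤ Real.log (r z.1 z.2) := by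
    rw [← Real.log_mul (by linarith) hcp.ne']
    exact Real.log_le_log (mul_pos (by linarith) hcp) (hle _ _ hz)
  have h3 := neg_log_one_sub_le h0 h1
  nlinarith

lemma klDiv_mix_self_le (hp : IsLayered S p) {θ : ℝ} (h0 : 0 < θ) (h1 : θ ≤ 1 / 2) :
    klDiv S p (mix S θ p) ≤ 2 * θ * L := by
  rw [klDiv_eq_of_isLayered hp (hp.mix h0.le (by linarith))]
  refine (sum_mul_log_div_le hp h0.le h1 (fun x a hx => mix_pos hp h0 (by linarith) x a hx)
    (c := p) (fun _ _ h => h) ?_).trans ?_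
  · intro x a hx
    simp only [mix, le_add_iff_nonneg_right]
    positivity
  · refine le_of_eq (add_eq_right.2 (Finset.sum_eq_zero fun z _ => ?_))
    rcases (hp.nonneg z.1 z.2).eq_or_lt with h | h
    · simp [← h]
    · simp [div_self h.ne']

/-- The divergence to a mixed distribution is at most logarithmic. -/
lemma klDiv_mix_le {q : X → A → ℝ} (hq : IsLayered S q) (hp : IsLayered S p) {T : ℕ}
    (hT : 0 < T) (hcard : Fintype.card X * Fintype.card A ≤ T) :
    klDiv S q (mix S (1 / T) p) ≤ 2 * L * Real.log T := by
  have hT' : (1 : ℝ) ≤ T := by exact_mod_cast hT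
  have h1 : (1 / (T : ℝ)) ≤ 1 := by rw [div_le_one (by linarith)]; exact hT'
  have h0 : 0 < 1 / (T : ℝ) := by positivity
  rw [klDiv_eq_of_isLayered hq (hp.mix h0.le h1), mul_comm (2 : ℝ), mul_assoc,
    ← hq.sum_pairs, Finset.sum_mul]
  refine Finset.sum_le_sum fun z hz => ?_
  rw [Layering.mem_pairs] at hz
  rcases (hq.nonneg z.1 z.2).eq_or_lt with h | h
  · simp [← h]
  refine mul_le_mul_of_nonneg_left ?_ h.le
  have hmp := mix_pos hp h0 h1 z.1 z.2 hz
  rw [← Real.log_rpow (by linarith)]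
  refine Real.log_le_log (by positivity) ?_
  rw [div_le_iff₀ hmp]
  have hs := hp.card_pos hz
  have h3 : 1 / (T : ℝ) * (1 / T) ≤ mix S (1 / T) p z.1 z.2 := by
    have h4 : (S.size (S.layer z.1) : ℝ) * Fintype.card A ≤ T := by
      have : S.size (S.layer z.1) * Fintype.card A ≤ T :=
        (Nat.mul_le_mul_right _ (S.size_le_card _)).trans hcard
      exact_mod_cast this
    have h5 : 1 / (T : ℝ) ≤ 1 / ((S.size (S.layer z.1) : ℝ) * Fintype.card A) :=
      one_div_le_one_div_of_le hs h4
    have h6 := mul_nonneg (sub_nonneg.2 h1) (hp.nonneg z.1 z.2)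
    have h7 := mul_le_mul_of_nonneg_left h5 h0.le
    simp only [mix]
    linarith
  have h8 : (T : ℝ) ^ (2 : ℝ) * (1 / (T : ℝ) * (1 / T)) = 1 := by
    rw [Real.rpow_two]; field_simp
  have h9 := mul_le_mul_of_nonneg_left h3 (show 0 ≤ (T : ℝ) ^ (2 : ℝ) by positivity)
  linarith [hq.le_one hz z.2]

/-! ### Expected utilities and rewards -/

lemma utility_sub_le {q q' : X → A → X → ℝ} {f : X → A → ℝ} {W : ℝ}
    (hf : ∀ x a, S.layer x < L → |f x a| ≤ W) :
    utility S q f - utility S q' f ≤ W * l1Dist S (marginal q) (marginal q') := by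
  rw [utility_eq, utility_eq, ← Finset.sum_sub_distrib, l1Dist, Finset.mul_sum]
  refine Finset.sum_le_sum fun z hz => ?_
  rw [← sub_mul]
  refine (le_abs_self _).trans ?_
  rw [abs_mul, mul_comm]
  exact mul_le_mul_of_nonneg_right (hf _ _ (Layering.mem_pairs.1 hz)) (abs_nonneg _)

lemma utility_nonneg {q : X → A → X → ℝ} {f : X → A → ℝ} (hq : IsLayered S (marginal q))
    (hf : ∀ x a, S.layer x < L → 0 ≤ f x a) : 0 ≤ utility S q f := by
  rw [utility_eq]
  exact Finset.sum_nonneg fun z hz =>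
    mul_nonneg (hq.nonneg _ _) (hf _ _ (Layering.mem_pairs.1 hz))

lemma utility_le {q : X → A → X → ℝ} {f : X → A → ℝ} (hq : IsLayered S (marginal q))
    (hf : ∀ x a, S.layer x < L → f x a ≤ 1) : utility S q f ≤ L := by
  rw [utility_eq, ← hq.sum_pairs]
  exact Finset.sum_le_sum fun z hz =>
    mul_le_of_le_one_right (hq.nonneg _ _) (hf _ _ (Layering.mem_pairs.1 hz))

lemma utility_add (q : X → A → X → ℝ) (f f' : X → A → ℝ) :
    utility S q (fun x a => f x a + f' x a) = utility S q f + utility S q f' := by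
  simp only [utility_eq, mul_add, Finset.sum_add_distrib]

lemma utility_const_mul (q : X → A → X → ℝ) (c : ℝ) (f : X → A → ℝ) :
    utility S q (fun x a => c * f x a) = c * utility S q f := by
  simp only [utility_eq, Finset.mul_sum]
  exact Finset.sum_congr rfl fun z _ => by ring

end Layered

section Reward

variable {X A Y B : Type*} [Fintype X] [Fintype A] [Fintype Y] [Fintype B] {L : ℕ}
  {S₁ : Layering X L} {S₂ : Layering Y L}

/-- The expected reward of the pairs `(x, a)` against the occupancy measure `q₂`. -/
def rewardAgainst₂ (S₁ : Layering X L) (S₂ : Layering Y L) (q₂ : Y → B → Y → ℝ)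
    (r : X → Y → A → B → ℝ) (x : X) (a : A) : ℝ :=
  ∑ w ∈ S₂.pairsAt B (S₁.layer x), marginal q₂ w.1 w.2 * r x w.1 a w.2

/-- The expected reward of the pairs `(y, b)` against the occupancy measure `q₁`. -/
def rewardAgainst₁ (S₁ : Layering X L) (S₂ : Layering Y L) (q₁ : X → A → X → ℝ)
    (r : X → Y → A → B → ℝ) (y : Y) (b : B) : ℝ :=
  ∑ z ∈ S₁.pairsAt A (S₂.layer y), marginal q₁ z.1 z.2 * r z.1 y z.2 b

lemma reward_eq_utility₁ (q₁ : X → A → X → ℝ) (q₂ : Y → B → Y → ℝ) (r : X → Y → A → B → ℝ) :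
    reward S₁ S₂ q₁ q₂ r = utility S₁ q₁ (rewardAgainst₂ S₁ S₂ q₂ r) := by
  unfold reward utility rewardAgainst₂
  refine Finset.sum_congr rfl fun x _ => ?_
  rw [Finset.sum_comm]
  refine Finset.sum_congr rfl fun a _ => ?_
  rw [← sum_ite_eq_eq_sum_pairsAt S₂ (S₁.layer x) fun y b => marginal q₂ y b * r x y a b]
  by_cases hx : S₁.layer x < L
  · simp only [hx, and_true, if_true, Finset.mul_sum, eq_comm (a := S₁.layer x), mul_ite, mul_zero,
      mul_assoc]
  · simp [hx]

lemma reward_eq_utility₂ (q₁ : X → A → X → ℝ) (q₂ : Y → B → Y → ℝ) (r : X → Y → A → B → ℝ) :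
    reward S₁ S₂ q₁ q₂ r = utility S₂ q₂ (rewardAgainst₁ S₁ S₂ q₁ r) := by
  unfold reward utility rewardAgainst₁
  rw [Finset.sum_comm]
  refine Finset.sum_congr rfl fun y _ => ?_
  simp only [Layering.pairsAt, Finset.sum_filter, Fintype.sum_prod_type]
  rw [Finset.sum_congr rfl fun x _ => Finset.sum_comm, Finset.sum_comm]
  refine Finset.sum_congr rfl fun b _ => ?_
  by_cases hy : S₂.layer y < L
  · simp only [hy, if_true, Finset.mul_sum, mul_ite, mul_zero]
    refine Finset.sum_congr rfl fun x _ => Finset.sum_congr rfl fun a _ => ?_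
    by_cases h : S₁.layer x = S₂.layer y
    · simp only [h, hy, and_self, if_true]; ring
    · simp [h]
  · simp only [hy, if_false]
    refine Finset.sum_eq_zero fun x _ => Finset.sum_eq_zero fun a _ => if_neg ?_
    rintro ⟨h, h'⟩
    exact hy (h ▸ h')

end Reward

lemma rewardAgainst₂_mem {X A Y B : Type*} [Fintype Y] [Fintype B] {L : ℕ}
    {S₁ : Layering X L} {S₂ : Layering Y L}
    {q₂ : Y → B → Y → ℝ} (hq : IsLayered S₂ (marginal q₂))
    {r : X → Y → A → B → ℝ} (hr : ∀ x y a b, r x y a b ∈ Set.Icc (0 : ℝ) 1) {x : X}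
    (hx : S₁.layer x < L) (a : A) : rewardAgainst₂ S₁ S₂ q₂ r x a ∈ Set.Icc (0 : ℝ) 1 := by
  constructor
  · exact Finset.sum_nonneg fun z _ => mul_nonneg (hq.nonneg _ _) (hr _ _ _ _).1
  · rw [← hq.mass _ hx]
    exact Finset.sum_le_sum fun z _ => mul_le_of_le_one_right (hq.nonneg _ _) (hr _ _ _ _).2

lemma rewardAgainst₁_mem {X A Y B : Type*} [Fintype X] [Fintype A] {L : ℕ}
    {S₁ : Layering X L} {S₂ : Layering Y L}
    {q₁ : X → A → X → ℝ} (hq : IsLayered S₁ (marginal q₁))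
    {r : X → Y → A → B → ℝ} (hr : ∀ x y a b, r x y a b ∈ Set.Icc (0 : ℝ) 1) {y : Y}
    (hy : S₂.layer y < L) (b : B) : rewardAgainst₁ S₁ S₂ q₁ r y b ∈ Set.Icc (0 : ℝ) 1 := by
  constructor
  · exact Finset.sum_nonneg fun z _ => mul_nonneg (hq.nonneg _ _) (hr _ _ _ _).1
  · rw [← hq.mass _ hy]
    exact Finset.sum_le_sum fun z _ => mul_le_of_le_one_right (hq.nonneg _ _) (hr _ _ _ _).2

/-! ### Convexity of the domains of the primal update -/

section Convexity

variable {X A : Type*} [Fintype X] [Fintype A] {L : ℕ} {S : Layering X L}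

/-- The segment `(1 - s) q + s q'` between two functions on triples. -/
def convexComb (s : ℝ) (q q' : X → A → X → ℝ) (x : X) (a : A) (x' : X) : ℝ :=
  (1 - s) * q x a x' + s * q' x a x'

lemma marginal_convexComb {X A : Type*} [Fintype X] (s : ℝ) (q q' : X → A → X → ℝ) (x : X) (a : A) :
    marginal (convexComb s q q') x a = (1 - s) * marginal q x a + s * marginal q' x a := by
  simp [marginal, convexComb, Finset.sum_add_distrib, Finset.mul_sum]

lemma utility_convexComb (s : ℝ) (q q' : X → A → X → ℝ) (f : X → A → ℝ) :
    utility S (convexComb s q q') f = (1 - s) * utility S q f + s * utility S q' f := by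
  simp only [utility_eq, marginal_convexComb, Finset.mul_sum, ← Finset.sum_add_distrib]
  exact Finset.sum_congr rfl fun _ _ => by ring

lemma IsOccupancy.convexComb {q q' : X → A → X → ℝ} (hq : IsOccupancy S q)
    (hq' : IsOccupancy S q') {s : ℝ} (h0 : 0 ≤ s) (h1 : s ≤ 1) :
    IsOccupancy S (convexComb s q q') where
  mem_unit x a x' := by
    obtain ⟨h2, h3⟩ := hq.mem_unit x a x'
    obtain ⟨h4, h5⟩ := hq'.mem_unit x a x'
    constructor
    · exact add_nonneg (mul_nonneg (by linarith) h2) (mul_nonneg h0 h4)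
    · unfold CMG.convexComb
      nlinarith
  support x a x' h := by
    by_contra hl
    have h2 : q x a x' = 0 := by_contra fun h => hl (hq.support x a x' h)
    have h3 : q' x a x' = 0 := by_contra fun h => hl (hq'.support x a x' h)
    exact h (by simp [CMG.convexComb, h2, h3])
  mass l hl := by
    have h2 := hq.mass l hl
    have h3 := hq'.mass l hl
    have : ∀ x a x', (if S.layer x = l then CMG.convexComb s q q' x a x' else 0) =
        (1 - s) * (if S.layer x = l then q x a x' else 0) +
          s * (if S.layer x = l then q' x a x' else 0) := by
      intro x a x'
      split_ifs <;> simp [CMG.convexComb]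
    simp only [this, Finset.sum_add_distrib, ← Finset.mul_sum, h2, h3]
    ring
  flow x' hx' hx'' := by
    simp only [CMG.convexComb, Finset.sum_add_distrib, ← Finset.mul_sum, hq.flow x' hx' hx'',
      hq'.flow x' hx' hx'']

lemma Counters.convexComb_mem_domain {c : Counters X A} {T : ℕ} {δ : ℝ}
    {q q' : X → A → X → ℝ} (hq : q ∈ c.domain S T δ) (hq' : q' ∈ c.domain S T δ) {s : ℝ}
    (h0 : 0 ≤ s) (h1 : s ≤ 1) : convexComb s q q' ∈ c.domain S T δ := by
  obtain ⟨P, ⟨hP, hPw⟩, hqo, hqP⟩ := hq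
  obtain ⟨P', ⟨hP', hPw'⟩, hqo', hqP'⟩ := hq'
  have hm := hqo.isLayered.nonneg
  have hm' := hqo'.isLayered.nonneg
  set w : X → A → ℝ := fun x a => (1 - s) * marginal q x a /
    ((1 - s) * marginal q x a + s * marginal q' x a) with hw
  have hs : 0 ≤ 1 - s := by linarith
  have hw0 : ∀ x a, 0 ≤ w x a := fun x a => div_nonneg (mul_nonneg hs (hm x a))
    (add_nonneg (mul_nonneg hs (hm x a)) (mul_nonneg h0 (hm' x a)))
  have hw1 : ∀ x a, 0 ≤ 1 - w x a := fun x a => sub_nonneg.2 (div_le_one_of_le₀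
    (le_add_of_nonneg_right (mul_nonneg h0 (hm' x a)))
    (add_nonneg (mul_nonneg hs (hm x a)) (mul_nonneg h0 (hm' x a))))
  refine ⟨fun x a x' => w x a * P x a x' + (1 - w x a) * P' x a x', ⟨⟨?_, ?_, ?_⟩, ?_⟩,
    hqo.convexComb hqo' h0 h1, ?_⟩
  · exact fun x a x' => add_nonneg (mul_nonneg (hw0 x a) (hP.nonneg x a x'))
      (mul_nonneg (hw1 x a) (hP'.nonneg x a x'))
  · intro x a hx
    simp only [Finset.sum_add_distrib, ← Finset.mul_sum, hP.sum_eq_one x a hx,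
      hP'.sum_eq_one x a hx]
    ring
  · intro x a x' h
    by_contra hl
    have h2 : P x a x' = 0 := le_antisymm (not_lt.1 fun h => hl (hP.loop_free x a x' h))
      (hP.nonneg x a x')
    have h3 : P' x a x' = 0 := le_antisymm (not_lt.1 fun h => hl (hP'.loop_free x a x' h))
      (hP'.nonneg x a x')
    simp [h2, h3] at h
  · intro x a hx
    calc ∑ x', |w x a * P x a x' + (1 - w x a) * P' x a x' - c.empirical x a x'|
        ≤ ∑ x', (w x a * |P x a x' - c.empirical x a x'| +
            (1 - w x a) * |P' x a x' - c.empirical x a x'|) := by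
          refine Finset.sum_le_sum fun x' _ => ?_
          rw [show w x a * P x a x' + (1 - w x a) * P' x a x' - c.empirical x a x' =
            w x a * (P x a x' - c.empirical x a x') +
              (1 - w x a) * (P' x a x' - c.empirical x a x') by ring]
          refine (abs_add_le _ _).trans ?_
          rw [abs_mul, abs_mul, abs_of_nonneg (hw0 x a), abs_of_nonneg (hw1 x a)]
      _ = w x a * ∑ x', |P x a x' - c.empirical x a x'| +
            (1 - w x a) * ∑ x', |P' x a x' - c.empirical x a x'| := by
          rw [Finset.sum_add_distrib, Finset.mul_sum, Finset.mul_sum]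
      _ ≤ w x a * c.width S T δ x a + (1 - w x a) * c.width S T δ x a :=
          add_le_add (mul_le_mul_of_nonneg_left (hPw x a hx) (hw0 x a))
            (mul_le_mul_of_nonneg_left (hPw' x a hx) (hw1 x a))
      _ = c.width S T δ x a := by ring
  · intro x a x'
    rw [marginal_convexComb, convexComb, hqP x a x', hqP' x a x']
    have ha := mul_nonneg hs (hm x a)
    have hb := mul_nonneg h0 (hm' x a)
    by_cases hd : (1 - s) * marginal q x a + s * marginal q' x a = 0
    · rw [hd, zero_mul, ← mul_assoc, ← mul_assoc, show (1 - s) * marginal q x a = 0 by linarith,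
        show s * marginal q' x a = 0 by linarith]
      ring
    · have h2 : ((1 - s) * marginal q x a + s * marginal q' x a) * w x a =
          (1 - s) * marginal q x a := mul_div_cancel₀ _ hd
      linear_combination (P' x a x' - P x a x') * h2

/-! ### The mirror descent step -/

lemma Counters.isLayered_of_mem_domain {c : Counters X A} {T : ℕ} {δ : ℝ}
    {q : X → A → X → ℝ} (hq : q ∈ c.domain S T δ) : IsLayered S (marginal q) := by
  obtain ⟨P, _, h, _⟩ := hq
  exact h.isLayered

variable {c : Counters X A} {T : ℕ} {δ η θ : ℝ} {p p' q : X → A → X → ℝ} {f : X → A → ℝ}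

/-- Mirror descent inequality for a step that starts from the mixture `mix S θ p`. Optimality of
`p'` is tested against the point at distance `s = θ / (|X||A|)` from `p'` on the segment towards
the comparator `q`. The divergence of `q` from that point exceeds its divergence from the next
mixture `mix S θ p'` by no more than `2θL`, so no derivative at the boundary is needed. -/
lemma mirror_step (hη : 0 < η) (h0 : 0 < θ) (h1 : θ ≤ 1 / 2)
    (hp : IsLayered S (marginal p)) (hp' : p' ∈ c.domain S T δ) (hq : q ∈ c.domain S T δ)
    (hmin : ∀ q ∈ c.domain S T δ,
      utility S p' f + η⁻¹ * klDiv S (marginal p') (mixing S θ p) ≤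
        utility S q f + η⁻¹ * klDiv S (marginal q) (mixing S θ p)) :
    utility S p' f + η⁻¹ * klDiv S (marginal p') (mixing S θ p) ≤
      utility S q f + η⁻¹ * (klDiv S (marginal q) (mixing S θ p) -
        klDiv S (marginal q) (mixing S θ p')) + η⁻¹ * (2 * θ * L) := by
  have hLp' := c.isLayered_of_mem_domain hp'
  have hLq := c.isLayered_of_mem_domain hq
  rcases Nat.eq_zero_or_pos L with rfl | hL
  · simp [utility_eq, klDiv_eq, Layering.pairs]
  have hstart : S.layer S.start < L := by rw [(S.layer_eq_zero_iff _).2 rfl]; exact hL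
  have hA : 0 < (Fintype.card A : ℝ) :=
    pos_of_mul_pos_right (hp.card_pos hstart) (Nat.cast_nonneg _)
  have hX : 0 < (Fintype.card X : ℝ) := by exact_mod_cast Fintype.card_pos_iff.2 ⟨S.start⟩
  have hX1 : (1 : ℝ) ≤ Fintype.card X := by exact_mod_cast Fintype.card_pos_iff.2 ⟨S.start⟩
  have hA1 : (1 : ℝ) ≤ Fintype.card A := by
    have : 0 < Fintype.card A := by exact_mod_cast hA
    exact_mod_cast this
  set s : ℝ := θ * (1 / ((Fintype.card X : ℝ) * Fintype.card A)) with hs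
  have hs0 : 0 < s := by positivity
  have hs1 : s ≤ θ := by
    rw [hs]
    refine mul_le_of_le_one_right h0.le ?_
    rw [div_le_one (by positivity)]
    nlinarith
  have hC := c.convexComb_mem_domain hp' hq hs0.le (by linarith : s ≤ 1)
  have hLC := c.isLayered_of_mem_domain hC
  have hLr : IsLayered S (mixing S θ p) := hp.mix h0.le (by linarith)
  have hr : ∀ x a, S.layer x < L → 0 < mixing S θ p x a := mix_pos hp h0 (by linarith)
  have hopt := hmin _ hC
  set C := marginal (convexComb s p' q) with hCdef
  have hCe : ∀ x a, C x a = (1 - s) * marginal p' x a + s * marginal q x a :=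
    marginal_convexComb s p' q
  -- The divergence of the intermediate point, by convexity along the segment.
  have hconv : klDiv S C (mixing S θ p) ≤ (1 - s) * klDiv S (marginal p') (mixing S θ p) +
      s * (klDiv S (marginal q) (mixing S θ p) -
        ∑ z ∈ S.pairs A, marginal q z.1 z.2 * Real.log (marginal q z.1 z.2 / C z.1 z.2)) := by
    have hz : ∑ z ∈ S.pairs A, (1 - s) * (C z.1 z.2 - marginal p' z.1 z.2) = 0 := by
      rw [← Finset.mul_sum, Finset.sum_sub_distrib, hLC.sum_pairs, hLp'.sum_pairs]
      ring
    rw [klDiv_eq_of_isLayered hLC hLr, klDiv_eq_of_isLayered hLp' hLr,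
      klDiv_eq_of_isLayered hLq hLr, ← add_zero ((1 - s) * _ + _), ← hz,
      ← Finset.sum_sub_distrib, Finset.mul_sum, Finset.mul_sum, ← Finset.sum_add_distrib,
      ← Finset.sum_add_distrib]
    refine Finset.sum_le_sum fun z hz => ?_
    rw [Layering.mem_pairs] at hz
    have hrz := hr z.1 z.2 hz
    have ha := hLp'.nonneg z.1 z.2
    have hb := hLq.nonneg z.1 z.2
    have hCz := hCe z.1 z.2
    set a := marginal p' z.1 z.2
    set b := marginal q z.1 z.2
    set r := mixing S θ p z.1 z.2
    set d := C z.1 z.2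
    have hs' : 0 < 1 - s := by linarith
    rcases (hLC.nonneg z.1 z.2).eq_or_lt with h | h
    · have hd : d = 0 := h.symm
      have ha0 : a = 0 := by
        have := mul_nonneg hs'.le ha
        have := mul_nonneg hs0.le hb
        have h5 : (1 - s) * a = 0 := by linarith
        rcases mul_eq_zero.1 h5 with h | h
        · linarith
        · exact h
      have hb0 : b = 0 := by
        have h5 : s * b = 0 := by rw [ha0] at hCz; linarith
        rcases mul_eq_zero.1 h5 with h | h
        · linarith
        · exact h
      simp [hd, ha0, hb0]
    · have h2 : a * Real.log (d / r) ≤ a * Real.log (a / r) - a + d := by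
        rcases ha.eq_or_lt with ha | ha
        · rw [← ha]; simp only [zero_mul, sub_zero, zero_add]; exact h.le
        have h3 := sq_sqrt_sub_sqrt_le ha.le h
        have h4 : Real.log (d / r) = Real.log (a / r) - Real.log (a / d) := by
          rw [Real.log_div h.ne' hrz.ne', Real.log_div ha.ne' hrz.ne',
            Real.log_div ha.ne' h.ne']
          ring
        rw [h4]
        nlinarith [sq_nonneg (√a - √d)]
      have h3 : b * Real.log (d / r) = b * Real.log (b / r) - b * Real.log (b / d) := by
        rcases hb.eq_or_lt with hb | hb
        · simp [← hb]
        rw [Real.log_div h.ne' hrz.ne', Real.log_div hb.ne' hrz.ne', Real.log_div hb.ne' h.ne']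
        ring
      have h4 : d * Real.log (d / r) =
          (1 - s) * (a * Real.log (d / r)) + s * (b * Real.log (d / r)) := by
        rw [hCz]; ring
      rw [h4, ← h3]
      nlinarith
  have hlast := sum_mul_log_div_le (r := mixing S θ p') (c := C) hLq h0.le h1
    (mix_pos hLp' h0 (by linarith)) (fun x a h => by
      rw [hCe]
      have := mul_nonneg (sub_nonneg.2 (by linarith : s ≤ 1)) (hLp'.nonneg x a)
      have := mul_pos hs0 h
      linarith) (fun x a hx => by
      rw [hCe]
      have h2 := hLq.le_one hx a
      have h3 := hLp'.nonneg x a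
      have h4 : s ≤ θ * (1 / ((S.size (S.layer x) : ℝ) * Fintype.card A)) := by
        refine mul_le_mul_of_nonneg_left (one_div_le_one_div_of_le (hp.card_pos hx) ?_) h0.le
        exact mul_le_mul_of_nonneg_right (by exact_mod_cast S.size_le_card _) hA.le
      have h5 := hLq.nonneg x a
      have h6 : s * marginal q x a ≤ s := mul_le_of_le_one_right hs0.le h2
      have h7 := mul_nonneg hs0.le h3
      have h8 := mul_nonneg hs0.le h5
      unfold mixing
      nlinarith [mul_nonneg h0.le h7, mul_nonneg h0.le h8])
  have hLm : IsLayered S (mixing S θ p') := hLp'.mix h0.le (by linarith)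
  rw [← klDiv_eq_of_isLayered hLq hLm] at hlast
  rw [utility_convexComb] at hopt
  have hη' : 0 < η⁻¹ := inv_pos.2 hη
  have h9 := mul_le_mul_of_nonneg_left hconv hη'.le
  have h10 := mul_le_mul_of_nonneg_left hlast hη'.le
  set Z := ∑ z ∈ S.pairs A, marginal q z.1 z.2 * Real.log (marginal q z.1 z.2 / C z.1 z.2)
  -- Both sides carry the factor `s`, the relative weight of the comparator in the test point.
  have h11 : s * (utility S p' f + η⁻¹ * klDiv S (marginal p') (mixing S θ p)) ≤
      s * (utility S q f + η⁻¹ * (klDiv S (marginal q) (mixing S θ p) - Z)) := by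
    linarith
  have h12 := le_of_mul_le_mul_left h11 hs0
  linarith

/-- Mirror descent step for a loss `V ρ + lam g` whose first part is charged at the old iterate
`p`, and the second at the new iterate `p'`. -/
lemma mirror_step_mixed_loss {V lam : ℝ} {ρ g : X → A → ℝ} (hV : 0 ≤ V) (hη : 0 < η)
    (h0 : 0 < θ) (h1 : θ ≤ 1 / 2) (hp : IsLayered S (marginal p)) (hp' : p' ∈ c.domain S T δ)
    (hq : q ∈ c.domain S T δ) (hρ : ∀ x a, S.layer x < L → |ρ x a| ≤ 1)
    (hmin : ∀ q ∈ c.domain S T δ,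
      utility S p' (fun x a => V * ρ x a + lam * g x a) +
          η⁻¹ * klDiv S (marginal p') (mixing S θ p) ≤
        utility S q (fun x a => V * ρ x a + lam * g x a) +
          η⁻¹ * klDiv S (marginal q) (mixing S θ p)) :
    V * utility S p ρ + lam * utility S p' g ≤
      V * utility S q ρ + lam * utility S q g + η⁻¹ * (klDiv S (marginal q) (mixing S θ p) -
        klDiv S (marginal q) (mixing S θ p')) +
        (η⁻¹ * (2 * θ * L) + V ^ 2 * L * η + 2 * V * θ * L) := by
  have h := mirror_step hη h0 h1 hp hp' hq hmin
  simp only [utility_add, utility_const_mul] at h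
  have hLp' := c.isLayered_of_mem_domain hp'
  have hLr : IsLayered S (mixing S θ p) := hp.mix h0.le (by linarith)
  have hpin := sq_l1Dist_le_klDiv hLp' hLr (mix_pos hp h0 (by linarith))
  set y := l1Dist S (marginal p') (mixing S θ p)
  set K := klDiv S (marginal p') (mixing S θ p)
  have h2 : utility S p ρ - utility S p' ρ ≤ y + 2 * θ * L := by
    refine (utility_sub_le hρ).trans ?_
    rw [one_mul, l1Dist_comm]
    exact (l1Dist_triangle _ (mixing S θ p) _).trans
      (add_le_add le_rfl (l1Dist_mix_le hp h0.le))
  have h3 : V * y ≤ V ^ 2 * L * η + η⁻¹ * K := by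
    rcases Nat.eq_zero_or_pos L with rfl | hL
    · have : y = 0 := by simp [y, l1Dist, Layering.pairs]
      have hK : K = 0 := by simp [K, klDiv_eq, Layering.pairs]
      simp [this, hK]
    have hL' : (0 : ℝ) < L := by exact_mod_cast hL
    have h4 : η * (V * y) * (4 * L) ≤ (V ^ 2 * L * η ^ 2 + K) * (4 * L) := by
      nlinarith [sq_nonneg (2 * L * V * η - y)]
    have h5 := le_of_mul_le_mul_right h4 (by positivity)
    have h6 : V * y = η⁻¹ * (η * (V * y)) := by field_simp
    rw [h6]
    refine (mul_le_mul_of_nonneg_left h5 (inv_pos.2 hη).le).trans (le_of_eq ?_)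
    field_simp
  have h4 := mul_le_mul_of_nonneg_left h2 hV
  linarith

/-- Consecutive iterates over the same domain are close. -/
lemma l1Dist_step_le {W : ℝ} (hη : 0 < η) (h0 : 0 < θ) (h1 : θ ≤ 1 / 2)
    (hp : p ∈ c.domain S T δ) (hp' : p' ∈ c.domain S T δ) (hW : 0 ≤ W)
    (hf : ∀ x a, S.layer x < L → |f x a| ≤ W)
    (hmin : ∀ q ∈ c.domain S T δ,
      utility S p' f + η⁻¹ * klDiv S (marginal p') (mixing S θ p) ≤
        utility S q f + η⁻¹ * klDiv S (marginal q) (mixing S θ p)) :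
    l1Dist S (marginal p) (marginal p') ≤ 6 * (L * η * W) + 7 * L * √θ := by
  have hLp := c.isLayered_of_mem_domain hp
  have hLp' := c.isLayered_of_mem_domain hp'
  have hLr : IsLayered S (mixing S θ p) := hLp.mix h0.le (by linarith)
  have hpin := sq_l1Dist_le_klDiv hLp' hLr (mix_pos hLp h0 (by linarith))
  have hself : klDiv S (marginal p) (mixing S θ p) ≤ 2 * θ * L := klDiv_mix_self_le hLp h0 h1
  have h2 := hmin p hp
  have h3 := utility_sub_le (q := p) (q' := p') hf
  have htri : l1Dist S (marginal p) (marginal p') ≤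
      l1Dist S (marginal p') (mixing S θ p) + 2 * θ * L := by
    rw [l1Dist_comm]
    exact (l1Dist_triangle _ (mixing S θ p) _).trans (add_le_add le_rfl (l1Dist_mix_le hLp h0.le))
  set y := l1Dist S (marginal p') (mixing S θ p)
  set K := klDiv S (marginal p') (mixing S θ p)
  have hy : 0 ≤ y := l1Dist_nonneg
  have hη' := inv_pos.2 hη
  have hK : K ≤ η * W * (y + 2 * θ * L) + 2 * θ * L := by
    have h4 : η⁻¹ * K ≤ W * (y + 2 * θ * L) + η⁻¹ * (2 * θ * L) := by
      have := mul_le_mul_of_nonneg_left htri hW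
      have := mul_le_mul_of_nonneg_left hself hη'.le
      linarith
    have h5 := mul_le_mul_of_nonneg_left h4 hη.le
    have h6 : η * (η⁻¹ * K) = K := by field_simp
    have h7 : η * (W * (y + 2 * θ * L) + η⁻¹ * (2 * θ * L)) =
      η * W * (y + 2 * θ * L) + 2 * θ * L := by field_simp
    linarith
  have hL0 : (0 : ℝ) ≤ L := Nat.cast_nonneg L
  set a := L * η * W with ha
  have ha0 : 0 ≤ a := by positivity
  have hy2 : y ^ 2 ≤ 4 * a * y + 8 * a * (θ * L) + 8 * θ * L ^ 2 := by
    have := mul_le_mul_of_nonneg_left hK (show (0 : ℝ) ≤ 4 * L by positivity)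
    rw [ha]
    linarith
  set t := √θ
  have ht : t ^ 2 = θ := Real.sq_sqrt h0.le
  have ht0 : 0 < t := Real.sqrt_pos.2 h0
  have ht1 : t ≤ 1 := by
    nlinarith
  have hθt : θ ≤ t := by nlinarith
  have hyb : y ≤ 6 * a + 5 * L * t := by
    by_contra hcon
    push Not at hcon
    have hb : 0 ≤ 5 * L * t := by positivity
    have h8 : (6 * a + 5 * L * t) * (2 * a + 5 * L * t) ≤ y * (y - 4 * a) :=
      mul_le_mul hcon.le (by linarith) (by positivity) hy
    have h9 : 8 * a * (θ * L) ≤ 4 * a ^ 2 + 4 * (θ * L) ^ 2 := by nlinarith [sq_nonneg (a - θ * L)]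
    have h10 : (θ * L) ^ 2 ≤ θ * L ^ 2 := by
      rw [mul_pow]
      exact mul_le_mul_of_nonneg_right (by nlinarith) (sq_nonneg _)
    have h11 : (5 * L * t) ^ 2 = 25 * (θ * L ^ 2) := by rw [← ht]; ring
    have h12 := mul_nonneg ha0 hb
    rcases hL0.eq_or_lt with hL1 | hL1
    · have : a = 0 := by rw [ha, ← hL1]; ring
      have hy0 : y ^ 2 ≤ 0 := by rw [this, ← hL1] at hy2; simpa using hy2
      have : y = 0 := by nlinarith
      rw [this] at hcon
      linarith
    · have h13 : 0 < θ * (L : ℝ) ^ 2 := by positivity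
      nlinarith [sq_nonneg a]
  have : θ * L ≤ t * L := mul_le_mul_of_nonneg_right hθt hL0
  linarith

end Convexity

/-! ### Runs of the algorithm -/

section Run

variable {X A Y B : Type*} [Fintype X] [Fintype A] [Fintype Y] [Fintype B] {L : ℕ}

/-- A single run of `UCB-CSAPO` with `V = L √T`, `η = 1 / (T L)`, `θ = 1 / T`, on observations
with values in `[0, 1]`. -/
structure IsRun (S₁ : Layering X L) (S₂ : Layering Y L) (b : ℝ) (T : ℕ) (δ : ℝ)
    (r : ℕ → X → Y → A → B → ℝ) (g : ℕ → X → A → ℝ) (h : ℕ → Y → B → ℝ)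
    (u₁ : ℕ → Traj X A L) (u₂ : ℕ → Traj Y B L)
    (q₁ : ℕ → X → A → X → ℝ) (q₂ : ℕ → Y → B → Y → ℝ) (lam : ℕ → ℝ) : Prop where
  algorithm : IsUCBCSAPO S₁ S₂ b T (L * √T) (1 / (T * L)) (1 / T) δ r g h u₁ u₂ q₁ q₂ lam
  horizon_pos : 0 < L
  two_le : 2 ≤ T
  card₁ : Fintype.card X * Fintype.card A ≤ T
  card₂ : Fintype.card Y * Fintype.card B ≤ T
  r_mem : ∀ t x y a b, r t x y a b ∈ Set.Icc (0 : ℝ) 1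
  g_mem : ∀ t x a, g t x a ∈ Set.Icc (0 : ℝ) 1
  h_mem : ∀ t y b, h t y b ∈ Set.Icc (0 : ℝ) 1
  budget_nonneg : 0 ≤ b
  budget_le : b ≤ 2 * L

lemma zeroAtZero_cases {E : Type*} [Zero E] (f : ℕ → E) (t : ℕ) :
    zeroAtZero f t = 0 ∨ zeroAtZero f t = f t := by
  unfold zeroAtZero; split_ifs <;> simp

lemma zeroAtZero_succ {E : Type*} [Zero E] (f : ℕ → E) (t : ℕ) :
    zeroAtZero f (t + 1) = f (t + 1) := rfl

lemma zeroAtZero_mem_unit {X A : Type*} {f : ℕ → X → A → ℝ}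
    (hf : ∀ t x a, f t x a ∈ Set.Icc (0 : ℝ) 1)
    (t : ℕ) (x : X) (a : A) : zeroAtZero f t x a ∈ Set.Icc (0 : ℝ) 1 := by
  rcases zeroAtZero_cases f t with h | h <;> rw [h]
  · simp
  · exact hf t x a

/-- The marginal of the initial iterate is uniform in every layer. -/
lemma isLayered_uniformOccupancy {S : Layering X L} {p : X → A → ℝ} (hp : IsLayered S p) :
    IsLayered S (marginal (uniformOccupancy S : X → A → X → ℝ)) where
  nonneg x a := Finset.sum_nonneg fun x' _ => by
    unfold uniformOccupancy; split_ifs <;> positivity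
  mass l hl := by
    rw [← sum_pairsAt_uniform hp hl]
    refine Finset.sum_congr rfl fun z hz => ?_
    rw [Layering.mem_pairsAt] at hz
    have hpos : 0 < S.size (l + 1) := by
      rcases (Nat.succ_le_of_lt hl).eq_or_lt with h | h
      · have h2 : S.layer S.terminal = l + 1 := ((S.layer_eq_last_iff _).2 rfl).trans h.symm
        rw [← h2]
        exact S.size_pos _
      · exact Nat.pos_of_ne_zero fun h0 => by simpa [h0] using hp.card_pos h
    have h1 := hp.card_pos hl
    simp only [marginal, uniformOccupancy]
    rw [← Finset.sum_filter, Finset.sum_const, hz, nsmul_eq_mul]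
    change (S.size (l + 1) : ℝ) * _ = _
    have h2 : (S.size (l + 1) : ℝ) ≠ 0 := by exact_mod_cast hpos.ne'
    have h3 := left_ne_zero_of_mul h1.ne'
    have h4 := right_ne_zero_of_mul h1.ne'
    field_simp

variable {S₁ : Layering X L} {S₂ : Layering Y L} {b : ℝ} {T : ℕ} {δ : ℝ}
  {r : ℕ → X → Y → A → B → ℝ} {g : ℕ → X → A → ℝ} {h : ℕ → Y → B → ℝ}
  {u₁ : ℕ → Traj X A L} {u₂ : ℕ → Traj Y B L}
  {q₁ : ℕ → X → A → X → ℝ} {q₂ : ℕ → Y → B → Y → ℝ} {lam : ℕ → ℝ}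

namespace IsRun

lemma layered₁ (run : IsRun S₁ S₂ b T δ r g h u₁ u₂ q₁ q₂ lam)
    {t : ℕ} (ht : t ≤ T) : IsLayered S₁ (marginal (q₁ t)) := by
  cases t with
  | zero =>
    rw [run.algorithm.init₁]
    exact isLayered_uniformOccupancy
      ((counters u₁ 0).isLayered_of_mem_domain
        (run.algorithm.mem₁ 0 (by have := run.two_le; omega)))
  | succ t => exact (counters u₁ t).isLayered_of_mem_domain (run.algorithm.mem₁ t (by omega))

lemma layered₂ (run : IsRun S₁ S₂ b T δ r g h u₁ u₂ q₁ q₂ lam)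
    {t : ℕ} (ht : t ≤ T) : IsLayered S₂ (marginal (q₂ t)) := by
  cases t with
  | zero =>
    rw [run.algorithm.init₂]
    exact isLayered_uniformOccupancy
      ((counters u₂ 0).isLayered_of_mem_domain
        (run.algorithm.mem₂ 0 (by have := run.two_le; omega)))
  | succ t => exact (counters u₂ t).isLayered_of_mem_domain (run.algorithm.mem₂ t (by omega))

lemma lam_nonneg (run : IsRun S₁ S₂ b T δ r g h u₁ u₂ q₁ q₂ lam)
    {t : ℕ} (ht : t ≤ T) : 0 ≤ lam t := by
  cases t with
  | zero => rw [run.algorithm.init_dual]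
  | succ t => rw [run.algorithm.dual t (by omega)]; exact le_max_right _ _

lemma r_zero_mem (run : IsRun S₁ S₂ b T δ r g h u₁ u₂ q₁ q₂ lam)
    (t : ℕ) (x : X) (y : Y) (a : A) (b : B) :
    zeroAtZero r t x y a b ∈ Set.Icc (0 : ℝ) 1 := by
  rcases zeroAtZero_cases r t with h | h <;> rw [h]
  · simp
  · exact run.r_mem t x y a b

lemma primal₁ (run : IsRun S₁ S₂ b T δ r g h u₁ u₂ q₁ q₂ lam)
    {t : ℕ} (ht : t < T) : ∀ q ∈ (counters u₁ t).domain S₁ T δ,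
    utility S₁ (q₁ (t + 1)) (fun x a => L * √T *
        rewardAgainst₂ S₁ S₂ (q₂ t) (zeroAtZero r t) x a + lam t * zeroAtZero g t x a) +
        (1 / (T * L : ℝ))⁻¹ * klDiv S₁ (marginal (q₁ (t + 1))) (mixing S₁ (1 / T) (q₁ t)) ≤
      utility S₁ q (fun x a => L * √T *
        rewardAgainst₂ S₁ S₂ (q₂ t) (zeroAtZero r t) x a + lam t * zeroAtZero g t x a) +
        (1 / (T * L : ℝ))⁻¹ * klDiv S₁ (marginal q) (mixing S₁ (1 / T) (q₁ t)) := by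
  intro q hq
  have h := run.algorithm.primal t ht q hq _ (run.algorithm.mem₂ t ht)
  simp only [primalObjective] at h
  simp only [utility_add, utility_const_mul, ← reward_eq_utility₁]
  change _ + lam t * utility S₁ _ (zeroAtZero g t) + _ ≤
    _ + lam t * utility S₁ _ (zeroAtZero g t) + _
  linarith

lemma primal₂ (run : IsRun S₁ S₂ b T δ r g h u₁ u₂ q₁ q₂ lam)
    {t : ℕ} (ht : t < T) : ∀ q ∈ (counters u₂ t).domain S₂ T δ,
    utility S₂ (q₂ (t + 1)) (fun y b => L * √T *
        (-1 * rewardAgainst₁ S₁ S₂ (q₁ t) (zeroAtZero r t) y b) + lam t * zeroAtZero h t y b) +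
        (1 / (T * L : ℝ))⁻¹ * klDiv S₂ (marginal (q₂ (t + 1))) (mixing S₂ (1 / T) (q₂ t)) ≤
      utility S₂ q (fun y b => L * √T *
        (-1 * rewardAgainst₁ S₁ S₂ (q₁ t) (zeroAtZero r t) y b) + lam t * zeroAtZero h t y b) +
        (1 / (T * L : ℝ))⁻¹ * klDiv S₂ (marginal q) (mixing S₂ (1 / T) (q₂ t)) := by
  intro q hq
  have h' := run.algorithm.primal t ht _ (run.algorithm.mem₁ t ht) q hq
  simp only [primalObjective] at h'
  simp only [utility_add, utility_const_mul, ← reward_eq_utility₂]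
  change _ + lam t * utility S₂ _ (zeroAtZero h t) + _ ≤
    _ + lam t * utility S₂ _ (zeroAtZero h t) + _
  linarith

/-- The parameters make every error term of one mirror descent step of order `L²`. -/
lemma step_error_le (run : IsRun S₁ S₂ b T δ r g h u₁ u₂ q₁ q₂ lam) :
    (1 / (T * L : ℝ))⁻¹ * (2 * (1 / (T : ℝ)) * L) +
    (L * √T) ^ 2 * L * (1 / (T * L : ℝ)) + 2 * (L * √T) * (1 / (T : ℝ)) * L ≤ 5 * (L : ℝ) ^ 2 := by
  have hL : (0 : ℝ) < L := by exact_mod_cast run.horizon_pos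
  have hT : (2 : ℝ) ≤ T := by exact_mod_cast run.two_le
  have hT0 : (0 : ℝ) < T := by linarith
  have h1 : (1 / (T * L : ℝ))⁻¹ * (2 * (1 / (T : ℝ)) * L) = 2 * (L : ℝ) ^ 2 := by
    field_simp
  have h2 : (L * √T) ^ 2 * L * (1 / (T * L : ℝ)) = (L : ℝ) ^ 2 := by
    rw [mul_pow, Real.sq_sqrt hT0.le]; field_simp
  have h3 : 2 * (L * √T) * (1 / (T : ℝ)) * L ≤ 2 * (L : ℝ) ^ 2 := by
    have : √(T : ℝ) * (1 / T) ≤ 1 := by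
      rw [mul_one_div, div_le_one hT0]
      exact Real.sqrt_le_iff.2 ⟨hT0.le, by nlinarith⟩
    nlinarith [mul_le_mul_of_nonneg_left this (show (0 : ℝ) ≤ 2 * L ^ 2 by positivity)]
  linarith

/-- One step of both players and of the dual variable, against a comparator `(c₁, c₂)` in the
current domains. The two reward terms `⟨q₁ᵗ · q₂ᵗ, r⟩` of the players cancel. -/
lemma primal_dual_step (run : IsRun S₁ S₂ b T δ r g h u₁ u₂ q₁ q₂ lam)
    {c₁ : X → A → X → ℝ} {c₂ : Y → B → Y → ℝ} {t : ℕ} (ht : t < T)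
    (hc₁ : c₁ ∈ (counters u₁ t).domain S₁ T δ) (hc₂ : c₂ ∈ (counters u₂ t).domain S₂ T δ) :
    L * √T * (reward S₁ S₂ (q₁ t) c₂ (zeroAtZero r t) - reward S₁ S₂ c₁ (q₂ t) (zeroAtZero r t)) +
        (lam (t + 1) ^ 2 - lam t ^ 2) / 2 ≤
      lam t * (utility S₁ c₁ (zeroAtZero g t) + utility S₂ c₂ (zeroAtZero h t) - b) +
        T * L * ((klDiv S₁ (marginal c₁) (mixing S₁ (1 / T) (q₁ t)) +
            klDiv S₂ (marginal c₂) (mixing S₂ (1 / T) (q₂ t))) -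
          (klDiv S₁ (marginal c₁) (mixing S₁ (1 / T) (q₁ (t + 1))) +
            klDiv S₂ (marginal c₂) (mixing S₂ (1 / T) (q₂ (t + 1))))) +
        12 * (L : ℝ) ^ 2 := by
  have hL : (0 : ℝ) < L := by exact_mod_cast run.horizon_pos
  have hT : (2 : ℝ) ≤ T := by exact_mod_cast run.two_le
  have hT0 : (0 : ℝ) < T := by linarith
  have hη : (0 : ℝ) < 1 / (T * L) := by positivity
  have hθ0 : (0 : ℝ) < 1 / T := by positivity
  have hθ1 : (1 : ℝ) / T ≤ 1 / 2 := one_div_le_one_div_of_le (by norm_num) hT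
  have hV : (0 : ℝ) ≤ L * √T := by positivity
  have hl₁ := run.layered₁ ht.le
  have hl₂ := run.layered₂ ht.le
  have h1 := mirror_step_mixed_loss hV hη hθ0 hθ1 hl₁ (run.algorithm.mem₁ t ht) hc₁
    (fun x a hx => by
      have := rewardAgainst₂_mem hl₂ (run.r_zero_mem t) hx a
      rw [abs_of_nonneg this.1]; exact this.2) (run.primal₁ ht)
  have h2 := mirror_step_mixed_loss hV hη hθ0 hθ1 hl₂ (run.algorithm.mem₂ t ht) hc₂
    (fun y b hy => by
      have := rewardAgainst₁_mem hl₁ (run.r_zero_mem t) hy b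
      rw [abs_mul, abs_of_nonneg this.1]; simpa using this.2) (run.primal₂ ht)
  simp only [utility_const_mul, ← reward_eq_utility₁, ← reward_eq_utility₂] at h1 h2
  have hinv : (1 / (T * L : ℝ))⁻¹ = T * L := by rw [one_div, inv_inv]
  have h3 := run.step_error_le
  rw [hinv] at h1 h2 h3
  -- The increment of the dual variable is at most `2 L`, so its square costs only order `L²`.
  have hd := run.algorithm.dual t ht
  have hl₁' := run.layered₁ (Nat.succ_le_of_lt ht)
  have hl₂' := run.layered₂ (Nat.succ_le_of_lt ht)
  have hg := zeroAtZero_mem_unit run.g_mem t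
  have hh := zeroAtZero_mem_unit run.h_mem t
  have e1 := utility_nonneg hl₁' fun x a _ => (hg x a).1
  have e2 := utility_le hl₁' fun x a _ => (hg x a).2
  have e3 := utility_nonneg hl₂' fun x a _ => (hh x a).1
  have e4 := utility_le hl₂' fun x a _ => (hh x a).2
  have e5 := run.budget_le
  have e6 := run.budget_nonneg
  set y := utility S₁ (q₁ (t + 1)) (zeroAtZero g t) + utility S₂ (q₂ (t + 1)) (zeroAtZero h t) - b
    with hy
  have h4 : lam (t + 1) ^ 2 ≤ (lam t + y) ^ 2 := by
    rw [hd]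
    rcases le_total (lam t + y) 0 with h | h
    · rw [max_eq_right h]; nlinarith
    · rw [max_eq_left h]
  have h5 : y ^ 2 ≤ 4 * (L : ℝ) ^ 2 := by
    nlinarith [mul_nonneg (show 0 ≤ 2 * (L : ℝ) - y by linarith)
      (show 0 ≤ 2 * (L : ℝ) + y by linarith)]
  have h6 : lam t * y = lam t * utility S₁ (q₁ (t + 1)) (zeroAtZero g t) +
    lam t * utility S₂ (q₂ (t + 1)) (zeroAtZero h t) - lam t * b := by rw [hy]; ring
  nlinarith

lemma klDiv_le₁ (run : IsRun S₁ S₂ b T δ r g h u₁ u₂ q₁ q₂ lam)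
    {c : X → A → ℝ} (hc : IsLayered S₁ c) {t : ℕ} (ht : t ≤ T) :
    klDiv S₁ c (mixing S₁ (1 / T) (q₁ t)) ≤ 2 * L * Real.log T :=
  klDiv_mix_le hc (run.layered₁ ht) (by have := run.two_le; omega) run.card₁

lemma klDiv_le₂ (run : IsRun S₁ S₂ b T δ r g h u₁ u₂ q₁ q₂ lam)
    {c : Y → B → ℝ} (hc : IsLayered S₂ c) {t : ℕ} (ht : t ≤ T) :
    klDiv S₂ c (mixing S₂ (1 / T) (q₂ t)) ≤ 2 * L * Real.log T :=
  klDiv_mix_le hc (run.layered₂ ht) (by have := run.two_le; omega) run.card₂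

lemma klDiv_nonneg₁ (run : IsRun S₁ S₂ b T δ r g h u₁ u₂ q₁ q₂ lam)
    {c : X → A → ℝ} (hc : IsLayered S₁ c) {t : ℕ} (ht : t ≤ T) :
    0 ≤ klDiv S₁ c (mixing S₁ (1 / T) (q₁ t)) := by
  have hT : (2 : ℝ) ≤ T := by exact_mod_cast run.two_le
  exact klDiv_nonneg hc.nonneg (mix_pos (run.layered₁ ht) (by positivity)
    (by rw [div_le_one (by linarith)]; linarith))

lemma klDiv_nonneg₂ (run : IsRun S₁ S₂ b T δ r g h u₁ u₂ q₁ q₂ lam)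
    {c : Y → B → ℝ} (hc : IsLayered S₂ c) {t : ℕ} (ht : t ≤ T) :
    0 ≤ klDiv S₂ c (mixing S₂ (1 / T) (q₂ t)) := by
  have hT : (2 : ℝ) ≤ T := by exact_mod_cast run.two_le
  exact klDiv_nonneg hc.nonneg (mix_pos (run.layered₂ ht) (by positivity)
    (by rw [div_le_one (by linarith)]; linarith))

end IsRun

/-! ### The drift of the dual variable -/

/-- A process with negative drift above the level `b₀`, whose noise is weighted by
`lam / Φ ≤ 1` and concentrates on every time window, stays of order `b₀ + a² ι / ξ`. -/
lemma drift_bound {Φ lam n : ℕ → ℝ} {T : ℕ} {a ξ b₀ K ι : ℝ} (hξ : 0 < ξ) (ha : 0 ≤ a)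
    (hb₀ : 0 < b₀) (hι : 0 ≤ ι) (hξa : ξ ≤ 2 * a) (hK : 2 * K ≤ ξ * b₀)
    (hΦ : ∀ t ≤ T, 0 ≤ Φ t) (hlam : ∀ t ≤ T, 0 ≤ lam t) (hle : ∀ t ≤ T, lam t ≤ Φ t)
    (hhalf : ∀ t ≤ T, b₀ ≤ Φ t → Φ t ≤ 2 * lam t) (hn : ∀ t < T, |n t| ≤ a)
    (hinit : Φ 0 ≤ b₀)
    (hstep : ∀ t < T, Φ (t + 1) ^ 2 ≤ Φ t ^ 2 + 2 * (lam t * (n t - ξ)) + K)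
    (hconc : ∀ s t, s ≤ t → t ≤ T →
      ∑ i ∈ Finset.Ico s t, lam i / Φ i * n i ≤ a * √(2 * (t - s : ℕ) * ι)) :
    ∀ t ≤ T, Φ t ≤ b₀ + 2 * a + 2 * a ^ 2 * ι / ξ := by
  -- Here `s` follows the last time before `t` with `Φ ≤ b₀`, or is zero; from then on every step
  -- has a drift of at most `-ξ / 4`.
  have key : ∀ t ≤ T, ∃ s ≤ t, Φ s ≤ b₀ + 2 * a ∧
      Φ t ≤ Φ s + ∑ i ∈ Finset.Ico s t, lam i / Φ i * n i - (t - s : ℕ) * (ξ / 4) := by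
    intro t
    induction t with
    | zero => intro _; exact ⟨0, le_rfl, by linarith, by simp⟩
    | succ t ih =>
      intro ht
      have h1 := hstep t (by omega)
      have h2 := hΦ t (by omega)
      have h3 := hΦ (t + 1) ht
      have h4 := hlam t (by omega)
      have h5 := hle t (by omega)
      have h6 := abs_le.1 (hn t (by omega))
      rcases le_or_gt (Φ t) b₀ with hcase | hcase
      · refine ⟨t + 1, le_rfl, ?_, by simp⟩
        have h7 : lam t * (n t - ξ) ≤ b₀ * a :=
          (mul_le_mul_of_nonneg_left (by linarith : n t - ξ ≤ a) h4).trans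
            (mul_le_mul_of_nonneg_right (by linarith) ha)
        have h8 : K ≤ a * b₀ := by nlinarith
        have h9 : Φ (t + 1) ^ 2 ≤ (b₀ + 2 * a) ^ 2 := by nlinarith
        exact abs_le_of_sq_le_sq' h9 (by positivity) |>.2
      · obtain ⟨s, hs, hs1, hs2⟩ := ih (by omega)
        refine ⟨s, by omega, hs1, ?_⟩
        have hpos : 0 < Φ t := by linarith
        have h7 : Φ (t + 1) ≤ Φ t + lam t / Φ t * n t - ξ / 4 := by
          have h8 : lam t / Φ t * n t = lam t * n t / Φ t := by ring
          rw [h8, ← sub_nonneg]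
          have h9 : Φ t + lam t * n t / Φ t - ξ / 4 - Φ (t + 1) =
            (2 * Φ t ^ 2 + 2 * (lam t * n t) - ξ / 2 * Φ t - 2 * Φ t * Φ (t + 1)) /
              (2 * Φ t) := by field_simp; ring
          rw [h9]
          refine div_nonneg ?_ (by positivity)
          have h10 := hhalf t (by omega) hcase.le
          nlinarith [sq_nonneg (Φ t - Φ (t + 1))]
        rw [Finset.sum_Ico_succ_top hs, show t + 1 - s = (t - s) + 1 by omega]
        push_cast
        linarith
  intro t ht
  obtain ⟨s, hs, h1, h2⟩ := key t ht
  have h3 := hconc s t hs ht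
  -- The drift absorbs the noise, whatever the length of the window.
  have h4 : a * √(2 * (t - s : ℕ) * ι) - (t - s : ℕ) * (ξ / 4) ≤ 2 * a ^ 2 * ι / ξ := by
    set m : ℝ := ((t - s : ℕ) : ℝ)
    have hm : (0 : ℝ) ≤ m := Nat.cast_nonneg _
    set z := √(2 * m * ι)
    have hz : z ^ 2 = 2 * m * ι := Real.sq_sqrt (by positivity)
    have hz0 : 0 ≤ z := Real.sqrt_nonneg _
    rw [le_div_iff₀ hξ]
    rcases hι.eq_or_lt with h0 | h0
    · have : z = 0 := by
        have : z ^ 2 = 0 := by rw [hz, ← h0]; ring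
        exact pow_eq_zero_iff (two_ne_zero) |>.1 this
      rw [this, ← h0]
      nlinarith [mul_nonneg hm (mul_nonneg hξ.le hξ.le)]
    · have h5 : (a * z - m * (ξ / 4)) * ξ * (8 * ι) ≤ 2 * a ^ 2 * ι * (8 * ι) := by
        have h6 : z ^ 2 * ξ ^ 2 = 2 * m * ι * ξ ^ 2 := by rw [hz]
        linarith [sq_nonneg (4 * a * ι - z * ξ)]
      exact le_of_mul_le_mul_right h5 (by positivity)
  linarith

end Run

/-! ### The iterates of a run -/

section RunBounds

variable {X A Y B : Type*} [Fintype X] [Fintype A] [Fintype Y] [Fintype B] {L : ℕ}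

/-- The Lyapunov function `√(lam² + 2 η⁻¹ D)` of the dual variable, where `D` is the divergence of
the comparator `(c₁, c₂)` from the mixed iterates. -/
def dualPotential (S₁ : Layering X L) (S₂ : Layering Y L) (T : ℕ) (c₁ : X → A → X → ℝ)
    (c₂ : Y → B → Y → ℝ) (p₁ : X → A → X → ℝ) (p₂ : Y → B → Y → ℝ) (lam : ℝ) : ℝ :=
  √(lam ^ 2 + 2 * (T * L) * (klDiv S₁ (marginal c₁) (mixing S₁ (1 / T) p₁) +
    klDiv S₂ (marginal c₂) (mixing S₂ (1 / T) p₂)))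

variable {S₁ : Layering X L} {S₂ : Layering Y L} {b : ℝ} {T : ℕ} {δ : ℝ}
  {r : ℕ → X → Y → A → B → ℝ} {g : ℕ → X → A → ℝ} {h : ℕ → Y → B → ℝ}
  {u₁ : ℕ → Traj X A L} {u₂ : ℕ → Traj Y B L}
  {q₁ : ℕ → X → A → X → ℝ} {q₂ : ℕ → Y → B → Y → ℝ} {lam : ℕ → ℝ}
  {c₁ : X → A → X → ℝ} {c₂ : Y → B → Y → ℝ}

lemma reward_nonneg (hc₁ : IsLayered S₁ (marginal c₁)) (hc₂ : IsLayered S₂ (marginal c₂))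
    {r : X → Y → A → B → ℝ} (hr : ∀ x y a b, r x y a b ∈ Set.Icc (0 : ℝ) 1) :
    0 ≤ reward S₁ S₂ c₁ c₂ r := by
  rw [reward_eq_utility₁]
  exact utility_nonneg hc₁ fun x a hx => (rewardAgainst₂_mem hc₂ hr hx a).1

lemma reward_le (hc₁ : IsLayered S₁ (marginal c₁)) (hc₂ : IsLayered S₂ (marginal c₂))
    {r : X → Y → A → B → ℝ} (hr : ∀ x y a b, r x y a b ∈ Set.Icc (0 : ℝ) 1) :
    reward S₁ S₂ c₁ c₂ r ≤ L := by
  rw [reward_eq_utility₁]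
  exact utility_le hc₁ fun x a hx => (rewardAgainst₂_mem hc₂ hr hx a).2

namespace IsRun

lemma log_two_le (run : IsRun S₁ S₂ b T δ r g h u₁ u₂ q₁ q₂ lam) : 0.69 ≤ Real.log T := by
  have h1 := Real.log_two_gt_d9
  have h2 := Real.log_le_log (by norm_num : (0 : ℝ) < 2)
    (by exact_mod_cast run.two_le : (2 : ℝ) ≤ T)
  linarith

/-- The dual variable stays of order `L² √T log (T / p)`, by strict feasibility. -/
lemma lam_le (run : IsRun S₁ S₂ b T δ r g h u₁ u₂ q₁ q₂ lam) {m ξ ι ι₀ : ℝ} (hξ : 0 < ξ)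
    (hm : 0 ≤ m) (hmξ : m + ξ ≤ b)
    (hc₁ : ∀ t < T, c₁ ∈ (counters u₁ t).domain S₁ T δ)
    (hc₂ : ∀ t < T, c₂ ∈ (counters u₂ t).domain S₂ T δ)
    (hι : Real.log T ≤ ι) (hι₀ : 0 ≤ ι₀) (hιι : ι₀ ≤ 6 * ι)
    (hconc : ∀ s t, s ≤ t → t ≤ T → ∑ i ∈ Finset.Ico s t,
      lam i / dualPotential S₁ S₂ T c₁ c₂ (q₁ i) (q₂ i) (lam i) *
        (utility S₁ c₁ (zeroAtZero g i) + utility S₂ c₂ (zeroAtZero h i) - m) ≤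
        2 * L * √(2 * (t - s : ℕ) * ι₀)) :
    ∀ t ≤ T, lam t ≤ (10 + 125 / ξ) * (L ^ 2 * √T * ι) := by
  have hL : (1 : ℝ) ≤ L := by exact_mod_cast run.horizon_pos
  have hT : (2 : ℝ) ≤ T := by exact_mod_cast run.two_le
  have hT2 := run.two_le
  have hLc₁ := (counters u₁ 0).isLayered_of_mem_domain (hc₁ 0 (by omega))
  have hLc₂ := (counters u₂ 0).isLayered_of_mem_domain (hc₂ 0 (by omega))
  have hlog := run.log_two_le
  have hι1 : 0.69 ≤ ι := by linarith
  have hs1 : 1 ≤ √(T : ℝ) := Real.one_le_sqrt.2 (by linarith)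
  have hsT : √(T : ℝ) ^ 2 = T := Real.sq_sqrt (by linarith)
  set s := √(T : ℝ)
  set D : ℕ → ℝ := fun t => klDiv S₁ (marginal c₁) (mixing S₁ (1 / T) (q₁ t)) +
    klDiv S₂ (marginal c₂) (mixing S₂ (1 / T) (q₂ t)) with hD
  set Φ : ℕ → ℝ := fun t => dualPotential S₁ S₂ T c₁ c₂ (q₁ t) (q₂ t) (lam t) with hΦ
  have hD0 : ∀ t ≤ T, 0 ≤ D t := fun t ht =>
    add_nonneg (run.klDiv_nonneg₁ hLc₁ ht) (run.klDiv_nonneg₂ hLc₂ ht)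
  have hD1 : ∀ t ≤ T, D t ≤ 4 * L * Real.log T := fun t ht => by
    have := run.klDiv_le₁ hLc₁ ht
    have := run.klDiv_le₂ hLc₂ ht
    simp only [hD]
    linarith
  have hΦ2 : ∀ t ≤ T, Φ t ^ 2 = lam t ^ 2 + 2 * (T * L) * D t := fun t ht =>
    Real.sq_sqrt (add_nonneg (sq_nonneg _) (mul_nonneg (by positivity) (hD0 t ht)))
  have hTD : ∀ t ≤ T, 2 * (T * L) * D t ≤ 8 * (T * L ^ 2 * ι) := fun t ht => by
    have h1 := mul_le_mul_of_nonneg_left ((hD1 t ht).trans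
      (mul_le_mul_of_nonneg_left hι (by positivity))) (show (0 : ℝ) ≤ 2 * (T * L) by positivity)
    linarith
  have hle : ∀ t ≤ T, lam t ≤ Φ t := fun t ht => Real.le_sqrt_of_sq_le
    (le_add_of_nonneg_right (mul_nonneg (by positivity) (hD0 t ht)))
  -- The threshold dominates both the drift error and the divergence part of the potential.
  set b₀ : ℝ := L ^ 2 * s * (52 / ξ + 4 * ι) with hb₀
  have hb₀1 : 4 * (L ^ 2 * s * ι) ≤ b₀ := by
    have : 0 ≤ L ^ 2 * s * (52 / ξ) := by positivity
    rw [hb₀, mul_add]; linarith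
  have hb₀2 : 11 * (T * L ^ 2 * ι) ≤ b₀ ^ 2 := by
    have h1 : (4 * (L ^ 2 * s * ι)) ^ 2 ≤ b₀ ^ 2 := pow_le_pow_left₀ (by positivity) hb₀1 2
    have h2 : (4 * (L ^ 2 * s * ι)) ^ 2 = 16 * (L ^ 2 * ι) * (T * L ^ 2 * ι) := by
      rw [← hsT]; ring
    have h3 : 0.69 ≤ (L : ℝ) ^ 2 * ι := by nlinarith
    have h4 : 0 ≤ T * (L : ℝ) ^ 2 * ι := by positivity
    nlinarith
  have hb₀pos : 0 < b₀ := by positivity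
  have hbound := drift_bound (Φ := Φ) (lam := lam)
    (n := fun t => utility S₁ c₁ (zeroAtZero g t) + utility S₂ c₂ (zeroAtZero h t) - m)
    (T := T) (a := 2 * L) (b₀ := b₀) (K := 26 * (L ^ 2 * s)) (ι := ι₀) hξ (by positivity)
    hb₀pos hι₀ (by have := run.budget_le; linarith) (by
      rw [hb₀]
      have : ξ * (L ^ 2 * s * (52 / ξ + 4 * ι)) = L ^ 2 * s * (52 + 4 * ι * ξ) := by
        field_simp
      rw [this]
      have : 0 ≤ L ^ 2 * s * (4 * ι * ξ) := by positivity
      linarith) (fun t _ => Real.sqrt_nonneg _) (fun t ht => run.lam_nonneg ht) hle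
    (fun t ht hb => by
      have h1 := hΦ2 t ht
      have h2 := hTD t ht
      have h3 : b₀ ^ 2 ≤ Φ t ^ 2 := pow_le_pow_left₀ hb₀pos.le hb 2
      have h5 : 0 ≤ T * (L : ℝ) ^ 2 * ι := by positivity
      have h4 : Φ t ^ 2 ≤ (2 * lam t) ^ 2 := by nlinarith
      exact (abs_le_of_sq_le_sq' h4 (by have := run.lam_nonneg ht; positivity)).2)
    (fun t ht => by
      have e1 := utility_nonneg hLc₁ fun x a _ => (zeroAtZero_mem_unit run.g_mem t x a).1
      have e2 := utility_le hLc₁ fun x a _ => (zeroAtZero_mem_unit run.g_mem t x a).2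
      have e3 := utility_nonneg hLc₂ fun x a _ => (zeroAtZero_mem_unit run.h_mem t x a).1
      have e4 := utility_le hLc₂ fun x a _ => (zeroAtZero_mem_unit run.h_mem t x a).2
      have e5 := run.budget_le
      rw [abs_le]
      constructor <;> linarith)
    (by
      have h1 := hΦ2 0 (by omega)
      have h2 := hTD 0 (by omega)
      rw [run.algorithm.init_dual] at h1
      have h5 : 0 ≤ T * (L : ℝ) ^ 2 * ι := by positivity
      exact (abs_le_of_sq_le_sq' (by nlinarith : Φ 0 ^ 2 ≤ b₀ ^ 2) hb₀pos.le).2)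
    (fun t ht => by
      have h1 := hΦ2 t ht.le
      have h2 := hΦ2 (t + 1) ht
      have h3 := run.primal_dual_step ht (hc₁ t ht) (hc₂ t ht)
      have h4 := reward_nonneg (run.layered₁ ht.le) hLc₂ (run.r_zero_mem t)
      have h5 := reward_le hLc₁ (run.layered₂ ht.le) (run.r_zero_mem t)
      have h6 : -(L : ℝ) * (L * s) ≤ L * s * (reward S₁ S₂ (q₁ t) c₂ (zeroAtZero r t) -
          reward S₁ S₂ c₁ (q₂ t) (zeroAtZero r t)) := by
        rw [mul_comm]
        exact mul_le_mul_of_nonneg_left (by linarith) (by positivity)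
      -- The slack of the comparator is the source of the negative drift.
      have h7 : lam t * (utility S₁ c₁ (zeroAtZero g t) + utility S₂ c₂ (zeroAtZero h t) - b) ≤
          lam t * (utility S₁ c₁ (zeroAtZero g t) + utility S₂ c₂ (zeroAtZero h t) - m - ξ) :=
        mul_le_mul_of_nonneg_left (by linarith) (run.lam_nonneg ht.le)
      have h8 : (L : ℝ) ^ 2 ≤ L ^ 2 * s := le_mul_of_one_le_right (by positivity) hs1
      change _ + _ ≤ _ + T * L * (D t - D (t + 1)) + _ at h3
      rw [h1, h2]
      linarith) hconc
  intro t ht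
  refine (hle t ht).trans ((hbound t ht).trans ?_)
  have h1 : 2 * (2 * (L : ℝ)) ≤ 6 * (L ^ 2 * s * ι) := by
    have : (L : ℝ) ≤ L ^ 2 * s := by nlinarith
    nlinarith
  have h2 : 2 * (2 * (L : ℝ)) ^ 2 * ι₀ / ξ ≤ 48 / ξ * (L ^ 2 * s * ι) := by
    rw [div_mul_eq_mul_div]
    refine div_le_div_of_nonneg_right ?_ hξ.le
    have h3 : (L : ℝ) ^ 2 * ι ≤ L ^ 2 * s * ι :=
      mul_le_mul_of_nonneg_right (le_mul_of_one_le_right (by positivity) hs1) (by linarith)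
    have h4 := mul_le_mul_of_nonneg_left hιι (show (0 : ℝ) ≤ 8 * L ^ 2 by positivity)
    linarith
  have h3 : L ^ 2 * s * (52 / ξ) ≤ 76 / ξ * (L ^ 2 * s * ι) := by
    have h4 : 52 ≤ 76 * ι := by linarith
    have h5 := mul_le_mul_of_nonneg_left h4 (show (0 : ℝ) ≤ L ^ 2 * s / ξ by positivity)
    calc _ = L ^ 2 * s / ξ * 52 := by ring
      _ ≤ _ := h5
      _ = _ := by ring
  have h4 : (10 + 125 / ξ) * (L ^ 2 * s * ι) =
      10 * (L ^ 2 * s * ι) + 48 / ξ * (L ^ 2 * s * ι) + 76 / ξ * (L ^ 2 * s * ι) +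
        1 / ξ * (L ^ 2 * s * ι) := by ring
  have h5 : 0 ≤ 1 / ξ * (L ^ 2 * s * ι) := by positivity
  rw [h4, hb₀, mul_add]
  linarith

/-- The regret of the iterates, up to the noise `N` of the utilities. -/
lemma sum_reward_sub_le (run : IsRun S₁ S₂ b T δ r g h u₁ u₂ q₁ q₂ lam) {N : ℝ}
    (hc₁ : ∀ t < T, c₁ ∈ (counters u₁ t).domain S₁ T δ)
    (hc₂ : ∀ t < T, c₂ ∈ (counters u₂ t).domain S₂ T δ)
    (hN : ∑ t ∈ Finset.range T, lam t *
      (utility S₁ c₁ (zeroAtZero g t) + utility S₂ c₂ (zeroAtZero h t) - b) ≤ L * √T * N) :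
    ∑ t ∈ Finset.Icc 1 T, (reward S₁ S₂ (q₁ t) c₂ (r t) - reward S₁ S₂ c₁ (q₂ t) (r t)) ≤
      N + 4 * (L * √T) * Real.log T + 12 * (L * √T) + L := by
  have hL : (1 : ℝ) ≤ L := by exact_mod_cast run.horizon_pos
  have hT : (2 : ℝ) ≤ T := by exact_mod_cast run.two_le
  have hT2 := run.two_le
  have hLc₁ := (counters u₁ 0).isLayered_of_mem_domain (hc₁ 0 (by omega))
  have hLc₂ := (counters u₂ 0).isLayered_of_mem_domain (hc₂ 0 (by omega))
  have hsT : √(T : ℝ) ^ 2 = T := Real.sq_sqrt (by linarith)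
  have hs0 : 0 < √(T : ℝ) := Real.sqrt_pos.2 (by linarith)
  set s := √(T : ℝ)
  set D : ℕ → ℝ := fun t => klDiv S₁ (marginal c₁) (mixing S₁ (1 / T) (q₁ t)) +
    klDiv S₂ (marginal c₂) (mixing S₂ (1 / T) (q₂ t)) with hD
  set R : ℕ → ℝ := fun t => reward S₁ S₂ (q₁ t) c₂ (zeroAtZero r t) -
    reward S₁ S₂ c₁ (q₂ t) (zeroAtZero r t) with hR
  have h1 : ∑ t ∈ Finset.range T, (L * s * R t + (lam (t + 1) ^ 2 - lam t ^ 2) / 2) ≤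
      ∑ t ∈ Finset.range T, (lam t *
        (utility S₁ c₁ (zeroAtZero g t) + utility S₂ c₂ (zeroAtZero h t) - b) +
        T * L * (D t - D (t + 1)) + 12 * (L : ℝ) ^ 2) := by
    refine Finset.sum_le_sum fun t ht => ?_
    have ht := Finset.mem_range.1 ht
    exact run.primal_dual_step ht (hc₁ t ht) (hc₂ t ht)
  rw [Finset.sum_add_distrib, ← Finset.mul_sum, ← Finset.sum_div, Finset.sum_range_sub
    (fun t => lam t ^ 2), Finset.sum_add_distrib, Finset.sum_add_distrib, ← Finset.mul_sum,
    Finset.sum_range_sub' D, Finset.sum_const, Finset.card_range, nsmul_eq_mul,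
    run.algorithm.init_dual] at h1
  have hD0 : 0 ≤ D T := add_nonneg (run.klDiv_nonneg₁ hLc₁ le_rfl) (run.klDiv_nonneg₂ hLc₂ le_rfl)
  have hD1 : D 0 ≤ 4 * L * Real.log T := by
    have := run.klDiv_le₁ hLc₁ (t := 0) (by omega)
    have := run.klDiv_le₂ hLc₂ (t := 0) (by omega)
    simp only [hD]
    linarith
  have h2 : T * L * (D 0 - D T) ≤ L * s * (4 * (L * s) * Real.log T) := by
    have := mul_le_mul_of_nonneg_left (by linarith : D 0 - D T ≤ 4 * L * Real.log T)
      (show (0 : ℝ) ≤ T * L by positivity)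
    calc _ ≤ _ := this
      _ = _ := by rw [← hsT]; ring
  have h3 : L * s * ∑ t ∈ Finset.range T, R t ≤
      L * s * (N + 4 * (L * s) * Real.log T + 12 * (L * s)) := by
    have : (T : ℝ) * (12 * L ^ 2) = L * s * (12 * (L * s)) := by rw [← hsT]; ring
    have := sq_nonneg (lam T)
    linarith
  have h4 := le_of_mul_le_mul_left h3 (by positivity)
  -- The zeroth reward vanishes, and the last episode costs at most `L`.
  have h5 : ∑ t ∈ Finset.Icc 1 T,
      (reward S₁ S₂ (q₁ t) c₂ (r t) - reward S₁ S₂ c₁ (q₂ t) (r t)) =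
      ∑ t ∈ Finset.range (T + 1), R t := by
    rw [Finset.sum_range_succ', Finset.range_eq_Ico, Finset.sum_Ico_add' R 0 T 1]
    have : R 0 = 0 := by simp [hR, zeroAtZero, reward]
    rw [this, add_zero]
    refine Finset.sum_congr (by ext; simp) fun t ht => ?_
    obtain ⟨k, rfl⟩ : ∃ k, t = k + 1 := ⟨t - 1, by simp at ht; omega⟩
    rfl
  rw [h5, Finset.sum_range_succ]
  have h6 : R T ≤ L := by
    have e1 := reward_le (run.layered₁ le_rfl) hLc₂ (run.r_zero_mem T)
    have e2 := reward_nonneg hLc₁ (run.layered₂ le_rfl) (run.r_zero_mem T)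
    simp only [hR]
    linarith
  linarith

open Classical in
/-- The violation of the iterates: the dual variable collects it up to the shift between
`qᵗ` and `qᵗ⁺¹`, which is small except at the boundaries of the epochs. -/
lemma sum_utility_le (run : IsRun S₁ S₂ b T δ r g h u₁ u₂ q₁ q₂ lam) {M : ℝ}
    (hM : ∀ t ≤ T, lam t ≤ M) :
    ∑ t ∈ Finset.Icc 1 T, (utility S₁ (q₁ t) (g t) + utility S₂ (q₂ t) (h t) - b) ≤
      30 * (L * √T) + 13 * M + 2 * L *
        (((Finset.range T).filter fun t => (counters u₁ (t + 1)).domain S₁ T δ ≠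
            (counters u₁ t).domain S₁ T δ).card +
          ((Finset.range T).filter fun t => (counters u₂ (t + 1)).domain S₂ T δ ≠
            (counters u₂ t).domain S₂ T δ).card) := by
  have hL : (1 : ℝ) ≤ L := by exact_mod_cast run.horizon_pos
  have hT : (2 : ℝ) ≤ T := by exact_mod_cast run.two_le
  have hT2 := run.two_le
  obtain ⟨T', hT'⟩ : ∃ T', T = T' + 1 := ⟨T - 1, by omega⟩
  have hθ0 : (0 : ℝ) < 1 / T := by positivity
  have hθ1 : (1 : ℝ) / T ≤ 1 / 2 := one_div_le_one_div_of_le (by norm_num) hT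
  have hη : (0 : ℝ) < 1 / (T * L) := by positivity
  have hsT : √(T : ℝ) ^ 2 = T := Real.sq_sqrt (by linarith)
  have hs1 : 1 ≤ √(T : ℝ) := Real.one_le_sqrt.2 (by linarith)
  have hM0 : 0 ≤ M := by have := hM 0 (by omega); rwa [run.algorithm.init_dual] at this
  have hsqrt : √(1 / (T : ℝ)) = √T / T := by
    rw [one_div, Real.sqrt_inv, eq_div_iff (by linarith), ← hsT]
    have : √(T : ℝ) ≠ 0 := by linarith
    rw [Real.sqrt_sq (by linarith)]
    field_simp
  set s := √(T : ℝ)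
  -- The bound for the shift between consecutive iterates of an epoch.
  set β : ℝ := (6 * (L * s + M) + 7 * (L * s)) / T with hβ
  have hβ0 : 0 ≤ β := by positivity
  have hβe : 6 * (L * (1 / (T * L : ℝ)) * (L * s + M)) + 7 * L * √(1 / (T : ℝ)) = β := by
    rw [hβ, hsqrt]; field_simp
  have hshift₁ : ∀ t, t + 1 < T → l1Dist S₁ (marginal (q₁ (t + 1))) (marginal (q₁ (t + 2))) ≤
      β + if (counters u₁ (t + 1)).domain S₁ T δ ≠ (counters u₁ t).domain S₁ T δ
        then 2 * (L : ℝ) else 0 := by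
    intro t ht
    split_ifs with hc
    · linarith [l1Dist_le (run.layered₁ (t := t + 1) (by omega))
        (run.layered₁ (t := t + 2) (by omega))]
    · rw [add_zero, ← hβe]
      refine l1Dist_step_le (c := counters u₁ (t + 1)) hη hθ0 hθ1 ?_ (run.algorithm.mem₁ _ ht)
        (by positivity) (fun x a hx => ?_) (run.primal₁ ht)
      · rw [not_not.1 hc]; exact run.algorithm.mem₁ t (by omega)
      · have h1 := rewardAgainst₂_mem (run.layered₂ (t := t + 1) (by omega))
          (run.r_zero_mem (t + 1)) hx a
        have h2 := zeroAtZero_mem_unit run.g_mem (t + 1) x a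
        have h3 := run.lam_nonneg (t := t + 1) (by omega)
        have h4 := hM (t + 1) (by omega)
        rw [abs_of_nonneg (add_nonneg (mul_nonneg (by positivity) h1.1) (mul_nonneg h3 h2.1))]
        exact add_le_add (mul_le_of_le_one_right (by positivity) h1.2)
          ((mul_le_of_le_one_right h3 h2.2).trans h4)
  have hshift₂ : ∀ t, t + 1 < T → l1Dist S₂ (marginal (q₂ (t + 1))) (marginal (q₂ (t + 2))) ≤
      β + if (counters u₂ (t + 1)).domain S₂ T δ ≠ (counters u₂ t).domain S₂ T δ
        then 2 * (L : ℝ) else 0 := by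
    intro t ht
    split_ifs with hc
    · linarith [l1Dist_le (run.layered₂ (t := t + 1) (by omega))
        (run.layered₂ (t := t + 2) (by omega))]
    · rw [add_zero, ← hβe]
      refine l1Dist_step_le (c := counters u₂ (t + 1)) hη hθ0 hθ1 ?_ (run.algorithm.mem₂ _ ht)
        (by positivity) (fun y b hy => ?_) (run.primal₂ ht)
      · rw [not_not.1 hc]; exact run.algorithm.mem₂ t (by omega)
      · have h1 := rewardAgainst₁_mem (run.layered₁ (t := t + 1) (by omega))
          (run.r_zero_mem (t + 1)) hy b
        have h2 := zeroAtZero_mem_unit run.h_mem (t + 1) y b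
        have h3 := run.lam_nonneg (t := t + 1) (by omega)
        have h4 := hM (t + 1) (by omega)
        refine (abs_add_le _ _).trans (add_le_add ?_ ?_)
        · rw [neg_one_mul, mul_neg, abs_neg, abs_of_nonneg (mul_nonneg (by positivity) h1.1)]
          exact mul_le_of_le_one_right (by positivity) h1.2
        · rw [abs_of_nonneg (mul_nonneg h3 h2.1)]
          exact (mul_le_of_le_one_right h3 h2.2).trans h4
  have hterm : ∀ t ∈ Finset.range T', utility S₁ (q₁ (t + 1)) (g (t + 1)) +
      utility S₂ (q₂ (t + 1)) (h (t + 1)) - b ≤ (lam (t + 2) - lam (t + 1)) +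
      (2 * β + ((if (counters u₁ (t + 1)).domain S₁ T δ ≠ (counters u₁ t).domain S₁ T δ
        then 2 * (L : ℝ) else 0) +
        (if (counters u₂ (t + 1)).domain S₂ T δ ≠ (counters u₂ t).domain S₂ T δ
        then 2 * (L : ℝ) else 0))) := by
    intro t ht
    have ht := Finset.mem_range.1 ht
    have h1 := hshift₁ t (by omega)
    have h2 := hshift₂ t (by omega)
    have h3 := utility_sub_le (S := S₁) (q := q₁ (t + 1)) (q' := q₁ (t + 2)) (f := g (t + 1))
      (W := 1) fun x a _ => by
        have := run.g_mem (t + 1) x a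
        rw [abs_of_nonneg this.1]; exact this.2
    have h4 := utility_sub_le (S := S₂) (q := q₂ (t + 1)) (q' := q₂ (t + 2)) (f := h (t + 1))
      (W := 1) fun x a _ => by
        have := run.h_mem (t + 1) x a
        rw [abs_of_nonneg this.1]; exact this.2
    have h5 := run.algorithm.dual (t + 1) (by omega)
    have h6 := le_max_left (lam (t + 1) + (utility S₁ (q₁ (t + 1 + 1)) (zeroAtZero g (t + 1)) +
      utility S₂ (q₂ (t + 1 + 1)) (zeroAtZero h (t + 1)) - b)) 0
    rw [← h5] at h6
    simp only [zeroAtZero_succ] at h6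
    linarith
  have hsum := Finset.sum_le_sum hterm
  rw [Finset.sum_add_distrib, Finset.sum_range_sub (fun t => lam (t + 1)),
    Finset.sum_add_distrib, Finset.sum_const, Finset.card_range, nsmul_eq_mul,
    Finset.sum_add_distrib, ← Finset.sum_filter, ← Finset.sum_filter, Finset.sum_const,
    Finset.sum_const, nsmul_eq_mul, nsmul_eq_mul] at hsum
  have hcard₁ : (((Finset.range T').filter fun t => (counters u₁ (t + 1)).domain S₁ T δ ≠
      (counters u₁ t).domain S₁ T δ).card : ℝ) ≤
      (((Finset.range T).filter fun t => (counters u₁ (t + 1)).domain S₁ T δ ≠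
      (counters u₁ t).domain S₁ T δ).card : ℝ) := by
    exact_mod_cast Finset.card_le_card (Finset.filter_subset_filter _
      (Finset.range_subset_range.2 (by omega)))
  have hcard₂ : (((Finset.range T').filter fun t => (counters u₂ (t + 1)).domain S₂ T δ ≠
      (counters u₂ t).domain S₂ T δ).card : ℝ) ≤
      (((Finset.range T).filter fun t => (counters u₂ (t + 1)).domain S₂ T δ ≠
      (counters u₂ t).domain S₂ T δ).card : ℝ) := by
    exact_mod_cast Finset.card_le_card (Finset.filter_subset_filter _
      (Finset.range_subset_range.2 (by omega)))
  have hlast : utility S₁ (q₁ T) (g T) + utility S₂ (q₂ T) (h T) - b ≤ 2 * L := by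
    have e1 := utility_le (run.layered₁ le_rfl) fun x a _ => (run.g_mem T x a).2
    have e2 := utility_le (run.layered₂ le_rfl) fun x a _ => (run.h_mem T x a).2
    have := run.budget_nonneg
    linarith
  have hsplit : ∑ t ∈ Finset.Icc 1 T, (utility S₁ (q₁ t) (g t) + utility S₂ (q₂ t) (h t) - b) =
      ∑ t ∈ Finset.range T', (utility S₁ (q₁ (t + 1)) (g (t + 1)) +
        utility S₂ (q₂ (t + 1)) (h (t + 1)) - b) +
        (utility S₁ (q₁ T) (g T) + utility S₂ (q₂ T) (h T) - b) := by
    rw [hT', ← Finset.sum_range_succ (fun t => utility S₁ (q₁ (t + 1)) (g (t + 1)) +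
      utility S₂ (q₂ (t + 1)) (h (t + 1)) - b), Finset.range_eq_Ico,
      Finset.sum_Ico_add' (fun t => utility S₁ (q₁ t) (g t) + utility S₂ (q₂ t) (h t) - b)]
    exact Finset.sum_congr (by ext; simp) fun _ _ => rfl
  rw [hsplit]
  have h1 : (T' : ℝ) * (2 * β) ≤ 2 * (6 * (L * s + M) + 7 * (L * s)) := by
    have h2 : (T' : ℝ) ≤ T := by rw [hT']; push_cast; linarith
    have h3 : (T : ℝ) * β = 6 * (L * s + M) + 7 * (L * s) := by rw [hβ]; field_simp
    nlinarith [mul_le_mul_of_nonneg_right h2 hβ0]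
  have h2 := hM (T' + 1) (by omega)
  have h3 := run.lam_nonneg (t := 0 + 1) (by omega)
  have h4 : (L : ℝ) ≤ L * s := le_mul_of_one_le_right (by linarith) hs1
  have h5 := mul_le_mul_of_nonneg_right hcard₁ (show (0 : ℝ) ≤ 2 * L by positivity)
  have h6 := mul_le_mul_of_nonneg_right hcard₂ (show (0 : ℝ) ≤ 2 * L by positivity)
  linarith

end IsRun

end RunBounds

/-! ### Trajectories and occupancy measures of policies -/

section Chain

variable {X A : Type*} [Fintype X] [Fintype A]

open Classical in
/-- The weight of a path of length `n` from `x₀` for the kernel `K x a x'`. -/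
def chainWeight {X A : Type*} (x₀ : X) (K : X → A → X → ℝ) (n : ℕ) (v : Traj X A n) : ℝ :=
  (if v.1 0 = x₀ then 1 else 0) * ∏ l : Fin n, K (v.1 l.castSucc) (v.2 l) (v.1 l.succ)

open Classical in
/-- The distribution of the state after `n` steps. -/
def forward (x₀ : X) (K : X → A → X → ℝ) : ℕ → X → ℝ
  | 0 => fun x => if x = x₀ then 1 else 0
  | n + 1 => fun x' => ∑ x, ∑ a, forward x₀ K n x * K x a x'

lemma sum_traj_succ {n : ℕ} (F : Traj X A (n + 1) → ℝ) :
    ∑ u, F u = ∑ v : Traj X A n, ∑ a, ∑ x', F (Fin.snoc (α := fun _ => X) v.1 x',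
      Fin.snoc (α := fun _ => A) v.2 a) := by
  rw [Fintype.sum_prod_type, Fintype.sum_prod_type,
    ← (Fin.snocEquiv (fun _ : Fin (n + 2) => X)).sum_comp, Fintype.sum_prod_type, Finset.sum_comm]
  refine Finset.sum_congr rfl fun v _ => ?_
  rw [Finset.sum_comm' (t' := Finset.univ) (s' := fun _ => Finset.univ) (by simp)]
  rw [← (Fin.snocEquiv (fun _ : Fin (n + 1) => A)).sum_comp, Fintype.sum_prod_type,
    Finset.sum_comm]
  refine Finset.sum_congr rfl fun w _ => ?_
  rfl

lemma chainWeight_snoc {X A : Type*} (x₀ : X) (K : X → A → X → ℝ) {n : ℕ} (v : Traj X A n)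
    (a : A) (x' : X) :
    chainWeight x₀ K (n + 1) (Fin.snoc (α := fun _ => X) v.1 x', Fin.snoc (α := fun _ => A) v.2 a) =
      chainWeight x₀ K n v * K (v.1 (Fin.last n)) a x' := by
  unfold chainWeight
  rw [Fin.prod_univ_castSucc, ← mul_assoc]
  have h0 : (Fin.snoc (α := fun _ => X) v.1 x' : Fin (n + 2) → X) 0 = v.1 0 := by
    rw [← Fin.castSucc_zero, Fin.snoc_castSucc]
  simp only [Fin.snoc_castSucc, Fin.succ_castSucc, Fin.snoc_last, Fin.succ_last]
  classical
  exact congrArg₂ _ (congrArg₂ _ (if_congr (Eq.to_iff (congrArg (· = x₀) h0)) rfl rfl) rfl) rfl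

lemma sum_chainWeight_last (x₀ : X) (K : X → A → X → ℝ) (n : ℕ) (f : X → ℝ) :
    ∑ v : Traj X A n, chainWeight x₀ K n v * f (v.1 (Fin.last n)) =
      ∑ x, forward x₀ K n x * f x := by
  induction n generalizing f with
  | zero =>
    rw [Fintype.sum_prod_type, ← (Equiv.funUnique (Fin 1) X).symm.sum_comp]
    simp [chainWeight, forward]
    rfl
  | succ n ih =>
    rw [sum_traj_succ]
    simp only [chainWeight_snoc, Fin.snoc_last, forward]
    have h := ih fun x => ∑ a, ∑ x', K x a x' * f x'
    simp only [Finset.mul_sum, ← mul_assoc] at h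
    rw [h]
    simp only [Finset.sum_mul]
    rw [Finset.sum_congr rfl fun x _ => Finset.sum_comm, Finset.sum_comm]

variable {L : ℕ} {S : Layering X L} {K : X → A → X → ℝ}

lemma layer_of_chainWeight_ne_zero {X A : Type*} {L : ℕ} {S : Layering X L} {K : X → A → X → ℝ}
    (hK : ∀ x a x', K x a x' ≠ 0 → S.layer x' = S.layer x + 1)
    {n : ℕ} {v : Traj X A n} (hv : chainWeight S.start K n v ≠ 0) (i : Fin (n + 1)) :
    S.layer (v.1 i) = i := by
  unfold chainWeight at hv
  have h1 := left_ne_zero_of_mul hv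
  have h2 := Finset.prod_ne_zero_iff.1 (right_ne_zero_of_mul hv)
  induction i using Fin.induction with
  | zero =>
    have : v.1 0 = S.start := by_contra fun h => h1 (if_neg h)
    rw [this]
    simpa using (S.layer_eq_zero_iff _).2 rfl
  | succ i ih => rw [hK _ _ _ (h2 i (Finset.mem_univ _)), ih]; simp

lemma layer_of_forward_ne_zero (hK : ∀ x a x', K x a x' ≠ 0 → S.layer x' = S.layer x + 1)
    {n : ℕ} {x : X} (hx : forward S.start K n x ≠ 0) : S.layer x = n := by
  induction n generalizing x with
  | zero =>
    have : x = S.start := by_contra fun h => hx (if_neg h)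
    rw [this]
    exact (S.layer_eq_zero_iff _).2 rfl
  | succ n ih =>
    obtain ⟨y, _, hy⟩ := Finset.exists_ne_zero_of_sum_ne_zero hx
    obtain ⟨a, _, ha⟩ := Finset.exists_ne_zero_of_sum_ne_zero hy
    rw [hK _ _ _ (right_ne_zero_of_mul ha), ih (left_ne_zero_of_mul ha)]

/-- The law of the `l`-th transition of a path. -/
lemma sum_chainWeight_step (hK : ∀ x a x', K x a x' ≠ 0 → S.layer x' = S.layer x + 1)
    (hK1 : ∀ x, S.layer x < L → ∑ a, ∑ x', K x a x' = 1) {n : ℕ} (hn : n ≤ L) (l : Fin n)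
    (f : X → A → X → ℝ) :
    ∑ v : Traj X A n, chainWeight S.start K n v *
        f (v.1 l.castSucc) (v.2 l) (v.1 l.succ) =
      ∑ x, ∑ a, ∑ x', forward S.start K l x * K x a x' * f x a x' := by
  induction n with
  | zero => exact l.elim0
  | succ n ih =>
    rw [sum_traj_succ]
    refine Fin.lastCases ?_ (fun l => ?_) l
    · simp only [chainWeight_snoc, Fin.snoc_castSucc, Fin.snoc_last, Fin.succ_last, Fin.val_last]
      have h := sum_chainWeight_last S.start K n fun x => ∑ a, ∑ x', K x a x' * f x a x'
      simp only [Finset.mul_sum, ← mul_assoc] at h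
      rw [h]
    · simp only [chainWeight_snoc, Fin.snoc_castSucc, Fin.succ_castSucc, Fin.val_castSucc]
      rw [← ih (by omega) l]
      refine Finset.sum_congr rfl fun v _ => ?_
      by_cases hv : chainWeight S.start K n v = 0
      · simp [hv]
      have h1 := layer_of_chainWeight_ne_zero hK hv (Fin.last n)
      have h2 := hK1 (v.1 (Fin.last n)) (by rw [h1]; simpa using hn)
      simp only [mul_right_comm _ (K _ _ _)]
      simp only [← Finset.mul_sum]
      rw [h2, mul_one]

end Chain

section Occupancy

variable {X A : Type*} [Fintype X] [Fintype A] {L : ℕ} {S : Layering X L}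
  {P P' : X → A → X → ℝ} {π : X → A → ℝ} {q : X → A → X → ℝ}

/-- Stationary policies: probability vectors over the actions at every state. -/
structure IsPolicy (π : X → A → ℝ) : Prop where
  nonneg : ∀ x a, 0 ≤ π x a
  sum_eq_one : ∀ x, ∑ a, π x a = 1

lemma isPolicy_policy [Nonempty A] (hq : ∀ x a, 0 ≤ marginal q x a) : IsPolicy (policy q) where
  nonneg x a := by
    unfold policy
    split_ifs
    · positivity
    · exact div_nonneg (hq x a) (Finset.sum_nonneg fun a _ => hq x a)
  sum_eq_one x := by
    unfold policy
    split_ifs with h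
    · rw [Finset.sum_const, Finset.card_univ, nsmul_eq_mul]
      exact mul_one_div_cancel (by exact_mod_cast Fintype.card_ne_zero)
    · rw [← Finset.sum_div, div_self h]

lemma marginal_eq_mul_policy (hq : ∀ x a, 0 ≤ marginal q x a) (x : X) (a : A) :
    marginal q x a = (∑ a', marginal q x a') * policy q x a := by
  unfold policy
  split_ifs with h
  · rw [h, zero_mul]
    exact (Finset.sum_eq_zero_iff_of_nonneg fun a _ => hq x a).1 h a (Finset.mem_univ _)
  · rw [mul_div_cancel₀ _ h]

/-- The one-step kernel of the policy `π` under `P`. -/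
def stepKernel (P : X → A → X → ℝ) (π : X → A → ℝ) (x : X) (a : A) (x' : X) : ℝ :=
  π x a * P x a x'

lemma trajProb_eq_chainWeight {X A : Type*} {L : ℕ} (S : Layering X L) (P : X → A → X → ℝ)
    (π : X → A → ℝ) :
    trajProb S P π = chainWeight S.start (stepKernel P π) L := rfl

lemma stepKernel_layer {X A : Type*} [Fintype X] {L : ℕ} {S : Layering X L}
    {P : X → A → X → ℝ} {π : X → A → ℝ} (hP : IsTransition S P) {x : X} {a : A} {x' : X}
    (h : stepKernel P π x a x' ≠ 0) : S.layer x' = S.layer x + 1 :=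
  hP.loop_free x a x' (lt_of_le_of_ne (hP.nonneg x a x') (right_ne_zero_of_mul h).symm)

lemma sum_stepKernel (hP : IsTransition S P) (hπ : IsPolicy π) {x : X} (hx : S.layer x < L) :
    ∑ a, ∑ x', stepKernel P π x a x' = 1 := by
  simp only [stepKernel, ← Finset.mul_sum, hP.sum_eq_one x _ hx, mul_one, hπ.sum_eq_one]

lemma trajProb_nonneg (hP : IsTransition S P) (hπ : IsPolicy π) (u : Traj X A L) :
    0 ≤ trajProb S P π u :=
  mul_nonneg (by split_ifs <;> norm_num)
    (Finset.prod_nonneg fun _ _ => mul_nonneg (hπ.nonneg _ _) (hP.nonneg _ _ _))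

lemma layer_of_trajProb_ne_zero {X A : Type*} [Fintype X] {L : ℕ} {S : Layering X L}
    {P : X → A → X → ℝ} {π : X → A → ℝ} (hP : IsTransition S P) {u : Traj X A L}
    (hu : trajProb S P π u ≠ 0) (i : Fin (L + 1)) : S.layer (u.1 i) = i :=
  layer_of_chainWeight_ne_zero (K := stepKernel P π)
    (fun _ _ _ h => stepKernel_layer hP h) hu i

lemma sum_trajProb_step (hP : IsTransition S P) (hπ : IsPolicy π) (l : Fin L)
    (f : X → A → X → ℝ) :
    ∑ u : Traj X A L, trajProb S P π u * f (u.1 l.castSucc) (u.2 l) (u.1 l.succ) =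
      ∑ x, ∑ a, ∑ x', forward S.start (stepKernel P π) l x * stepKernel P π x a x' * f x a x' :=
  sum_chainWeight_step (fun _ _ _ => stepKernel_layer hP) (fun _ => sum_stepKernel hP hπ) le_rfl l f

lemma forward_nonneg (hP : IsTransition S P) (hπ : IsPolicy π) (n : ℕ) (x : X) :
    0 ≤ forward S.start (stepKernel P π) n x := by
  induction n generalizing x with
  | zero => simp only [forward]; split_ifs <;> norm_num
  | succ n ih =>
    exact Finset.sum_nonneg fun y _ => Finset.sum_nonneg fun a _ =>
      mul_nonneg (ih y) (mul_nonneg (hπ.nonneg _ _) (hP.nonneg _ _ _))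

lemma forward_eq_zero (hP : IsTransition S P) {n : ℕ} {x : X} (hx : S.layer x ≠ n) :
    forward S.start (stepKernel P π) n x = 0 :=
  by_contra fun h => hx (layer_of_forward_ne_zero (fun _ _ _ => stepKernel_layer hP) h)

lemma sum_forward (hP : IsTransition S P) (hπ : IsPolicy π) {n : ℕ} (hn : n ≤ L) :
    ∑ x, forward S.start (stepKernel P π) n x = 1 := by
  induction n with
  | zero =>
    simp only [forward]
    rw [Finset.sum_eq_single S.start (fun x _ h => if_neg h) (by simp)]
    exact if_pos rfl
  | succ n ih =>
    rw [← ih (by omega)]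
    simp only [forward]
    rw [Finset.sum_comm]
    refine Finset.sum_congr rfl fun x _ => ?_
    rw [Finset.sum_comm]
    simp only [← Finset.mul_sum]
    by_cases hx : S.layer x = n
    · rw [sum_stepKernel hP hπ (by omega), mul_one]
    · rw [forward_eq_zero hP hx, zero_mul]

lemma sum_trajProb (hP : IsTransition S P) (hπ : IsPolicy π) : ∑ u, trajProb S P π u = 1 := by
  have h := sum_chainWeight_last S.start (stepKernel P π) L fun _ => 1
  simp only [mul_one] at h
  rw [trajProb_eq_chainWeight, h, sum_forward hP hπ le_rfl]

/-- The occupancy measure of a policy in terms of the forward distributions. -/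
lemma occupancy_eq (hP : IsTransition S P) (hπ : IsPolicy π) {x : X} (hx : S.layer x < L)
    (a : A) (x' : X) :
    occupancy S P π x a x' =
      forward S.start (stepKernel P π) (S.layer x) x * stepKernel P π x a x' := by
  classical
  have h := sum_trajProb_step hP hπ ⟨S.layer x, hx⟩
    fun y b y' => if y = x ∧ b = a ∧ y' = x' then (1 : ℝ) else 0
  refine Eq.trans (Eq.trans ?_ h) ?_
  · unfold occupancy
    refine Finset.sum_congr rfl fun u _ => ?_
    congr 1
    refine if_congr ⟨?_, fun h => ⟨_, rfl, h⟩⟩ rfl rfl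
    rintro ⟨l, hl, h⟩
    obtain rfl : l = ⟨S.layer x, hx⟩ := Fin.ext hl
    exact h
  rw [Finset.sum_eq_single x, Finset.sum_eq_single a, Finset.sum_eq_single x'] <;>
    simp +contextual

lemma marginal_occupancy (hP : IsTransition S P) (hπ : IsPolicy π) {x : X} (hx : S.layer x < L)
    (a : A) : marginal (occupancy S P π) x a =
      forward S.start (stepKernel P π) (S.layer x) x * π x a := by
  simp only [marginal, occupancy_eq hP hπ hx, stepKernel, ← Finset.mul_sum,
    hP.sum_eq_one x a hx, mul_one]

lemma marginal_occupancy_nonneg (hP : IsTransition S P) (hπ : IsPolicy π) (x : X) (a : A) :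
    0 ≤ marginal (occupancy S P π) x a :=
  Finset.sum_nonneg fun _ _ => Finset.sum_nonneg fun u _ =>
    mul_nonneg (trajProb_nonneg hP hπ u) (by split_ifs <;> norm_num)

/-- The expected sum of `f` along a trajectory. -/
lemma sum_trajProb_mul_sum (hP : IsTransition S P) (hπ : IsPolicy π) (f : X → A → ℝ) :
    ∑ u : Traj X A L, trajProb S P π u * ∑ l : Fin L, f (u.1 l.castSucc) (u.2 l) =
      ∑ z ∈ S.pairs A, marginal (occupancy S P π) z.1 z.2 * f z.1 z.2 := by
  simp only [Finset.mul_sum]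
  rw [Finset.sum_comm, sum_pairs_eq_sum_pairsAt, ← Fin.sum_univ_eq_sum_range
    (fun l => ∑ z ∈ S.pairsAt A l, marginal (occupancy S P π) z.1 z.2 * f z.1 z.2)]
  refine Finset.sum_congr rfl fun l _ => ?_
  rw [sum_trajProb_step hP hπ l fun x a _ => f x a, ← sum_ite_eq_eq_sum_pairsAt S l
    fun x a => marginal (occupancy S P π) x a * f x a]
  refine Finset.sum_congr rfl fun x _ => Finset.sum_congr rfl fun a _ => ?_
  split_ifs with hx
  · have hx' : S.layer x < L := by rw [hx]; exact l.2
    simp only [marginal_occupancy hP hπ hx', stepKernel, ← Finset.sum_mul, ← Finset.mul_sum,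
      hP.sum_eq_one x a hx', mul_one, hx]
  · simp [forward_eq_zero hP hx]

lemma sum_pairsAt_eq (S : Layering X L) (l : ℕ) (f : X → A → ℝ) :
    ∑ z ∈ S.pairsAt A l, f z.1 z.2 =
      ∑ x ∈ Finset.univ.filter (fun x => S.layer x = l), ∑ a, f x a := by
  rw [← sum_ite_eq_eq_sum_pairsAt, Finset.sum_filter]
  exact Finset.sum_congr rfl fun x _ => by split_ifs <;> simp

/-- The occupancy measure of the policy of `q` under `P` differs from `q`, an occupancy measure
under `P'`, by the differences of the transitions accumulated over the preceding layers. -/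
lemma l1Dist_occupancy_le (hP : IsTransition S P) (hP' : IsTransition S P')
    (hq : q ∈ occupancySet S P') [Nonempty A] :
    l1Dist S (marginal (occupancy S P (policy q))) (marginal q) ≤
      L * ∑ z ∈ S.pairs A, marginal (occupancy S P (policy q)) z.1 z.2 *
        ∑ x', |P z.1 z.2 x' - P' z.1 z.2 x'| := by
  obtain ⟨hqo, hqP⟩ := hq
  have hm := hqo.isLayered.nonneg
  have hπ : IsPolicy (policy q) := isPolicy_policy hm
  set π := policy q with hπdef
  set F := forward S.start (stepKernel P π) with hF
  -- `E l` is the expected error of the transitions out of layer `l`, and `e l` is the distance of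
  -- the two measures in this layer.
  set E : ℕ → ℝ := fun l => ∑ z ∈ S.pairsAt A l, marginal (occupancy S P π) z.1 z.2 *
        ∑ x', |P z.1 z.2 x' - P' z.1 z.2 x'| with hE
  have hE0 : ∀ l, 0 ≤ E l := fun l => Finset.sum_nonneg fun z _ =>
    mul_nonneg (marginal_occupancy_nonneg hP hπ _ _) (Finset.sum_nonneg fun _ _ => abs_nonneg _)
  set e : ℕ → ℝ := fun l => ∑ z ∈ S.pairsAt A l,
    |marginal (occupancy S P π) z.1 z.2 - marginal q z.1 z.2| with he
  -- The measures share the policy, so their distance is that of the state distributions.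
  have hstate : ∀ l < L, e l = ∑ x ∈ Finset.univ.filter (fun x => S.layer x = l),
      |F l x - ∑ a, marginal q x a| := by
    intro l hl
    simp only [he]
    rw [sum_pairsAt_eq S l fun x a => |marginal (occupancy S P π) x a - marginal q x a|]
    refine Finset.sum_congr rfl fun x hx => ?_
    have hx' : S.layer x = l := by simpa using hx
    have h1 : ∀ a, |marginal (occupancy S P π) x a - marginal q x a| =
        |F l x - ∑ a, marginal q x a| * π x a := by
      intro a
      rw [marginal_occupancy hP hπ (by omega), hx', marginal_eq_mul_policy hm x a, ← sub_mul,
        abs_mul, abs_of_nonneg (hπ.nonneg x a)]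
    simp only [h1, ← Finset.mul_sum, hπ.sum_eq_one, mul_one]
  have hrec : ∀ l, l < L → e l ≤ ∑ j ∈ Finset.range l, E j := by
    intro l
    induction l with
    | zero =>
      intro hl
      rw [hstate 0 hl, Finset.sum_range_zero]
      refine le_of_eq (Finset.sum_eq_zero fun x hx => ?_)
      have hx' : S.layer x = 0 := by simpa using hx
      have hxs := (S.layer_eq_zero_iff x).1 hx'
      have h1 : F 0 x = 1 := if_pos hxs
      have h2 := hqo.isLayered.mass 0 hl
      rw [sum_pairsAt_eq, show (Finset.univ.filter fun x => S.layer x = 0) = {x} by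
        ext y; simp [S.layer_eq_zero_iff, hxs], Finset.sum_singleton] at h2
      rw [h1, h2, sub_self, abs_zero]
    | succ l ih =>
      intro hl
      have hl' : l < L := by omega
      rw [Finset.sum_range_succ]
      refine le_trans ?_ (add_le_add (ih hl') le_rfl)
      rw [hstate (l + 1) hl]
      have h1 : ∀ x', S.layer x' = l + 1 → |F (l + 1) x' - ∑ a, marginal q x' a| ≤
          ∑ z ∈ S.pairsAt A l, (|marginal (occupancy S P π) z.1 z.2 - marginal q z.1 z.2| *
            P' z.1 z.2 x' + marginal (occupancy S P π) z.1 z.2 *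
              |P z.1 z.2 x' - P' z.1 z.2 x'|) := by
        intro x' hx'
        have h2 : F (l + 1) x' = ∑ z ∈ S.pairsAt A l,
            marginal (occupancy S P π) z.1 z.2 * P z.1 z.2 x' := by
          rw [← sum_ite_eq_eq_sum_pairsAt S l fun x a => marginal (occupancy S P π) x a * P x a x']
          refine Finset.sum_congr rfl fun x _ => Finset.sum_congr rfl fun a _ => ?_
          split_ifs with hx
          · rw [marginal_occupancy hP hπ (by omega), hx, stepKernel, mul_assoc]
          · rw [forward_eq_zero hP hx, zero_mul]
        have h3 : ∑ a, marginal q x' a = ∑ z ∈ S.pairsAt A l,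
            marginal q z.1 z.2 * P' z.1 z.2 x' := by
          simp only [marginal]
          rw [← hqo.flow x' (by omega) (by omega), ← sum_ite_eq_eq_sum_pairsAt S l
            fun x a => (∑ x', q x a x') * P' x a x']
          refine Finset.sum_congr rfl fun x _ => Finset.sum_congr rfl fun a _ => ?_
          split_ifs with hx
          · exact hqP x a x'
          · by_contra h
            have := hqo.support x a x' h
            omega
        rw [h2, h3, ← Finset.sum_sub_distrib]
        refine (Finset.abs_sum_le_sum_abs _ _).trans (Finset.sum_le_sum fun z _ => ?_)
        rw [show marginal (occupancy S P π) z.1 z.2 * P z.1 z.2 x' -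
            marginal q z.1 z.2 * P' z.1 z.2 x' =
          (marginal (occupancy S P π) z.1 z.2 - marginal q z.1 z.2) * P' z.1 z.2 x' +
            marginal (occupancy S P π) z.1 z.2 * (P z.1 z.2 x' - P' z.1 z.2 x') by ring]
        refine (abs_add_le _ _).trans (le_of_eq ?_)
        rw [abs_mul, abs_mul, abs_of_nonneg (hP'.nonneg _ _ _),
          abs_of_nonneg (marginal_occupancy_nonneg hP hπ _ _)]
      calc _ ≤ ∑ x' ∈ Finset.univ.filter (fun x => S.layer x = l + 1), ∑ z ∈ S.pairsAt A l,
            (|marginal (occupancy S P π) z.1 z.2 - marginal q z.1 z.2| *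
            P' z.1 z.2 x' + marginal (occupancy S P π) z.1 z.2 *
              |P z.1 z.2 x' - P' z.1 z.2 x'|) :=
            Finset.sum_le_sum fun x' hx' => h1 x' (by simpa using hx')
        _ ≤ ∑ x', ∑ z ∈ S.pairsAt A l,
            (|marginal (occupancy S P π) z.1 z.2 - marginal q z.1 z.2| *
            P' z.1 z.2 x' + marginal (occupancy S P π) z.1 z.2 *
              |P z.1 z.2 x' - P' z.1 z.2 x'|) :=
            Finset.sum_le_sum_of_subset_of_nonneg (Finset.filter_subset _ _)
              fun x' _ _ => Finset.sum_nonneg fun z _ => add_nonneg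
                (mul_nonneg (abs_nonneg _) (hP'.nonneg _ _ _))
                (mul_nonneg (marginal_occupancy_nonneg hP hπ _ _) (abs_nonneg _))
        _ = e l + E l := by
            rw [Finset.sum_comm, ← Finset.sum_add_distrib]
            refine Finset.sum_congr rfl fun z hz => ?_
            rw [Finset.sum_add_distrib, ← Finset.mul_sum, ← Finset.mul_sum,
              hP'.sum_eq_one _ _ (by rw [Layering.mem_pairsAt.1 hz]; exact hl'), mul_one]
  calc l1Dist S (marginal (occupancy S P π)) (marginal q) = ∑ l ∈ Finset.range L, e l :=
        sum_pairs_eq_sum_pairsAt S fun z =>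
          |marginal (occupancy S P π) z.1 z.2 - marginal q z.1 z.2|
    _ ≤ ∑ l ∈ Finset.range L, ∑ j ∈ Finset.range L, E j := by
        refine Finset.sum_le_sum fun l hl => ?_
        have hl := Finset.mem_range.1 hl
        exact (hrec l hl).trans (Finset.sum_le_sum_of_subset_of_nonneg
          (Finset.range_subset_range.2 hl.le) fun j _ _ => hE0 j)
    _ = _ := by
        rw [Finset.sum_const, Finset.card_range, nsmul_eq_mul, sum_pairs_eq_sum_pairsAt]

end Occupancy

/-! ### Visitation counts and epochs -/

section Visits

/-- Trajectories whose `i`-th state lies in layer `i`. -/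
def IsLegal {X A : Type*} {L : ℕ} (S : Layering X L) (v : Traj X A L) : Prop :=
  ∀ i, S.layer (v.1 i) = i

open Classical in
/-- The number of visits to `(x, a)` in one episode. -/
def episodeVisits {X A : Type*} {L : ℕ} (v : Traj X A L) (x : X) (a : A) : ℕ :=
  (Finset.univ.filter fun l : Fin L => v.1 l.castSucc = x ∧ v.2 l = a).card

open Classical in
/-- The number of transitions `(x, a, x')` in one episode. -/
def episodeTransitions {X A : Type*} {L : ℕ} (v : Traj X A L) (x : X) (a : A) (x' : X) : ℕ :=
  (Finset.univ.filter fun l : Fin L =>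
    v.1 l.castSucc = x ∧ v.2 l = a ∧ v.1 l.succ = x').card

/-- The number of visits to `(x, a)` in the episodes `1, …, t`. -/
def visits {X A : Type*} {L : ℕ} (u : ℕ → Traj X A L) (t : ℕ) (x : X) (a : A) : ℕ :=
  ∑ i ∈ Finset.range t, episodeVisits (u (i + 1)) x a

/-- The number of transitions `(x, a, x')` in the episodes `1, …, t`. -/
def transitions {X A : Type*} {L : ℕ} (u : ℕ → Traj X A L) (t : ℕ) (x : X) (a : A) (x' : X) : ℕ :=
  ∑ i ∈ Finset.range t, episodeTransitions (u (i + 1)) x a x'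

section

variable {X A : Type*} {L : ℕ} {S : Layering X L}

lemma episodeVisits_le_one {v : Traj X A L} (hv : IsLegal S v) (x : X) (a : A) :
    episodeVisits v x a ≤ 1 := by
  refine Finset.card_le_one.2 fun l hl l' hl' => ?_
  simp only [Finset.mem_filter, Finset.mem_univ, true_and] at hl hl'
  have h1 := hv l.castSucc
  have h2 := hv l'.castSucc
  rw [hl.1] at h1
  rw [hl'.1, h1] at h2
  exact Fin.ext (by simpa using h2)

open Classical in
lemma episodeVisits_eq {v : Traj X A L} (hv : IsLegal S v) {x : X} {a : A} (hx : S.layer x < L) :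
    episodeVisits v x a = if v.1 (Fin.castSucc ⟨S.layer x, hx⟩) = x ∧ v.2 ⟨S.layer x, hx⟩ = a
      then 1 else 0 := by
  have key : ∀ l : Fin L, v.1 l.castSucc = x → l = ⟨S.layer x, hx⟩ := fun l hl => by
    have := hv l.castSucc
    rw [hl] at this
    exact Fin.ext (by simpa using this.symm)
  unfold episodeVisits
  split_ifs with h
  · refine Finset.card_eq_one.2 ⟨⟨S.layer x, hx⟩, ?_⟩
    ext l
    simp only [Finset.mem_filter, Finset.mem_univ, true_and, Finset.mem_singleton]
    exact ⟨fun hl => key l hl.1, fun hl => hl ▸ h⟩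
  · refine Finset.card_eq_zero.2 (Finset.filter_eq_empty_iff.2 fun l _ hl => h ?_)
    rw [key l hl.1] at hl
    exact hl

lemma visits_le {u : ℕ → Traj X A L} {t : ℕ} (hu : ∀ i < t, IsLegal S (u (i + 1))) (x : X) (a : A) :
    visits u t x a ≤ t := by
  calc visits u t x a ≤ ∑ i ∈ Finset.range t, 1 :=
        Finset.sum_le_sum fun i hi => episodeVisits_le_one (hu i (by simpa using hi)) x a
    _ = t := by simp

end

variable {X A : Type*} [Fintype X] [Fintype A] {L : ℕ} {S : Layering X L}

/-- Along a legal trajectory a sum over the steps is a sum over the visited pairs. -/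
lemma sum_eq_sum_episodeVisits {v : Traj X A L} (hv : IsLegal S v) (f : X → A → ℝ) :
    ∑ l : Fin L, f (v.1 l.castSucc) (v.2 l) =
      ∑ z ∈ S.pairs A, (episodeVisits v z.1 z.2 : ℝ) * f z.1 z.2 := by
  classical
  rw [← Finset.sum_fiberwise_of_maps_to (s := Finset.univ) (t := S.pairs A)
    (g := fun l : Fin L => (v.1 l.castSucc, v.2 l))
    (fun l _ => by rw [Layering.mem_pairs, hv]; simp)]
  refine Finset.sum_congr rfl fun z _ => ?_
  rw [Finset.sum_congr rfl (g := fun _ => f z.1 z.2) fun l hl => by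
    rw [← (Finset.mem_filter.1 hl).2], Finset.sum_const, nsmul_eq_mul]
  congr 2
  unfold episodeVisits
  congr 1
  ext l
  simp [Prod.ext_iff]

/-- In each episode exactly one pair of a layer is visited. -/
lemma sum_pairsAt_visits_le {u : ℕ → Traj X A L} {t l : ℕ} (hl : l < L)
    (hu : ∀ i < t, IsLegal S (u (i + 1))) :
    ∑ z ∈ S.pairsAt A l, (visits u t z.1 z.2 : ℝ) ≤ t := by
  classical
  have h1 : ∀ v : Traj X A L, IsLegal S v →
      ∑ z ∈ S.pairsAt A l, episodeVisits v z.1 z.2 ≤ 1 := by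
    intro v hv
    rw [Finset.sum_congr rfl (g := fun z => if z = (v.1 (Fin.castSucc ⟨l, hl⟩), v.2 ⟨l, hl⟩)
      then 1 else 0) fun z hz => ?_]
    · rw [Finset.sum_ite_eq']
      split_ifs <;> simp
    · have hz := Layering.mem_pairsAt.1 hz
      subst hz
      rw [episodeVisits_eq hv hl]
      refine if_congr ?_ rfl rfl
      rw [Prod.ext_iff, eq_comm, eq_comm (a := v.2 _)]
  have h2 : ∑ z ∈ S.pairsAt A l, visits u t z.1 z.2 ≤ t := by
    unfold visits
    rw [Finset.sum_comm]
    calc _ ≤ ∑ i ∈ Finset.range t, 1 :=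
          Finset.sum_le_sum fun i hi => h1 _ (hu i (by simpa using hi))
      _ = t := by simp
  exact_mod_cast h2

lemma sum_episodeVisits_div_sqrt_le {X A : Type*} {L : ℕ} {S : Layering X L}
    {u : ℕ → Traj X A L} {t : ℕ} (hu : ∀ i < t, IsLegal S (u (i + 1))) (x : X) (a : A) :
    ∑ i ∈ Finset.range t, (episodeVisits (u (i + 1)) x a : ℝ) / √(max 1 (visits u i x a : ℝ)) ≤
      3 * √(visits u t x a : ℝ) := by
  induction t with
  | zero => simp
  | succ t ih =>
    rw [Finset.sum_range_succ]
    refine (add_le_add (ih fun i hi => hu i (by omega)) le_rfl).trans ?_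
    have h1 : visits u (t + 1) x a = visits u t x a + episodeVisits (u (t + 1)) x a :=
      Finset.sum_range_succ _ _
    have h2 := episodeVisits_le_one (hu t (by omega)) x a
    rw [h1]
    set n := visits u t x a
    interval_cases hcase : episodeVisits (u (t + 1)) x a
    · simp
    · rcases Nat.eq_zero_or_pos n with hn | hn
      · rw [hn]; norm_num
      have hn1 : (1 : ℝ) ≤ n := by exact_mod_cast hn
      rw [max_eq_right hn1]
      push_cast
      set y := √(n : ℝ)
      have hy : y ^ 2 = n := Real.sq_sqrt (by linarith)
      have hy1 : 1 ≤ y := Real.one_le_sqrt.2 hn1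
      have h3 : y + 1 / (3 * y) ≤ √((n : ℝ) + 1) := by
        refine Real.le_sqrt_of_sq_le ?_
        have h4 : (y + 1 / (3 * y)) ^ 2 = y ^ 2 + 2 / 3 + 1 / 9 * (1 / y ^ 2) := by
          field_simp; ring
        have h5 : 1 / y ^ 2 ≤ 1 := by
          rw [div_le_one (by positivity)]; nlinarith
        rw [h4, hy]
        rw [hy] at h5
        linarith
      have h4 : 1 / (3 * y) = 1 / y / 3 := by field_simp
      linarith

/-- The counters at time `t` are the total counts, split at the start `τ` of the epoch. -/
lemma counters_spec (u : ℕ → Traj X A L) (t : ℕ) :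
    (∃ τ ≤ t, (counters u t).N = visits u τ ∧ (counters u t).M = transitions u τ) ∧
    (∀ x a, (counters u t).N x a + (counters u t).n x a = visits u t x a) ∧
    (∀ x a x', (counters u t).M x a x' + (counters u t).m x a x' = transitions u t x a x') ∧
    (∀ x a, (counters u t).n x a < max 1 ((counters u t).N x a)) := by
  induction t with
  | zero =>
    refine ⟨⟨0, le_rfl, ?_, ?_⟩, ?_, ?_, ?_⟩ <;> intros <;>
      simp [counters, Counters.initial, visits, transitions] <;> rfl
  | succ t ih =>
    obtain ⟨⟨τ, hτ, hN, hM⟩, h1, h2, h3⟩ := ih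
    have hv : ∀ x a, visits u (t + 1) x a = visits u t x a + episodeVisits (u (t + 1)) x a :=
      fun x a => Finset.sum_range_succ _ _
    have hw : ∀ x a x', transitions u (t + 1) x a x' =
        transitions u t x a x' + episodeTransitions (u (t + 1)) x a x' :=
      fun x a x' => Finset.sum_range_succ _ _
    by_cases hc : ∃ x a, max 1 ((counters u t).N x a) ≤
        (counters u t).n x a + episodeVisits (u (t + 1)) x a
    · have e : counters u (t + 1) =
          { epoch := (counters u t).epoch + 1
            N := fun x a => (counters u t).N x a +
              ((counters u t).n x a + episodeVisits (u (t + 1)) x a)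
            M := fun x a x' => (counters u t).M x a x' +
              ((counters u t).m x a x' + episodeTransitions (u (t + 1)) x a x')
            n := fun _ _ => 0
            m := fun _ _ _ => 0 } := if_pos hc
      rw [e]
      refine ⟨⟨t + 1, le_rfl, ?_, ?_⟩, ?_, ?_, ?_⟩
      · funext x a; simp only [hv, ← h1]; ring
      · funext x a x'; simp only [hw, ← h2]; ring
      · intro x a; simp only [hv, ← h1]; ring
      · intro x a x'; simp only [hw, ← h2]; ring
      · intro x a; simp
    · have e : counters u (t + 1) =
          { counters u t with
            n := fun x a => (counters u t).n x a + episodeVisits (u (t + 1)) x a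
            m := fun x a x' => (counters u t).m x a x' +
              episodeTransitions (u (t + 1)) x a x' } := if_neg hc
      rw [e]
      refine ⟨⟨τ, by omega, hN, hM⟩, ?_, ?_, ?_⟩
      · intro x a; simp only [hv, ← h1]; ring
      · intro x a x'; simp only [hw, ← h2]; ring
      · intro x a
        push Not at hc
        exact hc x a

/-- The counters of the epoch capture at least half of all visits. -/
lemma max_visits_le (u : ℕ → Traj X A L) (t : ℕ) (x : X) (a : A) :
    max 1 (visits u t x a : ℝ) ≤ 2 * max 1 ((counters u t).N x a : ℝ) := by
  obtain ⟨_, h1, _, h3⟩ := counters_spec u t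
  have h4 : max 1 (visits u t x a) ≤ 2 * max 1 ((counters u t).N x a) := by
    have := h1 x a
    have := h3 x a
    omega
  exact_mod_cast h4

/-- Every new epoch doubles the count of some pair, which adds a binary digit. -/
lemma size_add_one_le {m n : ℕ} (h : max 1 m ≤ n) : m.size + 1 ≤ (m + n).size := by
  rw [Nat.add_one_le_iff, Nat.lt_size]
  rcases Nat.eq_zero_or_pos m with rfl | hm
  · simpa using h
  obtain ⟨k, hk⟩ : ∃ k, m.size = k + 1 := ⟨m.size - 1, by have := Nat.size_pos.2 hm; omega⟩
  have h2 : 2 ^ k ≤ m := Nat.lt_size.1 (by omega)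
  rw [hk, pow_succ]
  omega

open Classical in
lemma card_domain_changes_le_sum_size (u : ℕ → Traj X A L) (T : ℕ) (δ : ℝ) (t : ℕ) :
    ((Finset.range t).filter fun i => (counters u (i + 1)).domain S T δ ≠
      (counters u i).domain S T δ).card ≤ ∑ x, ∑ a, ((counters u t).N x a).size := by
  induction t with
  | zero => simp
  | succ t ih =>
    rw [Finset.range_add_one, Finset.filter_insert]
    by_cases hc : ∃ x a, max 1 ((counters u t).N x a) ≤
        (counters u t).n x a + episodeVisits (u (t + 1)) x a
    · have e : (counters u (t + 1)).N = fun x a => (counters u t).N x a +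
              ((counters u t).n x a + episodeVisits (u (t + 1)) x a) := by
        change (Counters.step (counters u t) (u (t + 1))).N = _
        unfold Counters.step
        exact congrArg Counters.N (if_pos hc)
      have h1 : ∑ x, ∑ a, ((counters u t).N x a).size <
          ∑ x, ∑ a, ((counters u (t + 1)).N x a).size := by
        obtain ⟨x, a, hxa⟩ := hc
        rw [e]
        have hmono : ∀ x a, ((counters u t).N x a).size ≤ ((counters u t).N x a +
              ((counters u t).n x a + episodeVisits (u (t + 1)) x a)).size :=
          fun x a => Nat.size_le_size (Nat.le_add_right _ _)
        refine Finset.sum_lt_sum (fun x _ => Finset.sum_le_sum fun a _ => hmono x a)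
          ⟨x, Finset.mem_univ _, Finset.sum_lt_sum (fun a _ => hmono x a)
            ⟨a, Finset.mem_univ _, size_add_one_le hxa⟩⟩
      have h2 : ∀ (s : Finset ℕ) (p : Prop) [Decidable p],
          (if p then insert t s else s).card ≤ s.card + 1 := by
        intro s p _
        split_ifs
        · exact Finset.card_insert_le _ _
        · omega
      exact (h2 _ _).trans (by omega)
    · have e : counters u (t + 1) =
          { counters u t with
            n := fun x a => (counters u t).n x a + episodeVisits (u (t + 1)) x a
            m := fun x a x' => (counters u t).m x a x' +
              episodeTransitions (u (t + 1)) x a x' } := if_neg hc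
      rw [if_neg (by rw [e]; exact not_not.2 rfl), e]
      exact ih

lemma size_le_log {n T : ℕ} (hT : 2 ≤ T) (hn : n ≤ T) : (n.size : ℝ) ≤ 3 * Real.log T := by
  have h2 := Real.log_two_gt_d9
  have hT' : (2 : ℝ) ≤ T := by exact_mod_cast hT
  have h3 := Real.log_le_log (by norm_num : (0 : ℝ) < 2) hT'
  rcases Nat.eq_zero_or_pos n with rfl | hn0
  · simp only [Nat.size_zero, Nat.cast_zero]; linarith
  obtain ⟨k, hk⟩ : ∃ k, n.size = k + 1 := ⟨n.size - 1, by have := Nat.size_pos.2 hn0; omega⟩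
  have h4 : 2 ^ k ≤ T := (Nat.lt_size.1 (by omega)).trans hn
  have h5 : (2 : ℝ) ^ k ≤ T := by exact_mod_cast h4
  have h6 := Real.log_le_log (by positivity) h5
  rw [Real.log_pow] at h6
  have h7 : (0 : ℝ) ≤ k := Nat.cast_nonneg k
  rw [hk]
  push_cast
  nlinarith

open Classical in
/-- The number of epochs is logarithmic in `T` for every state-action pair. -/
lemma card_domain_changes_le {u : ℕ → Traj X A L} {T : ℕ} (hT : 2 ≤ T)
    (hu : ∀ i < T, IsLegal S (u (i + 1))) (δ : ℝ) :
    (((Finset.range T).filter fun i => (counters u (i + 1)).domain S T δ ≠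
      (counters u i).domain S T δ).card : ℝ) ≤
      Fintype.card X * Fintype.card A * (3 * Real.log T) := by
  have h1 : (((Finset.range T).filter fun i => (counters u (i + 1)).domain S T δ ≠
      (counters u i).domain S T δ).card : ℝ) ≤
      ∑ x, ∑ a, (((counters u T).N x a).size : ℝ) := by
    exact_mod_cast card_domain_changes_le_sum_size (S := S) u T δ T
  refine h1.trans ?_
  calc _ ≤ ∑ _x : X, ∑ _a : A, 3 * Real.log T := by
        refine Finset.sum_le_sum fun x _ => Finset.sum_le_sum fun a _ => size_le_log hT ?_
        obtain ⟨_, h, _⟩ := counters_spec u T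
        have := h x a
        have := visits_le hu x a
        omega
    _ = _ := by simp; ring

/-- The sum over all episodes of the confidence radii along the trajectories. -/
lemma sum_width_le {u : ℕ → Traj X A L} {T : ℕ} {δ : ℝ}
    (hu : ∀ i < T, IsLegal S (u (i + 1)))
    (hκ : 0 ≤ Real.log ((T : ℝ) * Fintype.card A * Fintype.card X / δ)) :
    ∑ i ∈ Finset.range T, ∑ l : Fin L,
        (counters u i).width S T δ ((u (i + 1)).1 l.castSucc) ((u (i + 1)).2 l) ≤
      6 * √(Real.log ((T : ℝ) * Fintype.card A * Fintype.card X / δ)) *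
        (Fintype.card X * √(T * Fintype.card A)) := by
  set κ := Real.log ((T : ℝ) * Fintype.card A * Fintype.card X / δ) with hκdef
  have hwidth : ∀ i x a, (counters u i).width S T δ x a ≤
      2 * √κ * (√(S.size (S.layer x + 1) : ℝ) * (1 / √(max 1 (visits u i x a : ℝ)))) := by
    intro i x a
    have h1 := max_visits_le u i x a
    unfold Counters.width
    rw [← hκdef]
    have hV : 0 < max 1 (visits u i x a : ℝ) := lt_max_of_lt_left one_pos
    have hN : 0 < max 1 ((counters u i).N x a : ℝ) := lt_max_of_lt_left one_pos
    refine Real.sqrt_le_iff.2 ⟨by positivity, ?_⟩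
    have h2 : (2 * √κ * (√(S.size (S.layer x + 1) : ℝ) *
        (1 / √(max 1 (visits u i x a : ℝ))))) ^ 2 =
        4 * κ * S.size (S.layer x + 1) / max 1 (visits u i x a : ℝ) := by
      rw [mul_pow, mul_pow, mul_pow, div_pow, Real.sq_sqrt hκ, Real.sq_sqrt hV.le,
        Real.sq_sqrt (Nat.cast_nonneg _)]
      ring
    rw [h2, div_le_div_iff₀ hN hV]
    have h3 : 0 ≤ 2 * (S.size (S.layer x + 1) : ℝ) * κ := by positivity
    nlinarith [mul_le_mul_of_nonneg_left h1 h3]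
  calc _ ≤ ∑ i ∈ Finset.range T, ∑ l : Fin L, 2 * √κ *
        (√(S.size (S.layer ((u (i + 1)).1 l.castSucc) + 1) : ℝ) *
          (1 / √(max 1 (visits u i ((u (i + 1)).1 l.castSucc) ((u (i + 1)).2 l) : ℝ)))) :=
        Finset.sum_le_sum fun i _ => Finset.sum_le_sum fun l _ => hwidth _ _ _
    _ = 2 * √κ * ∑ z ∈ S.pairs A, √(S.size (S.layer z.1 + 1) : ℝ) * ∑ i ∈ Finset.range T,
          (episodeVisits (u (i + 1)) z.1 z.2 : ℝ) / √(max 1 (visits u i z.1 z.2 : ℝ)) := by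
        simp only [← Finset.mul_sum]
        congr 1
        simp only [Finset.mul_sum]
        rw [Finset.sum_comm (s := S.pairs A)]
        refine Finset.sum_congr rfl fun i hi => ?_
        rw [sum_eq_sum_episodeVisits (hu i (Finset.mem_range.1 hi)) fun x a =>
          √(S.size (S.layer x + 1) : ℝ) * (1 / √(max 1 (visits u i x a : ℝ)))]
        exact Finset.sum_congr rfl fun z _ => by ring
    _ ≤ 2 * √κ * ∑ z ∈ S.pairs A, √(S.size (S.layer z.1 + 1) : ℝ) *
          (3 * √(visits u T z.1 z.2 : ℝ)) := by
        gcongr with z hz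
        exact sum_episodeVisits_div_sqrt_le hu z.1 z.2
    _ = 6 * √κ * ∑ z ∈ S.pairs A,
          √(S.size (S.layer z.1 + 1) : ℝ) * √(visits u T z.1 z.2 : ℝ) := by
        rw [Finset.mul_sum, Finset.mul_sum]
        exact Finset.sum_congr rfl fun z _ => by ring
    _ ≤ 6 * √κ * (Fintype.card X * √(T * Fintype.card A)) := by
        refine mul_le_mul_of_nonneg_left ?_ (by positivity)
        -- A layer is visited once in each episode. Cauchy-Schwarz inside the layer, and the
        -- arithmetic-geometric mean of two adjacent sizes, make the total linear in `|X|`.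
        have hlayer : ∀ l ∈ Finset.range L, ∑ z ∈ S.pairsAt A l,
            √(S.size (S.layer z.1 + 1) : ℝ) * √(visits u T z.1 z.2 : ℝ) ≤
            √(T * Fintype.card A) * (((S.size l : ℝ) + S.size (l + 1)) / 2) := by
          intro l hl
          have hl := Finset.mem_range.1 hl
          have hcs : (∑ z ∈ S.pairsAt A l, √(visits u T z.1 z.2 : ℝ)) ^ 2 ≤
              (S.size l * Fintype.card A) * T := by
            have h1 := sq_sum_le_card_mul_sum_sq (s := S.pairsAt A l)
              (f := fun z => √(visits u T z.1 z.2 : ℝ))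
            simp only [Real.sq_sqrt (Nat.cast_nonneg _), S.card_pairsAt] at h1
            refine h1.trans ?_
            push_cast
            exact mul_le_mul_of_nonneg_left (sum_pairsAt_visits_le hl hu) (by positivity)
          have h2 : ∑ z ∈ S.pairsAt A l, √(visits u T z.1 z.2 : ℝ) ≤
              √(S.size l : ℝ) * √(T * Fintype.card A) := by
            rw [← Real.sqrt_mul (Nat.cast_nonneg _)]
            refine Real.le_sqrt_of_sq_le (hcs.trans (le_of_eq ?_))
            ring
          calc _ = √(S.size (l + 1) : ℝ) * ∑ z ∈ S.pairsAt A l, √(visits u T z.1 z.2 : ℝ) := by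
                rw [Finset.mul_sum]
                refine Finset.sum_congr rfl fun z hz => ?_
                rw [Layering.mem_pairsAt.1 hz]
            _ ≤ √(S.size (l + 1) : ℝ) * (√(S.size l : ℝ) * √(T * Fintype.card A)) :=
                mul_le_mul_of_nonneg_left h2 (Real.sqrt_nonneg _)
            _ = √(T * Fintype.card A) * (√(S.size (l + 1) : ℝ) * √(S.size l : ℝ)) := by ring
            _ ≤ _ := by
                refine mul_le_mul_of_nonneg_left ?_ (Real.sqrt_nonneg _)
                nlinarith [sq_nonneg (√(S.size (l + 1) : ℝ) - √(S.size l : ℝ)),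
                  Real.sq_sqrt (Nat.cast_nonneg (α := ℝ) (S.size (l + 1))),
                  Real.sq_sqrt (Nat.cast_nonneg (α := ℝ) (S.size l))]
        rw [sum_pairs_eq_sum_pairsAt]
        refine (Finset.sum_le_sum hlayer).trans ?_
        rw [← Finset.mul_sum, ← Finset.sum_div, Finset.sum_add_distrib, mul_comm]
        refine mul_le_mul_of_nonneg_right ?_ (Real.sqrt_nonneg _)
        have hsize : ∑ l ∈ Finset.range (L + 1), S.size l = Fintype.card X := by
          unfold Layering.size
          rw [← Finset.card_eq_sum_card_fiberwise (s := Finset.univ)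
            (fun x _ => by simpa using Nat.lt_succ_of_le (S.layer_le x))]
          rfl
        have h1 : (∑ l ∈ Finset.range L, (S.size l : ℝ)) ≤ Fintype.card X := by
          rw [← hsize, Finset.sum_range_succ]
          push_cast
          linarith [Nat.cast_nonneg (α := ℝ) (S.size L)]
        have h2 : (∑ l ∈ Finset.range L, (S.size (l + 1) : ℝ)) ≤ Fintype.card X := by
          rw [← hsize, Finset.sum_range_succ']
          push_cast
          linarith [Nat.cast_nonneg (α := ℝ) (S.size 0)]
        linarith

end Visits

/-! ### Concentration of adapted sequences -/

section Concentration

variable {Ω : Type*} {mΩ : MeasurableSpace Ω} {μ : Measure Ω}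

lemma integrable_of_measurable_of_bound [IsFiniteMeasure μ] {f : Ω → ℝ} (hf : Measurable f)
    {c : ℝ} (hc : ∀ ω, |f ω| ≤ c) : Integrable f μ :=
  Integrable.of_bound hf.aestronglyMeasurable c (Filter.Eventually.of_forall hc)

/-- If `X` and `Z` have the same integral over the sets of `m` and `Z` is `m`-measurable, they have
the same integral against bounded `m`-measurable weights. -/
lemma integral_mul_eq_of_setIntegral_eq [IsFiniteMeasure μ] {m : MeasurableSpace Ω} (hm : m ≤ mΩ)
    {X Z w : Ω → ℝ} (hX : Integrable X μ) (hZ : Integrable Z μ) (hZm : Measurable[m] Z)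
    (h : ∀ E, MeasurableSet[m] E → ∫ ω in E, X ω ∂μ = ∫ ω in E, Z ω ∂μ)
    (hw : Measurable[m] w) {c : ℝ} (hc : ∀ ω, |w ω| ≤ c) :
    ∫ ω, w ω * X ω ∂μ = ∫ ω, w ω * Z ω ∂μ := by
  have h1 : Z =ᵐ[μ] μ[X|m] := ae_eq_condExp_of_forall_setIntegral_eq hm hX
    (fun s _ _ => hZ.integrableOn) (fun s hs _ => (h s hs).symm)
    hZm.stronglyMeasurable.aestronglyMeasurable
  have hwX : Integrable (w * X) μ :=
    hX.bdd_mul (hw.mono hm le_rfl).aestronglyMeasurable (Filter.Eventually.of_forall hc)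
  have h2 := condExp_mul_of_stronglyMeasurable_left (μ := μ) hw.stronglyMeasurable hwX hX
  calc ∫ ω, w ω * X ω ∂μ = ∫ ω, (μ[w * X|m]) ω ∂μ := (integral_condExp hm).symm
    _ = ∫ ω, w ω * Z ω ∂μ := by
        refine integral_congr_ae ?_
        filter_upwards [h1, h2] with ω h1 h2
        rw [h2, Pi.mul_apply, h1]

/-- Products of adapted factors with conditional mean at most one have mean at most one. -/
lemma integral_prod_le_one [IsProbabilityMeasure μ] {m : ℕ → MeasurableSpace Ω}
    (hmono : Monotone m) {Y : ℕ → Ω → ℝ} {T : ℕ} {c : ℝ}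
    (hY : ∀ i < T, Measurable[m (i + 1)] (Y i)) (hY0 : ∀ i < T, ∀ ω, 0 ≤ Y i ω)
    (hYc : ∀ i < T, ∀ ω, Y i ω ≤ c)
    (hint : ∀ i < T, ∀ w : Ω → ℝ, Measurable[m i] w → (∀ ω, 0 ≤ w ω) →
      (∃ c, ∀ ω, w ω ≤ c) → ∫ ω, w ω * Y i ω ∂μ ≤ ∫ ω, w ω ∂μ)
    {s t : ℕ} (hst : s ≤ t) (ht : t ≤ T) :
    ∫ ω, ∏ i ∈ Finset.Ico s t, Y i ω ∂μ ≤ 1 := by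
  induction t, hst using Nat.le_induction with
  | base => simp
  | succ t hst ih =>
    refine le_trans ?_ (ih (by omega))
    simp only [Finset.prod_Ico_succ_top hst]
    refine hint t (by omega) (fun ω => ∏ i ∈ Finset.Ico s t, Y i ω) ?_ ?_ ?_
    · refine Finset.measurable_fun_prod _ fun i hi => ?_
      have hi := Finset.mem_Ico.1 hi
      exact (hY i (by omega)).mono (hmono (by omega)) le_rfl
    · exact fun ω => Finset.prod_nonneg fun i hi =>
        hY0 i (by have := Finset.mem_Ico.1 hi; omega) ω
    · exact ⟨∏ i ∈ Finset.Ico s t, c, fun ω => Finset.prod_le_prod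
        (fun i hi => hY0 i (by have := Finset.mem_Ico.1 hi; omega) ω)
        (fun i hi => hYc i (by have := Finset.mem_Ico.1 hi; omega) ω)⟩

/-- Markov's inequality for a nonnegative variable of mean at most one. -/
lemma measureReal_le_exp_neg [IsProbabilityMeasure μ] {Z : Ω → ℝ} (hZ : Integrable Z μ)
    (h0 : ∀ ω, 0 ≤ Z ω) (h1 : ∫ ω, Z ω ∂μ ≤ 1) {E : Set Ω} {x : ℝ}
    (hE : ∀ ω ∈ E, Real.exp x ≤ Z ω) : μ.real E ≤ Real.exp (-x) := by
  have h2 := mul_meas_ge_le_integral_of_nonneg (Filter.Eventually.of_forall h0) hZ (Real.exp x)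
  have h3 : μ.real E ≤ μ.real {ω | Real.exp x ≤ Z ω} := measureReal_mono hE
  rw [Real.exp_neg]
  rw [← one_div, le_div_iff₀ (Real.exp_pos x)]
  nlinarith [Real.exp_pos x]

/-- The Azuma-Hoeffding inequality over the window `[s, t)`. The sequence is orthogonal to the
past in the sense that it integrates to zero against bounded weights. -/
lemma azuma_hoeffding [IsProbabilityMeasure μ] {m : ℕ → MeasurableSpace Ω}
    (hm : ∀ i, m i ≤ mΩ) (hmono : Monotone m) {d : ℕ → Ω → ℝ} {T : ℕ} {c : ℝ} (hc : 0 < c)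
    (hd : ∀ i < T, Measurable[m (i + 1)] (d i)) (hdc : ∀ i < T, ∀ ω, |d i ω| ≤ c)
    (horth : ∀ i < T, ∀ w : Ω → ℝ, Measurable[m i] w → (∃ c, ∀ ω, |w ω| ≤ c) →
      ∫ ω, w ω * d i ω ∂μ = 0)
    {s t : ℕ} (hst : s ≤ t) (ht : t ≤ T) {ι : ℝ} (hι : 0 ≤ ι) :
    μ.real {ω | c * √(2 * (t - s : ℕ) * ι) < ∑ i ∈ Finset.Ico s t, d i ω} ≤ Real.exp (-ι) := by
  rcases hst.eq_or_lt with rfl | hlt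
  · simp [Real.exp_nonneg]
  have hn : (0 : ℝ) < (t - s : ℕ) := by exact_mod_cast Nat.sub_pos_of_lt hlt
  set n : ℝ := ((t - s : ℕ) : ℝ) with hndef
  -- The moment generating function at `α / c` gives the optimal bound.
  set α : ℝ := √(2 * ι / n) with hα
  have hα2 : α ^ 2 = 2 * ι / n := Real.sq_sqrt (by positivity)
  have hα0 : 0 ≤ α := Real.sqrt_nonneg _
  set Y : ℕ → Ω → ℝ := fun i ω => Real.exp (d i ω / c * α - α ^ 2 / 2) with hY
  have habs : ∀ i < T, ∀ ω, |d i ω / c| ≤ 1 := fun i hi ω => by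
    rw [abs_div, abs_of_pos hc, div_le_one hc]; exact hdc i hi ω
  have hYm : ∀ i < T, Measurable[m (i + 1)] (Y i) := fun i hi =>
    Real.measurable_exp.comp ((((hd i hi).div_const c).mul_const α).sub_const _)
  have hYc : ∀ i < T, ∀ ω, Y i ω ≤ Real.exp α := fun i hi ω => by
    refine Real.exp_le_exp.2 ?_
    have := (abs_le.1 (habs i hi ω)).2
    nlinarith
  have hprod := integral_prod_le_one (μ := μ) hmono hYm (fun i _ ω => (Real.exp_pos _).le) hYc
    (fun i hi w hw hw0 ⟨cw, hcw⟩ => by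
      have hwm := hw.mono (hm i) le_rfl
      have hdm := (hd i hi).mono (hm (i + 1)) le_rfl
      have hwabs : ∀ ω, |w ω| ≤ cw := fun ω => by rw [abs_of_nonneg (hw0 ω)]; exact hcw ω
      have hwi : Integrable w μ := integrable_of_measurable_of_bound hwm hwabs
      have hdi : Integrable (fun ω => w ω * d i ω) μ :=
        integrable_of_measurable_of_bound (hwm.mul hdm) (c := cw * c) fun ω => by
          rw [abs_mul]
          exact mul_le_mul (hwabs ω) (hdc i hi ω) (abs_nonneg _) ((abs_nonneg _).trans (hwabs ω))
      have h0 := horth i hi w hw ⟨cw, hwabs⟩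
      have hpt : ∀ ω, w ω * Y i ω ≤ w ω +
          Real.exp (-(α ^ 2 / 2)) * (Real.sinh α / c) * (w ω * d i ω) := by
        intro ω
        have h1 := Real.exp_mul_le_cosh_add_mul_sinh (habs i hi ω) α
        have h2 := Real.cosh_le_exp_half_sq α
        have h3 : Y i ω = Real.exp (-(α ^ 2 / 2)) * Real.exp (d i ω / c * α) := by
          rw [← Real.exp_add]
          simp only [hY]
          congr 1
          ring
        have h4 : Real.exp (-(α ^ 2 / 2)) * Real.exp (α ^ 2 / 2) = 1 := by
          rw [← Real.exp_add]; simp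
        have h5 := mul_le_mul_of_nonneg_left (h1.trans (add_le_add h2 le_rfl))
          (Real.exp_pos (-(α ^ 2 / 2))).le
        rw [← h3, mul_add, h4] at h5
        calc w ω * Y i ω ≤ w ω * (1 + Real.exp (-(α ^ 2 / 2)) * (d i ω / c * Real.sinh α)) :=
              mul_le_mul_of_nonneg_left h5 (hw0 ω)
          _ = _ := by ring
      calc ∫ ω, w ω * Y i ω ∂μ ≤ ∫ ω, (w ω +
            Real.exp (-(α ^ 2 / 2)) * (Real.sinh α / c) * (w ω * d i ω)) ∂μ := by
            refine integral_mono ?_ (hwi.add (hdi.const_mul _)) hpt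
            refine integrable_of_measurable_of_bound
              (hwm.mul ((hYm i hi).mono (hm (i + 1)) le_rfl)) (c := cw * Real.exp α) fun ω => ?_
            rw [abs_mul, abs_of_pos (Real.exp_pos _)]
            exact mul_le_mul (hwabs ω) (hYc i hi ω) (Real.exp_pos _).le
              ((abs_nonneg _).trans (hwabs ω))
        _ = ∫ ω, w ω ∂μ := by
            rw [integral_add hwi (hdi.const_mul _), integral_const_mul, h0, mul_zero, add_zero])
    hst ht
  refine measureReal_le_exp_neg (Z := fun ω => ∏ i ∈ Finset.Ico s t, Y i ω) ?_
    (fun ω => Finset.prod_nonneg fun i _ => (Real.exp_pos _).le) hprod ?_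
  · refine integrable_of_measurable_of_bound (c := ∏ i ∈ Finset.Ico s t, Real.exp α)
      (Finset.measurable_fun_prod _ fun i hi => ?_) fun ω => ?_
    · exact (hYm i (by have := Finset.mem_Ico.1 hi; omega)).mono (hm _) le_rfl
    · rw [abs_of_nonneg (Finset.prod_nonneg fun i _ => (Real.exp_pos _).le)]
      exact Finset.prod_le_prod (fun i _ => (Real.exp_pos _).le)
        (fun i hi => hYc i (by have := Finset.mem_Ico.1 hi; omega) ω)
  · intro ω hω
    simp only [hY]
    rw [← Real.exp_sum]
    refine Real.exp_le_exp.2 ?_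
    rw [Finset.sum_sub_distrib, ← Finset.sum_mul, ← Finset.sum_div, Finset.sum_const,
      Nat.card_Ico, nsmul_eq_mul, ← hndef, hα2]
    have h1 : √(2 * n * ι) = n * α := by
      rw [Real.sqrt_eq_iff_mul_self_eq (by positivity) (by positivity)]
      have : n * α * (n * α) = n ^ 2 * α ^ 2 := by ring
      rw [this, hα2]
      field_simp
    have h2 : c * (n * α) ≤ ∑ i ∈ Finset.Ico s t, d i ω := by rw [← h1]; exact le_of_lt hω
    have h3 : n * α ≤ (∑ i ∈ Finset.Ico s t, d i ω) / c := by
      rw [le_div_iff₀ hc]; linarith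
    have h4 := mul_le_mul_of_nonneg_right h3 hα0
    have h5 : n * α * α = 2 * ι := by
      rw [mul_assoc, ← sq, hα2]; field_simp
    have h6 : n * (2 * ι / n / 2) = ι := by field_simp
    rw [h6]
    linarith

/-- Conditionally on `m`, the variable `u` with values in a finite type has the law `κ`. -/
structure HasCondLaw {V : Type*} [Fintype V] (μ : Measure Ω) (m : MeasurableSpace Ω)
    (u : Ω → V) (κ : Ω → V → ℝ) : Prop where
  le : m ≤ mΩ
  measurableSet_eq : ∀ v, MeasurableSet[mΩ] {ω | u ω = v}
  measurable : ∀ v, Measurable[m] fun ω => κ ω v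
  nonneg : ∀ ω v, 0 ≤ κ ω v
  sum_eq_one : ∀ ω, ∑ v, κ ω v = 1
  law : ∀ E, MeasurableSet[m] E → ∀ v, μ.real (E ∩ {ω | u ω = v}) = ∫ ω in E, κ ω v ∂μ

/-- A function of `ω` and of a discrete variable is measurable if its sections are. -/
lemma measurable_comp_discrete {V : Type*} [Fintype V] {m : MeasurableSpace Ω} {u : Ω → V}
    (hu : ∀ v, MeasurableSet[m] {ω | u ω = v}) {φ : Ω → V → ℝ}
    (hφ : ∀ v, Measurable[m] fun ω => φ ω v) : Measurable[m] fun ω => φ ω (u ω) := by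
  classical
  have : (fun ω => φ ω (u ω)) = fun ω => ∑ v, if u ω = v then φ ω v else 0 := by
    funext ω; simp
  rw [this]
  exact Finset.measurable_fun_sum _ fun v _ => Measurable.ite (hu v) (hφ v) measurable_const

lemma HasCondLaw.le_one {V : Type*} [Fintype V] {m : MeasurableSpace Ω} {u : Ω → V}
    {κ : Ω → V → ℝ} (h : HasCondLaw μ m u κ) (ω : Ω) (v : V) : κ ω v ≤ 1 := by
  rw [← h.sum_eq_one ω]
  exact Finset.single_le_sum (f := κ ω) (fun v _ => h.nonneg ω v) (Finset.mem_univ v)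

/-- Integrals of functions of `u` are computed with its conditional law. -/
lemma HasCondLaw.integral_eq [IsProbabilityMeasure μ] {V : Type*} [Fintype V]
    {m : MeasurableSpace Ω} {u : Ω → V} {κ : Ω → V → ℝ} (h : HasCondLaw μ m u κ)
    {φ : Ω → V → ℝ} (hφ : ∀ v, Measurable[m] fun ω => φ ω v) {c : ℝ}
    (hc : ∀ ω v, |φ ω v| ≤ c) :
    ∫ ω, φ ω (u ω) ∂μ = ∫ ω, ∑ v, κ ω v * φ ω v ∂μ := by
  classical
  have h1 : ∀ ω, φ ω (u ω) = ∑ v, φ ω v * Set.indicator {ω | u ω = v} (fun _ => (1 : ℝ)) ω := by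
    intro ω
    simp [Set.indicator_apply]
  have hφ' : ∀ v, Measurable[mΩ] fun ω => φ ω v := fun v => (hφ v).mono h.le le_rfl
  have hκ' : ∀ v, Measurable[mΩ] fun ω => κ ω v := fun v => (h.measurable v).mono h.le le_rfl
  have hind : ∀ v, Integrable (Set.indicator {ω | u ω = v} (fun _ => (1 : ℝ))) μ := fun v =>
    (integrable_const 1).indicator (h.measurableSet_eq v)
  have hκi : ∀ v, Integrable (fun ω => κ ω v) μ := fun v =>
    integrable_of_measurable_of_bound (hκ' v) (c := 1) fun ω => by
      rw [abs_of_nonneg (h.nonneg ω v)]; exact h.le_one ω v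
  simp only [h1]
  rw [integral_finsetSum _ fun v _ => (hind v).bdd_mul (hφ' v).aestronglyMeasurable
      (Filter.Eventually.of_forall fun ω => hc ω v),
    integral_finsetSum _ fun v _ => ((hκi v).mul_bdd (hφ' v).aestronglyMeasurable
      (Filter.Eventually.of_forall fun ω => hc ω v))]
  refine Finset.sum_congr rfl fun v _ => ?_
  simp only [mul_comm (κ _ v)]
  refine integral_mul_eq_of_setIntegral_eq h.le (hind v) (hκi v) (h.measurable v) (fun E hE => ?_)
    (hφ v) (fun ω => hc ω v)
  rw [← h.law E hE v, integral_indicator (h.measurableSet_eq v),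
    Measure.restrict_restrict (h.measurableSet_eq v), setIntegral_const, Set.inter_comm]
  simp

end Concentration

/-! ### The confidence sets contain the true transitions -/

section Weissman

/-- Hoeffding's lemma for a probability vector and a function with values in `[-1, 1]`. -/
lemma sum_mul_exp_le {X : Type*} [Fintype X] {p s : X → ℝ} (hp : ∀ x, 0 ≤ p x)
    (hp1 : ∑ x, p x = 1) (hs : ∀ x, s x ∈ Set.Icc (-1 : ℝ) 1) (α : ℝ) :
    ∑ x, p x * Real.exp (α * (s x - ∑ y, p y * s y)) ≤ Real.exp (α ^ 2 / 2) := by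
  let _ : MeasurableSpace X := ⊤
  set ν : Measure X := ∑ x, ENNReal.ofReal (p x) • Measure.dirac x with hν
  have hfin : ∀ x, IsFiniteMeasure (ENNReal.ofReal (p x) • Measure.dirac x) := fun x =>
    Measure.smul_finite _ ENNReal.ofReal_ne_top
  have hint : ∀ f : X → ℝ, ∫ x, f x ∂ν = ∑ x, p x * f x := by
    intro f
    rw [hν, integral_finsetSum_measure fun x _ => Integrable.of_finite]
    refine Finset.sum_congr rfl fun x _ => ?_
    rw [integral_smul_measure, integral_dirac, ENNReal.toReal_ofReal (hp x), smul_eq_mul]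
  have hprob : IsProbabilityMeasure ν := by
    constructor
    rw [hν, Measure.finsetSum_apply]
    simp only [Measure.smul_apply, measure_univ, smul_eq_mul, mul_one]
    rw [← ENNReal.ofReal_sum_of_nonneg fun x _ => hp x, hp1, ENNReal.ofReal_one]
  have h := (hasSubgaussianMGF_of_mem_Icc (μ := ν) (X := s) (a := -1) (b := 1)
    (measurable_from_top.aemeasurable) (Filter.Eventually.of_forall hs)).mgf_le α
  simp only [mgf, hint] at h
  refine h.trans (le_of_eq ?_)
  congr 1
  have : ((‖(1 : ℝ) - -1‖₊ / 2) ^ 2 : NNReal) = 1 := by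
    have : ‖(1 : ℝ) - -1‖₊ = 2 := by
      ext; simp; norm_num
    rw [this]; norm_num
  rw [this]
  simp

/-- The deviation of the transitions out of `(x, a)` in one episode, tested with the function `s`,
from its mean given the visits to `(x, a)`. -/
def signedDeviation {X A : Type*} [Fintype X] {L : ℕ} (P : X → A → X → ℝ) (x : X) (a : A)
    (s : X → ℝ) (v : Traj X A L) : ℝ :=
  ∑ x', (episodeTransitions v x a x' : ℝ) * s x' -
    (episodeVisits v x a : ℝ) * ∑ x', P x a x' * s x'

open Classical in
lemma episodeTransitions_eq {X A : Type*} {L : ℕ} {S : Layering X L} {v : Traj X A L}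
    (hv : IsLegal S v) {x : X} {a : A} (hx : S.layer x < L) (x' : X) :
    episodeTransitions v x a x' = if v.1 (Fin.castSucc ⟨S.layer x, hx⟩) = x ∧
      v.2 ⟨S.layer x, hx⟩ = a ∧ v.1 (Fin.succ ⟨S.layer x, hx⟩) = x' then 1 else 0 := by
  have key : ∀ l : Fin L, v.1 l.castSucc = x → l = ⟨S.layer x, hx⟩ := fun l hl => by
    have := hv l.castSucc
    rw [hl] at this
    exact Fin.ext (by simpa using this.symm)
  unfold episodeTransitions
  split_ifs with h
  · refine Finset.card_eq_one.2 ⟨⟨S.layer x, hx⟩, ?_⟩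
    ext l
    simp only [Finset.mem_filter, Finset.mem_univ, true_and, Finset.mem_singleton]
    exact ⟨fun hl => key l hl.1, fun hl => hl ▸ h⟩
  · refine Finset.card_eq_zero.2 (Finset.filter_eq_empty_iff.2 fun l _ hl => h ?_)
    rw [key l hl.1] at hl
    exact hl

variable {X A : Type*} [Fintype X] [Fintype A] {L : ℕ} {S : Layering X L}
  {P : X → A → X → ℝ} {π : X → A → ℝ}

/-- The exponential of the deviation, compensated by the number of visits, has mean at most one. -/
lemma sum_trajProb_mul_exp_le_one (hP : IsTransition S P) (hπ : IsPolicy π) {x : X} {a : A}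
    (hx : S.layer x < L) {s : X → ℝ} (hs : ∀ x, s x ∈ Set.Icc (-1 : ℝ) 1) (α : ℝ) :
    ∑ v : Traj X A L, trajProb S P π v *
      Real.exp (α * signedDeviation P x a s v - α ^ 2 / 2 * episodeVisits v x a) ≤ 1 := by
  classical
  set F : X → A → X → ℝ := fun y b y' => if y = x ∧ b = a then
    Real.exp (α * (s y' - ∑ x', P x a x' * s x') - α ^ 2 / 2) else 1 with hF
  have h1 : ∀ v : Traj X A L, trajProb S P π v *
      Real.exp (α * signedDeviation P x a s v - α ^ 2 / 2 * episodeVisits v x a) =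
      trajProb S P π v * F (v.1 (Fin.castSucc ⟨S.layer x, hx⟩)) (v.2 ⟨S.layer x, hx⟩)
        (v.1 (Fin.succ ⟨S.layer x, hx⟩)) := by
    intro v
    by_cases hv : trajProb S P π v = 0
    · rw [hv, zero_mul, zero_mul]
    have hleg : IsLegal S v := layer_of_trajProb_ne_zero hP hv
    congr 1
    simp only [hF, signedDeviation, episodeVisits_eq hleg hx, episodeTransitions_eq hleg hx]
    generalize v.1 (Fin.castSucc ⟨S.layer x, hx⟩) = y, v.2 ⟨S.layer x, hx⟩ = b,
      v.1 (Fin.succ ⟨S.layer x, hx⟩) = y'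
    by_cases hvis : y = x ∧ b = a
    · simp [hvis.1, hvis.2]
    · rw [if_neg hvis, if_neg hvis]
      have : ∀ x', ¬(y = x ∧ b = a ∧ y' = x') := fun x' h => hvis ⟨h.1, h.2.1⟩
      simp [this]
  rw [Finset.sum_congr rfl fun v _ => h1 v, sum_trajProb_step hP hπ ⟨S.layer x, hx⟩ F]
  calc _ ≤ ∑ y, forward S.start (stepKernel P π) (S.layer x) y * 1 := by
        refine Finset.sum_le_sum fun y _ => ?_
        simp only [mul_assoc, ← Finset.mul_sum]
        by_cases hy : S.layer y = S.layer x
        · refine mul_le_mul_of_nonneg_left ?_ (forward_nonneg hP hπ _ _)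
          rw [← hπ.sum_eq_one y]
          refine Finset.sum_le_sum fun b _ => ?_
          simp only [stepKernel, mul_assoc, ← Finset.mul_sum]
          refine mul_le_of_le_one_right (hπ.nonneg y b) ?_
          by_cases hyb : y = x ∧ b = a
          · obtain ⟨rfl, rfl⟩ := hyb
            simp only [hF, and_self, if_true]
            have h2 := sum_mul_exp_le (hP.nonneg y b) (hP.sum_eq_one y b hx) hs α
            calc ∑ y', P y b y' * Real.exp (α * (s y' - ∑ x', P y b x' * s x') - α ^ 2 / 2)
                = Real.exp (-(α ^ 2 / 2)) *
                    ∑ y', P y b y' * Real.exp (α * (s y' - ∑ x', P y b x' * s x')) := by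
                  rw [Finset.mul_sum]
                  refine Finset.sum_congr rfl fun y' _ => ?_
                  rw [sub_eq_add_neg _ (α ^ 2 / 2), Real.exp_add]
                  ring
              _ ≤ Real.exp (-(α ^ 2 / 2)) * Real.exp (α ^ 2 / 2) :=
                  mul_le_mul_of_nonneg_left h2 (Real.exp_pos _).le
              _ = 1 := by rw [← Real.exp_add]; simp
          · simp only [hF, if_neg hyb, mul_one]
            rw [hP.sum_eq_one y b (hy ▸ hx)]
        · rw [forward_eq_zero hP hy, zero_mul, zero_mul]
    _ = 1 := by simp only [mul_one]; exact sum_forward hP hπ hx.le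

lemma sum_signedDeviation {X A : Type*} [Fintype X] {L : ℕ} (P : X → A → X → ℝ) (x : X) (a : A)
    (s : X → ℝ) (u : ℕ → Traj X A L) (t : ℕ) :
    ∑ i ∈ Finset.range t, signedDeviation P x a s (u (i + 1)) =
      ∑ x', (transitions u t x a x' : ℝ) * s x' -
        (visits u t x a : ℝ) * ∑ x', P x a x' * s x' := by
  simp only [signedDeviation, Finset.sum_sub_distrib, transitions, visits, Nat.cast_sum,
    Finset.sum_mul]
  rw [Finset.sum_comm]

lemma sum_transitions {X A : Type*} [Fintype X] {L : ℕ} {S : Layering X L}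
    {u : ℕ → Traj X A L} {t : ℕ} (hu : ∀ i < t, IsLegal S (u (i + 1))) {x : X}
    (hx : S.layer x < L) (a : A) : ∑ x', transitions u t x a x' = visits u t x a := by
  classical
  unfold transitions visits
  rw [Finset.sum_comm]
  refine Finset.sum_congr rfl fun i hi => ?_
  have hleg := hu i (Finset.mem_range.1 hi)
  rw [episodeVisits_eq hleg hx]
  simp only [episodeTransitions_eq hleg hx]
  generalize (u (i + 1)).1 (Fin.castSucc ⟨S.layer x, hx⟩) = y, (u (i + 1)).2 ⟨S.layer x, hx⟩ = b,
    (u (i + 1)).1 (Fin.succ ⟨S.layer x, hx⟩) = y'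
  by_cases h : y = x ∧ b = a
  · simp [h.1, h.2]
  · rw [if_neg h]
    exact Finset.sum_eq_zero fun x' _ => if_neg fun h' => h ⟨h'.1, h'.2.1⟩

lemma transitions_eq_zero {X A : Type*} {L : ℕ} {S : Layering X L} {u : ℕ → Traj X A L} {t : ℕ}
    (hu : ∀ i < t, IsLegal S (u (i + 1)))
    {x x' : X} (hx : S.layer x < L) (hx' : S.layer x' ≠ S.layer x + 1) (a : A) :
    transitions u t x a x' = 0 := by
  classical
  refine Finset.sum_eq_zero fun i hi => ?_
  have hleg := hu i (Finset.mem_range.1 hi)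
  rw [episodeTransitions_eq hleg hx, if_neg]
  rintro ⟨-, -, h⟩
  apply hx'
  rw [← h, hleg]
  simp

/-- The states of layer `l`. -/
def Layering.states (S : Layering X L) (l : ℕ) : Finset X :=
  Finset.univ.filter fun x => S.layer x = l

open Classical in
/-- The function with value `1` on `D` and `-1` elsewhere. -/
def signOf {X : Type*} (D : Finset X) (x : X) : ℝ := if x ∈ D then 1 else -1

/-- The counts `M / max 1 N` fail the confidence bound at `(x, a)` only if `(x, a)` was visited, the
next layer has at least two states, and the deviation in the direction of some sign vector of
that layer is large. -/
lemma exists_sign_of_width_lt {X A : Type*} [Fintype X] {L : ℕ} {S : Layering X L}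
    {P : X → A → X → ℝ} (hP : IsTransition S P) {u : ℕ → Traj X A L} {t : ℕ}
    (hu : ∀ i < t, IsLegal S (u (i + 1))) {x : X} (hx : S.layer x < L) {a : A} {κ : ℝ}
    (hκ : 1 / 2 ≤ κ)
    (hw : √(2 * (S.size (S.layer x + 1) : ℝ) * κ / max 1 (visits u t x a : ℝ)) <
      ∑ x', |P x a x' - (transitions u t x a x' : ℝ) / max 1 (visits u t x a : ℝ)|) :
    1 ≤ visits u t x a ∧ 2 ≤ S.size (S.layer x + 1) ∧
      ∃ D ∈ (S.states (S.layer x + 1)).powerset,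
        (visits u t x a : ℝ) *
            √(2 * (S.size (S.layer x + 1) : ℝ) * κ / (visits u t x a : ℝ)) <
          ∑ i ∈ Finset.range t, signedDeviation P x a (signOf D) (u (i + 1)) := by
  classical
  have hM1 : ∑ x', (transitions u t x a x' : ℝ) = visits u t x a := by
    exact_mod_cast sum_transitions hu hx a
  have hM0 : ∀ x', S.layer x' ≠ S.layer x + 1 → (transitions u t x a x' : ℝ) = 0 := fun x' h => by
    exact_mod_cast transitions_eq_zero hu hx h a
  have hP1 := hP.sum_eq_one x a hx
  have hP0 : ∀ x', S.layer x' ≠ S.layer x + 1 → P x a x' = 0 := fun x' h =>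
    le_antisymm (not_lt.1 fun h' => h (hP.loop_free x a x' h')) (hP.nonneg x a x')
  have hsize : 1 ≤ S.size (S.layer x + 1) := by
    by_contra h
    have hempty : S.states (S.layer x + 1) = ∅ := Finset.card_eq_zero.1 (by
      change S.size (S.layer x + 1) = 0
      omega)
    have : ∑ x', P x a x' = 0 := Finset.sum_eq_zero fun x' _ => hP0 x' fun h' => by
      have : x' ∈ S.states (S.layer x + 1) := by simp [Layering.states, h']
      rw [hempty] at this
      simp at this
    linarith
  have hsize' : (1 : ℝ) ≤ S.size (S.layer x + 1) := by exact_mod_cast hsize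
  set N := visits u t x a
  have hN : 1 ≤ N := by
    by_contra h
    have hN0 : N = 0 := by omega
    rw [hN0] at hw hM1
    have hM : ∀ x', (transitions u t x a x' : ℝ) = 0 := fun x' =>
      (Finset.sum_eq_zero_iff_of_nonneg fun _ _ => Nat.cast_nonneg _).1
        (by simpa using hM1) x' (Finset.mem_univ _)
    simp only [hM, zero_div, sub_zero, abs_of_nonneg (hP.nonneg x a _), hP1] at hw
    refine absurd hw (not_lt.2 (Real.one_le_sqrt.2 ?_))
    rw [Nat.cast_zero, max_eq_left zero_le_one, div_one]
    nlinarith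
  have hN1 : (1 : ℝ) ≤ N := by exact_mod_cast hN
  have hN0 : (0 : ℝ) < N := by linarith
  rw [max_eq_right hN1] at hw
  refine ⟨hN, ?_, ?_⟩
  · by_contra h
    have hcard : (S.states (S.layer x + 1)).card = 1 := by
      change S.size (S.layer x + 1) = 1
      omega
    obtain ⟨y, hy⟩ := Finset.card_eq_one.1 hcard
    have hout : ∀ x', x' ≠ y → S.layer x' ≠ S.layer x + 1 := fun x' h h' => by
      have : x' ∈ S.states (S.layer x + 1) := by simp [Layering.states, h']
      rw [hy] at this
      exact h (Finset.mem_singleton.1 this)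
    have e1 : P x a y = 1 := by
      rw [← hP1]
      exact (Finset.sum_eq_single y (fun x' _ h => hP0 x' (hout x' h)) (by simp)).symm
    have e2 : (transitions u t x a y : ℝ) = N := by
      rw [← hM1]
      exact (Finset.sum_eq_single y (fun x' _ h => hM0 x' (hout x' h)) (by simp)).symm
    have e3 : ∑ x', |P x a x' - (transitions u t x a x' : ℝ) / N| = 0 := by
      rw [Finset.sum_eq_single y (fun x' _ h => by
        rw [hP0 x' (hout x' h), hM0 x' (hout x' h)]; simp) (by simp), e1, e2, div_self hN0.ne']
      simp
    rw [e3] at hw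
    exact absurd hw (not_lt.2 (Real.sqrt_nonneg _))
  · refine ⟨(S.states (S.layer x + 1)).filter fun x' => P x a x' ≤ (transitions u t x a x' : ℝ) / N,
      Finset.mem_powerset.2 (Finset.filter_subset _ _), ?_⟩
    set D := (S.states (S.layer x + 1)).filter fun x' =>
      P x a x' ≤ (transitions u t x a x' : ℝ) / N with hD
    refine (mul_lt_mul_of_pos_left hw hN0).trans_le (le_of_eq ?_)
    rw [sum_signedDeviation, Finset.mul_sum, Finset.mul_sum, ← Finset.sum_sub_distrib]
    refine Finset.sum_congr rfl fun x' _ => ?_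
    by_cases hl : S.layer x' = S.layer x + 1
    · have hmem : x' ∈ D ↔ P x a x' ≤ (transitions u t x a x' : ℝ) / N := by
        simp [hD, Layering.states, hl]
      have e : (N : ℝ) * ((transitions u t x a x' : ℝ) / N) = transitions u t x a x' := by
        field_simp
      by_cases hle : P x a x' ≤ (transitions u t x a x' : ℝ) / N
      · rw [abs_of_nonpos (by linarith), signOf, if_pos (hmem.2 hle)]
        linear_combination e
      · rw [abs_of_pos (by linarith), signOf, if_neg (mt hmem.1 hle)]
        linear_combination -e
    · rw [hP0 x' hl, hM0 x' hl]
      simp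

end Weissman

/-! ### The process of one player -/

section Player

/-- The part of the interaction that concerns one player: the trajectories `u`, with the laws given
by the policies of the iterates `q`, which lie in the domains of the algorithm. -/
structure IsPlayer {Ω X A : Type*} {mΩ : MeasurableSpace Ω} [Fintype X] [Fintype A] {L : ℕ}
    (S : Layering X L) (P : X → A → X → ℝ) (T : ℕ) (δ : ℝ) (μ : Measure Ω)
    (ℱ : Filtration ℕ mΩ) (u : ℕ → Ω → Traj X A L) (q : ℕ → Ω → X → A → X → ℝ) : Prop where
  isTransition : IsTransition S P
  horizon_pos : 0 < L
  two_le : 2 ≤ T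
  mem : ∀ ω, ∀ t < T, q (t + 1) ω ∈ (counters (fun i => u i ω) t).domain S T δ
  measurable_q : ∀ t < T, Measurable[ℱ t] (q (t + 1))
  measurable_u : ∀ t < T, ∀ v, MeasurableSet[ℱ (t + 1)] {ω | u (t + 1) ω = v}
  law : ∀ t < T, ∀ E, MeasurableSet[ℱ t] E → ∀ v,
    μ.real (E ∩ {ω | u (t + 1) ω = v}) = ∫ ω in E, trajProb S P (policy (q (t + 1) ω)) v ∂μ

variable {Ω X A : Type*} {mΩ : MeasurableSpace Ω} [Fintype X] [Fintype A] {L : ℕ}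

lemma measurable_marginal {Ω X A : Type*} [Fintype X] {m : MeasurableSpace Ω}
    {q : Ω → X → A → X → ℝ} (hq : Measurable q) (x : X) (a : A) :
    Measurable fun ω => marginal (q ω) x a :=
  Finset.measurable_fun_sum _ fun x' _ => (measurable_pi_apply x').comp
    ((measurable_pi_apply a).comp ((measurable_pi_apply x).comp hq))

lemma measurable_policy {m : MeasurableSpace Ω} {q : Ω → X → A → X → ℝ} (hq : Measurable q)
    (x : X) (a : A) : Measurable fun ω => policy (q ω) x a := by
  have h := Finset.measurable_fun_sum Finset.univ fun a' _ => measurable_marginal hq x a'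
  unfold policy
  exact Measurable.ite (measurableSet_eq_fun h measurable_const) measurable_const
    ((measurable_marginal hq x a).div h)

lemma measurable_trajProb {m : MeasurableSpace Ω} {S : Layering X L} {P : X → A → X → ℝ}
    {q : Ω → X → A → X → ℝ} (hq : Measurable q) (v : Traj X A L) :
    Measurable fun ω => trajProb S P (policy (q ω)) v :=
  (Finset.measurable_fun_prod _ fun _ _ =>
    (measurable_policy hq _ _).mul_const _).const_mul _

namespace IsPlayer

variable {S : Layering X L} {P : X → A → X → ℝ} {T : ℕ} {δ : ℝ} {μ : Measure Ω}
  {ℱ : Filtration ℕ mΩ} {u : ℕ → Ω → Traj X A L} {q : ℕ → Ω → X → A → X → ℝ}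

lemma layered (hp : IsPlayer S P T δ μ ℱ u q) (ω : Ω) {t : ℕ} (ht : t < T) :
    IsLayered S (marginal (q (t + 1) ω)) :=
  Counters.isLayered_of_mem_domain (hp.mem ω t ht)

lemma nonempty (hp : IsPlayer S P T δ μ ℱ u q) (ω : Ω) : Nonempty A := by
  have h := (hp.layered ω (t := 0) (by have := hp.two_le; omega)).card_pos hp.horizon_pos
  refine Fintype.card_pos_iff.1 (Nat.pos_of_ne_zero fun h0 => ?_)
  simp [h0] at h

lemma isPolicy (hp : IsPlayer S P T δ μ ℱ u q) (ω : Ω) {t : ℕ} (ht : t < T) :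
    IsPolicy (policy (q (t + 1) ω)) :=
  have := hp.nonempty ω
  isPolicy_policy (hp.layered ω ht).nonneg

lemma hasCondLaw (hp : IsPlayer S P T δ μ ℱ u q) {t : ℕ} (ht : t < T) :
    HasCondLaw μ (ℱ t) (u (t + 1)) fun ω v => trajProb S P (policy (q (t + 1) ω)) v where
  le := ℱ.le t
  measurableSet_eq v := ℱ.le _ _ (hp.measurable_u t ht v)
  measurable v := measurable_trajProb (hp.measurable_q t ht) v
  nonneg ω v := trajProb_nonneg hp.isTransition (hp.isPolicy ω ht) v
  sum_eq_one ω := sum_trajProb hp.isTransition (hp.isPolicy ω ht)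
  law := hp.law t ht

/-- Almost surely all trajectories pass through the layers in order. -/
lemma measureReal_not_legal (hp : IsPlayer S P T δ μ ℱ u q) [IsProbabilityMeasure μ] :
    μ.real {ω | ∃ i < T, ¬ IsLegal S (u (i + 1) ω)} = 0 := by
  classical
  have h1 : {ω | ∃ i < T, ¬ IsLegal S (u (i + 1) ω)} ⊆ ⋃ i ∈ Finset.range T,
      ⋃ v ∈ Finset.univ.filter (fun v : Traj X A L => ¬ IsLegal S v), {ω | u (i + 1) ω = v} := by
    rintro ω ⟨i, hi, hl⟩
    simp only [Set.mem_iUnion]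
    exact ⟨i, by simpa using hi, _, by simpa using hl, rfl⟩
  refine le_antisymm ((measureReal_mono h1 (measure_ne_top _ _)).trans
    ((measureReal_biUnion_finset_le _ _).trans
    (Finset.sum_nonpos fun i hi => (measureReal_biUnion_finset_le _ _).trans
      (Finset.sum_nonpos fun v hv => le_of_eq ?_)))) measureReal_nonneg
  have hi := Finset.mem_range.1 hi
  have h2 := hp.law i hi Set.univ MeasurableSet.univ v
  rw [Set.univ_inter, Measure.restrict_univ] at h2
  rw [h2]
  refine integral_eq_zero_of_ae (Filter.Eventually.of_forall fun ω => ?_)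
  by_contra h
  exact (Finset.mem_filter.1 hv).2 (layer_of_trajProb_ne_zero hp.isTransition h)

/-- The tail bound for the deviations at a single pair, number of visits and test function. -/
lemma measureReal_deviation_le (hp : IsPlayer S P T δ μ ℱ u q) [IsProbabilityMeasure μ] {x : X}
    (hx : S.layer x < L) (a : A) {s : X → ℝ} (hs : ∀ x, s x ∈ Set.Icc (-1 : ℝ) 1) {t n : ℕ}
    (ht : t ≤ T) {ε : ℝ} (hε : 0 ≤ ε) :
    μ.real {ω | visits (fun i => u i ω) t x a = n ∧
      n * ε < ∑ i ∈ Finset.range t, signedDeviation P x a s (u (i + 1) ω)} ≤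
      Real.exp (-(n * ε ^ 2 / 2)) := by
  set φ : Traj X A L → ℝ := fun v =>
    Real.exp (ε * signedDeviation P x a s v - ε ^ 2 / 2 * episodeVisits v x a) with hφ
  have hφ0 : ∀ v, 0 ≤ φ v := fun v => (Real.exp_pos _).le
  set c : ℝ := ∑ v, φ v with hc
  have hφc : ∀ v, φ v ≤ c := fun v =>
    Finset.single_le_sum (fun v _ => hφ0 v) (Finset.mem_univ v)
  have hY : ∀ i < T, Measurable[ℱ (i + 1)] fun ω => φ (u (i + 1) ω) := fun i hi =>
    measurable_comp_discrete (m := ℱ (i + 1)) (hp.measurable_u i hi) (φ := fun _ v => φ v)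
      fun v => measurable_const
  have hprod := integral_prod_le_one (μ := μ) (m := fun i => ℱ i) (fun _ _ h => ℱ.mono h)
    (Y := fun i ω => φ (u (i + 1) ω)) (T := T) (c := c) hY (fun i _ ω => hφ0 _)
    (fun i _ ω => hφc _) (fun i hi w hw hw0 ⟨cw, hcw⟩ => by
      have hwabs : ∀ ω, |w ω| ≤ cw := fun ω => by rw [abs_of_nonneg (hw0 ω)]; exact hcw ω
      rw [(hp.hasCondLaw hi).integral_eq (φ := fun ω v => w ω * φ v)
        (fun v => hw.mul_const _) (c := cw * c) fun ω v => by
          rw [abs_mul, abs_of_nonneg (hφ0 v)]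
          exact mul_le_mul (hwabs ω) (hφc v) (hφ0 v) ((abs_nonneg _).trans (hwabs ω))]
      have hle : ∀ ω, ∑ v, trajProb S P (policy (q (i + 1) ω)) v * (w ω * φ v) ≤ w ω := by
        intro ω
        have := sum_trajProb_mul_exp_le_one hp.isTransition (hp.isPolicy ω hi) (a := a) hx hs ε
        calc _ = w ω * ∑ v, trajProb S P (policy (q (i + 1) ω)) v * φ v := by
              rw [Finset.mul_sum]
              exact Finset.sum_congr rfl fun v _ => by ring
          _ ≤ w ω := mul_le_of_le_one_right (hw0 ω) this
      refine integral_mono ?_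
        (integrable_of_measurable_of_bound (hw.mono (ℱ.le i) le_rfl) hwabs) hle
      refine integrable_of_measurable_of_bound (c := cw) (Finset.measurable_fun_sum _ fun v _ =>
        (((hp.hasCondLaw hi).measurable v).mul (hw.mul_const _)).mono (ℱ.le i) le_rfl) fun ω => ?_
      rw [abs_of_nonneg (Finset.sum_nonneg fun v _ => mul_nonneg
        ((hp.hasCondLaw hi).nonneg ω v) (mul_nonneg (hw0 ω) (hφ0 v)))]
      exact (hle ω).trans (hcw ω))
    (Nat.zero_le t) ht
  refine measureReal_le_exp_neg (Z := fun ω => ∏ i ∈ Finset.Ico 0 t, φ (u (i + 1) ω)) ?_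
    (fun ω => Finset.prod_nonneg fun i _ => hφ0 _) hprod ?_
  · refine integrable_of_measurable_of_bound (c := ∏ i ∈ Finset.Ico 0 t, c)
      (Finset.measurable_fun_prod _ fun i hi => ?_) fun ω => ?_
    · exact (hY i (by have := Finset.mem_Ico.1 hi; omega)).mono (ℱ.le _) le_rfl
    · rw [abs_of_nonneg (Finset.prod_nonneg fun i _ => hφ0 _)]
      exact Finset.prod_le_prod (fun i _ => hφ0 _) fun i _ => hφc _
  · rintro ω ⟨h1, h2⟩
    simp only [hφ]
    rw [← Real.exp_sum, ← Finset.range_eq_Ico, Finset.sum_sub_distrib, ← Finset.mul_sum,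
      ← Finset.mul_sum]
    refine Real.exp_le_exp.2 ?_
    have h3 : ∑ i ∈ Finset.range t, (episodeVisits (u (i + 1) ω) x a : ℝ) = n := by
      rw [← h1]
      simp [visits]
    rw [h3]
    nlinarith [mul_le_mul_of_nonneg_left h2.le hε]

end IsPlayer

end Player

/-! ### The executed policies of one player -/

section PlayerEvents

variable {Ω X A : Type*} {mΩ : MeasurableSpace Ω} [Fintype X] [Fintype A] {L : ℕ}
  {S : Layering X L} {P : X → A → X → ℝ} {T : ℕ} {δ : ℝ} {μ : Measure Ω}
  {ℱ : Filtration ℕ mΩ} {u : ℕ → Ω → Traj X A L} {q : ℕ → Ω → X → A → X → ℝ}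

namespace IsPlayer

/-- With high probability the true transitions lie in all confidence sets: a union bound over the
times, pairs, numbers of visits and sign vectors. -/
lemma measureReal_not_mem_confidenceSet_le [IsProbabilityMeasure μ] {p : ℝ} (hp0 : 0 < p)
    (hp1 : p < 1) (hp : IsPlayer S P T (p / (2 * T)) μ ℱ u q) :
    μ.real {ω | (∀ i < T, IsLegal S (u (i + 1) ω)) ∧
      ∃ t < T, P ∉ (counters (fun i => u i ω) t).confidenceSet S T (p / (2 * T))} ≤ p / 4 := by
  classical
  obtain ⟨ω₀⟩ := μ.nonempty_of_neZero
  have hA : 1 ≤ Fintype.card A := Fintype.card_pos_iff.2 (hp.nonempty ω₀)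
  have hX : 1 ≤ Fintype.card X := Fintype.card_pos_iff.2 ⟨S.start⟩
  have hA' : (1 : ℝ) ≤ Fintype.card A := by exact_mod_cast hA
  have hX' : (1 : ℝ) ≤ Fintype.card X := by exact_mod_cast hX
  have hT : (2 : ℝ) ≤ T := by exact_mod_cast hp.two_le
  have hT0 : (0 : ℝ) < T := by linarith
  set κ := Real.log ((T : ℝ) * Fintype.card A * Fintype.card X / (p / (2 * T))) with hκ
  have hAX : (1 : ℝ) ≤ Fintype.card A * Fintype.card X := one_le_mul_of_one_le_of_one_le hA' hX'
  have harg : (T : ℝ) * Fintype.card A * Fintype.card X / (p / (2 * T)) =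
      2 * (T ^ 2 * (Fintype.card A * Fintype.card X)) / p := by
    field_simp
  have hκ1 : 1 / 2 ≤ κ := by
    have h1 : (2 : ℝ) ≤ (T : ℝ) * Fintype.card A * Fintype.card X / (p / (2 * T)) := by
      rw [harg, le_div_iff₀ hp0]
      nlinarith [mul_le_mul (show (1 : ℝ) ≤ T ^ 2 by nlinarith) hAX zero_le_one (by positivity)]
    have h2 := Real.log_le_log (by norm_num) h1
    have := Real.log_two_gt_d9
    linarith
  -- `2 exp (-κ)` is the base of the geometric bound.
  set β : ℝ := p / (T ^ 2 * (Fintype.card A * Fintype.card X)) with hβ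
  have hexp : 2 * Real.exp (-κ) = β := by
    rw [Real.exp_neg, hκ, Real.exp_log (by positivity), harg, hβ]
    field_simp
  have hβ0 : 0 < β := by positivity
  have hβ1 : β ≤ 1 := by
    rw [hβ, div_le_one (by positivity)]
    nlinarith [mul_le_mul (show (1 : ℝ) ≤ T ^ 2 by nlinarith) hAX zero_le_one (by positivity)]
  set Z := (S.pairs A).filter fun z => 2 ≤ S.size (S.layer z.1 + 1) with hZ
  have hsub : {ω | (∀ i < T, IsLegal S (u (i + 1) ω)) ∧
      ∃ t < T, P ∉ (counters (fun i => u i ω) t).confidenceSet S T (p / (2 * T))} ⊆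
      ⋃ t ∈ Finset.range T, ⋃ z ∈ Z, ⋃ n ∈ Finset.Icc 1 T,
        ⋃ D ∈ (S.states (S.layer z.1 + 1)).powerset,
        {ω | visits (fun i => u i ω) t z.1 z.2 = n ∧
          n * √(2 * (S.size (S.layer z.1 + 1) : ℝ) * κ / n) <
            ∑ i ∈ Finset.range t, signedDeviation P z.1 z.2 (signOf D) (u (i + 1) ω)} := by
    rintro ω ⟨hleg, t, ht, hnot⟩
    obtain ⟨⟨τ, hτ, hN, hM⟩, -⟩ := counters_spec (fun i => u i ω) t
    have h1 : ∃ x a, S.layer x < L ∧ (counters (fun i => u i ω) t).width S T (p / (2 * T)) x a <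
        ∑ x', |P x a x' - (counters (fun i => u i ω) t).empirical x a x'| := by
      by_contra hcon
      push Not at hcon
      exact hnot ⟨hp.isTransition, fun x a hx => hcon x a hx⟩
    obtain ⟨x, a, hx, hlt⟩ := h1
    simp only [Counters.width, Counters.empirical, hN, hM, ← hκ] at hlt
    obtain ⟨h2, h3, D, hD, h4⟩ := exists_sign_of_width_lt hp.isTransition
      (u := fun i => u i ω) (t := τ) (fun i hi => hleg i (by omega)) hx hκ1 hlt
    simp only [Set.mem_iUnion]
    refine ⟨τ, by simp; omega, (x, a), by simp [hZ, hx, h3],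
      visits (fun i => u i ω) τ x a, ?_, D, hD, rfl, h4⟩
    rw [Finset.mem_Icc]
    exact ⟨h2, (visits_le (S := S) (fun i hi => hleg i (by omega)) x a).trans (by omega)⟩
  refine (measureReal_mono hsub (measure_ne_top _ _)).trans ?_
  calc _ ≤ ∑ t ∈ Finset.range T, ∑ z ∈ Z, ∑ n ∈ Finset.Icc 1 T,
        ∑ D ∈ (S.states (S.layer z.1 + 1)).powerset,
          Real.exp (-(S.size (S.layer z.1 + 1) * κ)) := by
        refine (measureReal_biUnion_finset_le _ _).trans (Finset.sum_le_sum fun t ht => ?_)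
        refine (measureReal_biUnion_finset_le _ _).trans (Finset.sum_le_sum fun z hz => ?_)
        refine (measureReal_biUnion_finset_le _ _).trans (Finset.sum_le_sum fun n hn => ?_)
        refine (measureReal_biUnion_finset_le _ _).trans (Finset.sum_le_sum fun D _ => ?_)
        have hzL : S.layer z.1 < L := Layering.mem_pairs.1 (Finset.mem_filter.1 hz).1
        refine (hp.measureReal_deviation_le hzL z.2 (s := signOf D) (fun x => ?_)
          (Finset.mem_range.1 ht).le (Real.sqrt_nonneg _)).trans (le_of_eq ?_)
        · unfold signOf; split_ifs <;> norm_num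
        · have hn0 : (0 : ℝ) < n := by exact_mod_cast (Finset.mem_Icc.1 hn).1
          rw [Real.sq_sqrt (by positivity)]
          congr 2
          field_simp
    _ ≤ ∑ t ∈ Finset.range T, ∑ z ∈ Z, ∑ n ∈ Finset.Icc 1 T, β ^ 2 := by
        refine Finset.sum_le_sum fun t _ => Finset.sum_le_sum fun z hz =>
          Finset.sum_le_sum fun n _ => ?_
        rw [Finset.sum_const, Finset.card_powerset, nsmul_eq_mul]
        change ((2 ^ S.size (S.layer z.1 + 1) : ℕ) : ℝ) * _ ≤ _
        have h1 : Real.exp (-(S.size (S.layer z.1 + 1) * κ)) =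
            Real.exp (-κ) ^ S.size (S.layer z.1 + 1) := by
          rw [← Real.exp_nat_mul]; congr 1; ring
        rw [h1]
        push_cast
        rw [← mul_pow, hexp]
        exact pow_le_pow_of_le_one hβ0.le hβ1 (Finset.mem_filter.1 hz).2
    _ = T * (Z.card * (T * β ^ 2)) := by
        simp
    _ ≤ T * ((Fintype.card X * Fintype.card A) * (T * β ^ 2)) := by
        have : Z.card ≤ Fintype.card X * Fintype.card A := by
          rw [← Fintype.card_prod]; exact Finset.card_le_univ _
        have : (Z.card : ℝ) ≤ Fintype.card X * Fintype.card A := by exact_mod_cast this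
        gcongr
    _ = p ^ 2 / (T ^ 2 * (Fintype.card A * Fintype.card X)) := by
        rw [hβ]; field_simp
    _ ≤ p / 4 := by
        rw [div_le_div_iff₀ (by positivity) (by norm_num)]
        have h4 : (4 : ℝ) * 1 ≤ T ^ 2 * (Fintype.card A * Fintype.card X) :=
          mul_le_mul (by nlinarith) hAX zero_le_one (by positivity)
        nlinarith

lemma measurable_counters (hp : IsPlayer S P T δ μ ℱ u q) {t : ℕ} (ht : t ≤ T)
    (f : Counters X A → ℝ) : Measurable[ℱ t] fun ω => f (counters (fun i => u i ω) t) := by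
  induction t generalizing f with
  | zero => exact measurable_const (a := f Counters.initial)
  | succ t ih =>
    exact measurable_comp_discrete (m := ℱ (t + 1)) (hp.measurable_u t (by omega))
      (φ := fun ω v => f ((counters (fun i => u i ω) t).step v)) fun v =>
        (ih (by omega) fun c => f (c.step v)).mono (ℱ.mono (Nat.le_succ t)) le_rfl

/-- The bound `min 2 (2 ε)` for the distance of two transitions in the confidence set. -/
def _root_.CMG.Counters.diameter (c : Counters X A) (S : Layering X L) (T : ℕ) (δ : ℝ) (x : X)
    (a : A) : ℝ := min 2 (2 * c.width S T δ x a)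

lemma _root_.CMG.Counters.diameter_mem (c : Counters X A) (S : Layering X L) (T : ℕ) (δ : ℝ)
    (x : X) (a : A) : c.diameter S T δ x a ∈ Set.Icc (0 : ℝ) 2 :=
  ⟨le_min (by norm_num) (mul_nonneg (by norm_num) (Real.sqrt_nonneg _)), min_le_left _ _⟩

lemma _root_.CMG.Counters.sum_diameter_mem (c : Counters X A) (S : Layering X L) (T : ℕ) (δ : ℝ)
    (v : Traj X A L) :
    ∑ l : Fin L, c.diameter S T δ (v.1 l.castSucc) (v.2 l) ∈ Set.Icc (0 : ℝ) (2 * L) := by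
  constructor
  · exact Finset.sum_nonneg fun l _ => (c.diameter_mem S T δ _ _).1
  · calc _ ≤ ∑ _l : Fin L, (2 : ℝ) := Finset.sum_le_sum fun l _ => (c.diameter_mem S T δ _ _).2
      _ = 2 * L := by simp; ring

/-- With high probability the expected radii of the confidence sets along the trajectories do not
exceed the realized ones by much. -/
lemma measureReal_diameter_deviation_le (hp : IsPlayer S P T δ μ ℱ u q) [IsProbabilityMeasure μ]
    {ι : ℝ} (hι : 0 ≤ ι) :
    μ.real {ω | 2 * L * √(2 * T * ι) < ∑ i ∈ Finset.range T,
      (∑ z ∈ S.pairs A, marginal (occupancy S P (policy (q (i + 1) ω))) z.1 z.2 *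
          (counters (fun i => u i ω) i).diameter S T δ z.1 z.2 -
        ∑ l : Fin L, (counters (fun i => u i ω) i).diameter S T δ
          ((u (i + 1) ω).1 l.castSucc) ((u (i + 1) ω).2 l))} ≤ Real.exp (-ι) := by
  have hL : (0 : ℝ) < L := by exact_mod_cast hp.horizon_pos
  set G : ℕ → Ω → Traj X A L → ℝ := fun i ω v => ∑ l : Fin L,
    (counters (fun i => u i ω) i).diameter S T δ (v.1 l.castSucc) (v.2 l) with hG
  have hGm : ∀ i < T, ∀ v, Measurable[ℱ i] fun ω => G i ω v := fun i hi v =>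
    hp.measurable_counters hi.le fun c => ∑ l : Fin L, c.diameter S T δ (v.1 l.castSucc) (v.2 l)
  have hGb : ∀ i ω v, G i ω v ∈ Set.Icc (0 : ℝ) (2 * L) := fun i ω v =>
    Counters.sum_diameter_mem _ _ _ _ _
  set d : ℕ → Ω → ℝ := fun i ω => ∑ v, trajProb S P (policy (q (i + 1) ω)) v * G i ω v -
    G i ω (u (i + 1) ω) with hd
  have hsum : ∀ i < T, ∀ ω, ∑ v, trajProb S P (policy (q (i + 1) ω)) v * G i ω v ∈
      Set.Icc (0 : ℝ) (2 * L) := by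
    intro i hi ω
    have hc := hp.hasCondLaw hi
    constructor
    · exact Finset.sum_nonneg fun v _ => mul_nonneg (hc.nonneg ω v) (hGb i ω v).1
    · calc _ ≤ ∑ v, trajProb S P (policy (q (i + 1) ω)) v * (2 * L) :=
            Finset.sum_le_sum fun v _ => mul_le_mul_of_nonneg_left (hGb i ω v).2 (hc.nonneg ω v)
        _ = 2 * L := by rw [← Finset.sum_mul, hc.sum_eq_one ω, one_mul]
  have hsm : ∀ i < T, Measurable[ℱ i] fun ω =>
      ∑ v, trajProb S P (policy (q (i + 1) ω)) v * G i ω v := fun i hi =>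
    Finset.measurable_fun_sum _ fun v _ => ((hp.hasCondLaw hi).measurable v).mul (hGm i hi v)
  have hum : ∀ i < T, Measurable[ℱ (i + 1)] fun ω => G i ω (u (i + 1) ω) := fun i hi =>
    measurable_comp_discrete (m := ℱ (i + 1)) (hp.measurable_u i hi) fun v =>
      (hGm i hi v).mono (ℱ.mono (Nat.le_succ i)) le_rfl
  have h := azuma_hoeffding (μ := μ) (m := fun i => ℱ i) (fun i => ℱ.le i)
    (fun _ _ h => ℱ.mono h) (d := d) (T := T) (c := 2 * L) (by positivity)
    (fun i hi => ((hsm i hi).mono (ℱ.mono (Nat.le_succ i)) le_rfl).sub (hum i hi))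
    (fun i hi ω => by
      have h1 := hsum i hi ω
      have h2 := hGb i ω (u (i + 1) ω)
      rw [abs_le]
      constructor <;> linarith [h1.1, h1.2, h2.1, h2.2])
    (fun i hi w hw ⟨cw, hcw⟩ => by
      have hwm := hw.mono (ℱ.le i) le_rfl
      have h1 := (hp.hasCondLaw hi).integral_eq (φ := fun ω v => w ω * G i ω v)
        (fun v => hw.mul (hGm i hi v)) (c := cw * (2 * L)) (fun ω v => by
          rw [abs_mul, abs_of_nonneg (hGb i ω v).1]
          exact mul_le_mul (hcw ω) (hGb i ω v).2 (hGb i ω v).1 ((abs_nonneg _).trans (hcw ω)))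
      have h2 : ∀ ω, ∑ v, trajProb S P (policy (q (i + 1) ω)) v * (w ω * G i ω v) =
          w ω * ∑ v, trajProb S P (policy (q (i + 1) ω)) v * G i ω v := fun ω => by
        rw [Finset.mul_sum]
        exact Finset.sum_congr rfl fun v _ => by ring
      simp only [h2] at h1
      have e1 : Integrable (fun ω => w ω *
          ∑ v, trajProb S P (policy (q (i + 1) ω)) v * G i ω v) μ :=
        integrable_of_measurable_of_bound (hwm.mul ((hsm i hi).mono (ℱ.le i) le_rfl))
          (c := cw * (2 * L)) fun ω => by
            rw [abs_mul, abs_of_nonneg (hsum i hi ω).1]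
            exact mul_le_mul (hcw ω) (hsum i hi ω).2 (hsum i hi ω).1
              ((abs_nonneg _).trans (hcw ω))
      have e2 : Integrable (fun ω => w ω * G i ω (u (i + 1) ω)) μ :=
        integrable_of_measurable_of_bound (hwm.mul ((hum i hi).mono (ℱ.le _) le_rfl))
          (c := cw * (2 * L)) fun ω => by
            rw [abs_mul, abs_of_nonneg (hGb i ω _).1]
            exact mul_le_mul (hcw ω) (hGb i ω _).2 (hGb i ω _).1 ((abs_nonneg _).trans (hcw ω))
      simp only [hd, mul_sub]
      rw [integral_sub e1 e2, h1, sub_self])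
    (Nat.zero_le T) le_rfl hι
  refine le_of_eq_of_le ?_ h
  congr 1
  ext ω
  simp only [Set.mem_ofPred_eq, Nat.sub_zero, ← Finset.range_eq_Ico]
  rw [Finset.sum_congr rfl fun i hi => ?_]
  simp only [hd, hG]
  rw [sum_trajProb_mul_sum hp.isTransition (hp.isPolicy ω (Finset.mem_range.1 hi))
    ((counters (fun i => u i ω) i).diameter S T δ)]

/-- With high probability all trajectories are legal, the true transitions lie in the confidence
sets, and the executed occupancy measures are close to the iterates in total. -/
lemma exists_bad_event [IsProbabilityMeasure μ] {p : ℝ} (hp0 : 0 < p)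
    (hp1 : p < 1) (hp : IsPlayer S P T (p / (2 * T)) μ ℱ u q) {ι : ℝ} (hι : 0 ≤ ι) :
    ∃ bad : Set Ω, μ.real bad ≤ p / 4 + Real.exp (-ι) ∧ ∀ ω ∉ bad,
      (∀ i < T, IsLegal S (u (i + 1) ω)) ∧
      (∀ t < T, P ∈ (counters (fun i => u i ω) t).confidenceSet S T (p / (2 * T))) ∧
      ∑ i ∈ Finset.range T, l1Dist S (marginal (occupancy S P (policy (q (i + 1) ω))))
          (marginal (q (i + 1) ω)) ≤
        L * (12 * √(Real.log ((T : ℝ) * Fintype.card A * Fintype.card X / (p / (2 * T)))) *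
          (Fintype.card X * √(T * Fintype.card A)) + 2 * L * √(2 * T * ι)) := by
  refine ⟨{ω | ∃ i < T, ¬ IsLegal S (u (i + 1) ω)} ∪ ({ω | (∀ i < T, IsLegal S (u (i + 1) ω)) ∧
      ∃ t < T, P ∉ (counters (fun i => u i ω) t).confidenceSet S T (p / (2 * T))} ∪
      {ω | 2 * L * √(2 * T * ι) < ∑ i ∈ Finset.range T,
      (∑ z ∈ S.pairs A, marginal (occupancy S P (policy (q (i + 1) ω))) z.1 z.2 *
          (counters (fun i => u i ω) i).diameter S T (p / (2 * T)) z.1 z.2 -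
        ∑ l : Fin L, (counters (fun i => u i ω) i).diameter S T (p / (2 * T))
          ((u (i + 1) ω).1 l.castSucc) ((u (i + 1) ω).2 l))}), ?_, ?_⟩
  · refine (measureReal_union_le _ _).trans ?_
    rw [hp.measureReal_not_legal, zero_add]
    exact (measureReal_union_le _ _).trans (add_le_add
      (measureReal_not_mem_confidenceSet_le hp0 hp1 hp) (hp.measureReal_diameter_deviation_le hι))
  · intro ω hω
    simp only [Set.mem_union, Set.mem_ofPred_eq, not_or, not_exists, not_and, not_not, not_lt]
      at hω
    obtain ⟨hleg, hconf, hdev⟩ := hω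
    have hconf := hconf hleg
    refine ⟨hleg, hconf, ?_⟩
    have := hp.nonempty ω
    have hA : 1 ≤ Fintype.card A := Fintype.card_pos
    have hX : 1 ≤ Fintype.card X := Fintype.card_pos_iff.2 ⟨S.start⟩
    have hA' : (1 : ℝ) ≤ Fintype.card A := by exact_mod_cast hA
    have hX' : (1 : ℝ) ≤ Fintype.card X := by exact_mod_cast hX
    have hT : (2 : ℝ) ≤ T := by exact_mod_cast hp.two_le
    have hκ : 0 ≤ Real.log ((T : ℝ) * Fintype.card A * Fintype.card X / (p / (2 * T))) := by
      refine Real.log_nonneg ?_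
      have h1 : p / (2 * T) ≤ 1 := by rw [div_le_one (by positivity)]; linarith
      rw [one_le_div (by positivity)]
      refine h1.trans ?_
      exact one_le_mul_of_one_le_of_one_le (one_le_mul_of_one_le_of_one_le (by linarith) hA') hX'
    have hwidth := sum_width_le (S := S) (u := fun i => u i ω) hleg hκ
    have hdist : ∀ i ∈ Finset.range T, l1Dist S
        (marginal (occupancy S P (policy (q (i + 1) ω)))) (marginal (q (i + 1) ω)) ≤
        L * ∑ z ∈ S.pairs A, marginal (occupancy S P (policy (q (i + 1) ω))) z.1 z.2 *
          (counters (fun i => u i ω) i).diameter S T (p / (2 * T)) z.1 z.2 := by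
      intro i hi
      have hi := Finset.mem_range.1 hi
      obtain ⟨P', hP', hq⟩ := hp.mem ω i hi
      refine (l1Dist_occupancy_le hp.isTransition hP'.1 hq).trans
        (mul_le_mul_of_nonneg_left (Finset.sum_le_sum fun z hz => mul_le_mul_of_nonneg_left ?_
          (marginal_occupancy_nonneg hp.isTransition (hp.isPolicy ω hi) _ _)) (Nat.cast_nonneg _))
      have hz := Layering.mem_pairs.1 hz
      refine le_min ?_ ?_
      · calc ∑ x', |P z.1 z.2 x' - P' z.1 z.2 x'|
            ≤ ∑ x', (P z.1 z.2 x' + P' z.1 z.2 x') := Finset.sum_le_sum fun x' _ => by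
              have := hp.isTransition.nonneg z.1 z.2 x'
              have := hP'.1.nonneg z.1 z.2 x'
              rw [abs_le]
              constructor <;> linarith
          _ = 2 := by
              rw [Finset.sum_add_distrib, hp.isTransition.sum_eq_one _ _ hz,
                hP'.1.sum_eq_one _ _ hz]
              norm_num
      · have h1 := (hconf i hi).2 z.1 z.2 hz
        have h2 := hP'.2 z.1 z.2 hz
        calc ∑ x', |P z.1 z.2 x' - P' z.1 z.2 x'|
            ≤ ∑ x', (|P z.1 z.2 x' - (counters (fun i => u i ω) i).empirical z.1 z.2 x'| +
              |P' z.1 z.2 x' - (counters (fun i => u i ω) i).empirical z.1 z.2 x'|) :=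
              Finset.sum_le_sum fun x' _ => by
                rw [abs_sub_comm (P' z.1 z.2 x')]
                exact abs_sub_le _ _ _
          _ ≤ _ := by rw [Finset.sum_add_distrib]; linarith
    refine (Finset.sum_le_sum hdist).trans ?_
    rw [← Finset.mul_sum]
    refine mul_le_mul_of_nonneg_left ?_ (Nat.cast_nonneg _)
    rw [Finset.sum_sub_distrib] at hdev
    have h3 : ∑ i ∈ Finset.range T, ∑ l : Fin L,
        (counters (fun i => u i ω) i).diameter S T (p / (2 * T))
          ((u (i + 1) ω).1 l.castSucc) ((u (i + 1) ω).2 l) ≤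
        2 * ∑ i ∈ Finset.range T, ∑ l : Fin L,
        (counters (fun i => u i ω) i).width S T (p / (2 * T))
          ((u (i + 1) ω).1 l.castSucc) ((u (i + 1) ω).2 l) := by
      simp only [Finset.mul_sum]
      exact Finset.sum_le_sum fun i _ => Finset.sum_le_sum fun l _ => min_le_right _ _
    linarith

end IsPlayer

end PlayerEvents

/-! ### The fluctuations of the utilities -/

section Measurability

variable {Ω X A : Type*} [Fintype X] [Fintype A] {L : ℕ} {S : Layering X L}

lemma measurable_utility {m : MeasurableSpace Ω} {q : Ω → X → A → X → ℝ} {f : Ω → X → A → ℝ}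
    (hq : Measurable q) (hf : Measurable f) : Measurable fun ω => utility S (q ω) (f ω) := by
  simp only [utility_eq]
  exact Finset.measurable_fun_sum _ fun z _ => (measurable_marginal hq _ _).mul
    ((measurable_pi_apply z.2).comp ((measurable_pi_apply z.1).comp hf))

lemma measurable_klDiv_mixing {m : MeasurableSpace Ω} {q : Ω → X → A → X → ℝ} (hq : Measurable q)
    (c : X → A → X → ℝ) (θ : ℝ) :
    Measurable fun ω => klDiv S (marginal c) (mixing S θ (q ω)) := by
  have h : ∀ x a, Measurable fun ω => mixing S θ (q ω) x a := fun x a =>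
    ((measurable_marginal hq x a).const_mul _).add_const _
  simp only [klDiv_eq]
  exact Finset.measurable_fun_sum _ fun z _ =>
    ((Real.measurable_log.comp ((h _ _).const_div _)).const_mul _).sub ((h _ _).const_sub _)

lemma integral_utility {mΩ : MeasurableSpace Ω} {μ : Measure Ω} (q : X → A → X → ℝ)
    {f : Ω → X → A → ℝ} (hf : ∀ x a, Integrable (fun ω => f ω x a) μ) :
    ∫ ω, utility S q (f ω) ∂μ = utility S q fun x a => ∫ ω, f ω x a ∂μ := by
  simp only [utility_eq]
  rw [integral_finsetSum _ fun z _ => (hf _ _).const_mul _]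
  simp only [integral_const_mul]

/-- The law of one of two variables that are conditionally independent. -/
lemma measureReal_inter_eq_of_joint {mΩ : MeasurableSpace Ω} {μ : Measure Ω}
    [IsProbabilityMeasure μ] {V W : Type*} [Fintype V] [Fintype W] {u : Ω → V} {w : Ω → W}
    (hu : ∀ v, MeasurableSet {ω | u ω = v}) (hw : ∀ v, MeasurableSet {ω | w ω = v})
    {κ : Ω → V → ℝ} {κ' : Ω → W → ℝ} (hκ : ∀ v, Measurable fun ω => κ ω v)
    (hκ' : ∀ v, Measurable fun ω => κ' ω v) (hκ0 : ∀ ω v, 0 ≤ κ ω v) (hκ'0 : ∀ ω v, 0 ≤ κ' ω v)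
    (hκ1 : ∀ ω, ∑ v, κ ω v = 1) (hκ'1 : ∀ ω, ∑ v, κ' ω v = 1) {E : Set Ω} (hE : MeasurableSet E)
    (h : ∀ v v', μ.real (E ∩ {ω | u ω = v ∧ w ω = v'}) = ∫ ω in E, κ ω v * κ' ω v' ∂μ) (v : V) :
    μ.real (E ∩ {ω | u ω = v}) = ∫ ω in E, κ ω v ∂μ := by
  classical
  have h1 : E ∩ {ω | u ω = v} = ⋃ v' ∈ Finset.univ, E ∩ {ω | u ω = v ∧ w ω = v'} := by
    ext ω
    simp
  have h2 : ∀ ω v, κ ω v ≤ 1 := fun ω v => (hκ1 ω).symm ▸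
    Finset.single_le_sum (f := κ ω) (fun v _ => hκ0 ω v) (Finset.mem_univ v)
  have h3 : ∀ ω v, κ' ω v ≤ 1 := fun ω v => (hκ'1 ω).symm ▸
    Finset.single_le_sum (f := κ' ω) (fun v _ => hκ'0 ω v) (Finset.mem_univ v)
  rw [h1, measureReal_biUnion_finset]
  · rw [Finset.sum_congr rfl fun v' _ => h v v', ← integral_finsetSum]
    · simp only [← Finset.mul_sum, hκ'1, mul_one]
    · intro v' _
      refine (integrable_of_measurable_of_bound ((hκ v).mul (hκ' v')) (c := 1)
        fun ω => ?_).integrableOn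
      change |κ ω v * κ' ω v'| ≤ 1
      rw [abs_of_nonneg (mul_nonneg (hκ0 ω v) (hκ'0 ω v'))]
      exact mul_le_one₀ (h2 ω v) (hκ'0 ω v') (h3 ω v')
  · intro a _ b _ hab
    refine Set.disjoint_left.2 fun ω ha hb => hab ?_
    rw [← ha.2.2, ← hb.2.2]
  · exact fun v' _ => hE.inter ((hu v).inter (hw v'))

end Measurability

section Interaction

variable {X A Y B Ω : Type*} [Fintype X] [Fintype A] [Fintype Y] [Fintype B]
  {mΩ : MeasurableSpace Ω} {μ : Measure Ω} {ℱ : Filtration ℕ mΩ} {L : ℕ} {G : Game X A Y B L}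
  {T : ℕ} {V η θ δ : ℝ} {g : ℕ → Ω → X → A → ℝ} {h : ℕ → Ω → Y → B → ℝ}
  {u₁ : ℕ → Ω → Traj X A L} {u₂ : ℕ → Ω → Traj Y B L}
  {q₁ : ℕ → Ω → X → A → X → ℝ} {q₂ : ℕ → Ω → Y → B → Y → ℝ} {lam : ℕ → Ω → ℝ}
  {c₁ : X → A → X → ℝ} {c₂ : Y → B → Y → ℝ}

namespace IsInteraction

lemma mean_g_mem (hI : IsInteraction G T V η θ δ μ ℱ g h u₁ u₂ q₁ q₂ lam)
    [IsProbabilityMeasure μ] (hT : 0 < T) (x : X) (a : A) : G.g x a ∈ Set.Icc (0 : ℝ) 1 := by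
  rw [← hI.mean_g 0 hT x a]
  refine ⟨integral_nonneg fun ω => (hI.g_mem _ ω x a).1, ?_⟩
  have := integral_mono_of_nonneg (μ := μ) (Filter.Eventually.of_forall fun ω =>
    (hI.g_mem (0 + 1) ω x a).1) (integrable_const 1) (Filter.Eventually.of_forall fun ω =>
    (hI.g_mem (0 + 1) ω x a).2)
  simpa using this

lemma mean_h_mem (hI : IsInteraction G T V η θ δ μ ℱ g h u₁ u₂ q₁ q₂ lam)
    [IsProbabilityMeasure μ] (hT : 0 < T) (y : Y) (b : B) : G.h y b ∈ Set.Icc (0 : ℝ) 1 := by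
  rw [← hI.mean_h 0 hT y b]
  refine ⟨integral_nonneg fun ω => (hI.h_mem _ ω y b).1, ?_⟩
  have := integral_mono_of_nonneg (μ := μ) (Filter.Eventually.of_forall fun ω =>
    (hI.h_mem (0 + 1) ω y b).1) (integrable_const 1) (Filter.Eventually.of_forall fun ω =>
    (hI.h_mem (0 + 1) ω y b).2)
  simpa using this

lemma measurable_zeroAtZero_g (hI : IsInteraction G T V η θ δ μ ℱ g h u₁ u₂ q₁ q₂ lam) {t : ℕ}
    (ht : t ≤ T) : Measurable[ℱ t] fun ω => zeroAtZero (fun i => g i ω) t := by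
  cases t with
  | zero => exact measurable_const (a := (0 : X → A → ℝ))
  | succ t => exact hI.measurable_g t ht

lemma measurable_zeroAtZero_h (hI : IsInteraction G T V η θ δ μ ℱ g h u₁ u₂ q₁ q₂ lam) {t : ℕ}
    (ht : t ≤ T) : Measurable[ℱ t] fun ω => zeroAtZero (fun i => h i ω) t := by
  cases t with
  | zero => exact measurable_const (a := (0 : Y → B → ℝ))
  | succ t => exact hI.measurable_h t ht

/-- The iterates of episode `t` are known before it. -/
lemma measurable_q₁_pred (hI : IsInteraction G T V η θ δ μ ℱ g h u₁ u₂ q₁ q₂ lam) {t : ℕ}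
    (ht : t ≤ T) : Measurable[ℱ (t - 1)] (q₁ t) := by
  cases t with
  | zero =>
    rw [show q₁ 0 = fun _ => uniformOccupancy G.S₁ from funext fun ω => (hI.algorithm ω).init₁]
    exact measurable_const
  | succ t => exact hI.measurable_q₁ t ht

lemma measurable_q₂_pred (hI : IsInteraction G T V η θ δ μ ℱ g h u₁ u₂ q₁ q₂ lam) {t : ℕ}
    (ht : t ≤ T) : Measurable[ℱ (t - 1)] (q₂ t) := by
  cases t with
  | zero =>
    rw [show q₂ 0 = fun _ => uniformOccupancy G.S₂ from funext fun ω => (hI.algorithm ω).init₂]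
    exact measurable_const
  | succ t => exact hI.measurable_q₂ t ht

lemma measurable_lam_pred (hI : IsInteraction G T V η θ δ μ ℱ g h u₁ u₂ q₁ q₂ lam) {t : ℕ}
    (ht : t ≤ T) : Measurable[ℱ (t - 1)] (lam t) := by
  induction t with
  | zero =>
    rw [show lam 0 = fun _ => 0 from funext fun ω => (hI.algorithm ω).init_dual]
    exact measurable_const
  | succ t ih =>
    rw [show lam (t + 1) = fun ω => max (lam t ω +
      (utility G.S₁ (q₁ (t + 1) ω) (zeroAtZero (fun i => g i ω) t) +
        utility G.S₂ (q₂ (t + 1) ω) (zeroAtZero (fun i => h i ω) t) - G.budget)) 0 from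
      funext fun ω => (hI.algorithm ω).dual t ht]
    refine Measurable.max (Measurable.add ?_ (Measurable.sub_const (Measurable.add ?_ ?_) _))
      measurable_const
    · exact (ih (by omega)).mono (ℱ.mono (by omega)) le_rfl
    · exact measurable_utility (hI.measurable_q₁ t ht) (hI.measurable_zeroAtZero_g (by omega))
    · exact measurable_utility (hI.measurable_q₂ t ht) (hI.measurable_zeroAtZero_h (by omega))

/-- The utilities of fixed comparators fluctuate around their means independently of the past. -/
lemma integral_mul_utility_sub_eq_zero
    (hI : IsInteraction G T V η θ δ μ ℱ g h u₁ u₂ q₁ q₂ lam) [IsProbabilityMeasure μ] {t : ℕ}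
    (ht : t < T) {w : Ω → ℝ} (hw : Measurable[ℱ t] w) :
    ∫ ω, w ω * (utility G.S₁ c₁ (g (t + 1) ω) + utility G.S₂ c₂ (h (t + 1) ω) -
      (utility G.S₁ c₁ G.g + utility G.S₂ c₂ G.h)) ∂μ = 0 := by
  have hgi : ∀ x a, Integrable (fun ω => g (t + 1) ω x a) μ := fun x a =>
    integrable_of_measurable_of_bound (c := 1) ((measurable_pi_apply a).comp
      ((measurable_pi_apply x).comp ((hI.measurable_g t ht).mono (ℱ.le _) le_rfl))) fun ω => by
        have := hI.g_mem (t + 1) ω x a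
        rw [abs_of_nonneg this.1]; exact this.2
  have hhi : ∀ y b, Integrable (fun ω => h (t + 1) ω y b) μ := fun y b =>
    integrable_of_measurable_of_bound (c := 1) ((measurable_pi_apply b).comp
      ((measurable_pi_apply y).comp ((hI.measurable_h t ht).mono (ℱ.le _) le_rfl))) fun ω => by
        have := hI.h_mem (t + 1) ω y b
        rw [abs_of_nonneg this.1]; exact this.2
  have hU₁ : Integrable (fun ω => utility G.S₁ c₁ (g (t + 1) ω)) μ := by
    simp only [utility_eq]
    exact integrable_finsetSum _ fun z _ => (hgi _ _).const_mul _
  have hU₂ : Integrable (fun ω => utility G.S₂ c₂ (h (t + 1) ω)) μ := by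
    simp only [utility_eq]
    exact integrable_finsetSum _ fun z _ => (hhi _ _).const_mul _
  set F : (X → A → ℝ) × (Y → B → ℝ) → ℝ := fun z => utility G.S₁ c₁ z.1 +
    utility G.S₂ c₂ z.2 - (utility G.S₁ c₁ G.g + utility G.S₂ c₂ G.h) with hF
  have hFm : Measurable F := ((measurable_utility measurable_const measurable_fst).add
    (measurable_utility measurable_const measurable_snd)).sub_const _
  have hind : IndepFun w (fun ω => F (g (t + 1) ω, h (t + 1) ω)) μ := by
    rw [IndepFun_iff_Indep]
    refine (indep_of_indep_of_le_left (indep_of_indep_of_le_right (hI.indep t ht)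
      (measurable_iff_comap_le.1 hw)) ?_).symm
    exact (hFm.comp (comap_measurable fun ω => (g (t + 1) ω, h (t + 1) ω))).comap_le
  have h0 : ∫ ω, F (g (t + 1) ω, h (t + 1) ω) ∂μ = 0 := by
    have hU : Integrable (fun ω => utility G.S₁ c₁ (g (t + 1) ω) +
        utility G.S₂ c₂ (h (t + 1) ω)) μ := hU₁.add hU₂
    simp only [hF]
    rw [integral_sub hU (integrable_const _), integral_add hU₁ hU₂,
      integral_utility _ hgi, integral_utility _ hhi]
    simp only [hI.mean_g t ht, hI.mean_h t ht]
    simp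
  have := hind.integral_fun_mul_eq_mul_integral
    (hw.mono (ℱ.le t) le_rfl).aestronglyMeasurable
    ((hU₁.add hU₂).sub (integrable_const _)).aestronglyMeasurable
  rw [h0, mul_zero] at this
  exact this

/-- The concentration of the utilities of fixed comparators, summed with predictable weights. -/
lemma measureReal_weighted_utility_le
    (hI : IsInteraction G T V η θ δ μ ℱ g h u₁ u₂ q₁ q₂ lam) [IsProbabilityMeasure μ]
    (hL : 0 < L) (hc₁ : IsLayered G.S₁ (marginal c₁)) (hc₂ : IsLayered G.S₂ (marginal c₂))
    {w : ℕ → Ω → ℝ} (hw : ∀ t < T, Measurable[ℱ (t - 1)] (w t)) (hw0 : ∀ ω, w 0 ω = 0) {c : ℝ}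
    (hc : 0 < c) (hwc : ∀ t < T, ∀ ω, |w t ω| ≤ c) {s t : ℕ} (hst : s ≤ t) (ht : t ≤ T) {ι : ℝ}
    (hι : 0 ≤ ι) :
    μ.real {ω | c * (2 * L) * √(2 * (t - s : ℕ) * ι) < ∑ i ∈ Finset.Ico s t, w i ω *
      (utility G.S₁ c₁ (zeroAtZero (fun i => g i ω) i) +
        utility G.S₂ c₂ (zeroAtZero (fun i => h i ω) i) -
        (utility G.S₁ c₁ G.g + utility G.S₂ c₂ G.h))} ≤ Real.exp (-ι) := by
  have hL' : (0 : ℝ) < L := by exact_mod_cast hL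
  refine azuma_hoeffding (m := fun i => ℱ (i - 1)) (T := T)
    (d := fun i ω => w i ω * (utility G.S₁ c₁ (zeroAtZero (fun i => g i ω) i) +
        utility G.S₂ c₂ (zeroAtZero (fun i => h i ω) i) -
        (utility G.S₁ c₁ G.g + utility G.S₂ c₂ G.h))) (fun i => ℱ.le _)
    (fun i j hij => ℱ.mono (Nat.sub_le_sub_right hij 1)) (by positivity) ?_ ?_ ?_ hst ht hι
  · intro i hi
    exact ((hw i hi).mono (ℱ.mono (by omega)) le_rfl).mul
      (((measurable_utility measurable_const (hI.measurable_zeroAtZero_g hi.le)).add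
        (measurable_utility measurable_const (hI.measurable_zeroAtZero_h hi.le))).sub_const _)
  · intro i hi ω
    rw [abs_mul]
    refine mul_le_mul (hwc i hi ω) ?_ (abs_nonneg _) hc.le
    have a1 := zeroAtZero_mem_unit (fun t x a => hI.g_mem t ω x a) i
    have a2 := zeroAtZero_mem_unit (fun t x a => hI.h_mem t ω x a) i
    have a3 := hI.mean_g_mem (by omega)
    have a4 := hI.mean_h_mem (by omega)
    have b1 := utility_nonneg hc₁ fun x a _ => (a1 x a).1
    have b2 := utility_nonneg hc₂ fun x a _ => (a2 x a).1
    have b3 := utility_nonneg hc₁ fun x a _ => (a3 x a).1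
    have b4 := utility_nonneg hc₂ fun x a _ => (a4 x a).1
    have d1 := utility_le hc₁ fun x a _ => (a1 x a).2
    have d2 := utility_le hc₂ fun x a _ => (a2 x a).2
    have d3 := utility_le hc₁ fun x a _ => (a3 x a).2
    have d4 := utility_le hc₂ fun x a _ => (a4 x a).2
    rw [abs_le]
    constructor <;> linarith
  · intro i hi v hv hvb
    cases i with
    | zero => simp [hw0]
    | succ i =>
      simp only [← mul_assoc]
      exact hI.integral_mul_utility_sub_eq_zero (by omega)
        (w := fun ω => v ω * w (i + 1) ω) (hv.mul (hw (i + 1) hi))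

end IsInteraction

end Interaction

/-! ### Regret and violation in terms of the iterates -/

section Performance

variable {X A : Type*} [Fintype X] [Fintype A] {L : ℕ} {S : Layering X L}

/-- There is a state in each of the nonterminal layers. -/
lemma IsLayered.horizon_le_card {p : X → A → ℝ} (hp : IsLayered S p) : L ≤ Fintype.card X := by
  classical
  have h : Finset.range L ⊆ Finset.univ.image S.layer := fun l hl => by
    have h1 := hp.card_pos (Finset.mem_range.1 hl)
    have h2 : 0 < S.size l := Nat.pos_of_ne_zero fun h0 => by simp [h0] at h1
    obtain ⟨x, hx⟩ := Finset.card_pos.1 h2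
    exact Finset.mem_image.2 ⟨x, Finset.mem_univ _, (Finset.mem_filter.1 hx).2⟩
  simpa using (Finset.card_le_card h).trans Finset.card_image_le

lemma IsLayered.card_actions_pos {p : X → A → ℝ} (hp : IsLayered S p) (hL : 0 < L) :
    0 < Fintype.card A :=
  Nat.pos_of_ne_zero fun h0 => by simpa [h0] using hp.card_pos hL

lemma Layering.two_le_card {X : Type*} [Fintype X] {L : ℕ} (S : Layering X L) (hL : 0 < L) :
    2 ≤ Fintype.card X :=
  Fintype.one_lt_card_iff.2 ⟨S.start, S.terminal, fun h => by
    have h1 := (S.layer_eq_zero_iff _).2 rfl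
    have h2 := (S.layer_eq_last_iff _).2 rfl
    rw [h, h2] at h1
    omega⟩

lemma sum_Icc_one_eq_sum_range (f : ℕ → ℝ) (T : ℕ) :
    ∑ t ∈ Finset.Icc 1 T, f t = ∑ i ∈ Finset.range T, f (i + 1) := by
  rw [Finset.range_eq_Ico, Finset.sum_Ico_add' f 0 T 1, zero_add, Finset.Ico_add_one_right_eq_Icc]

variable {Y B : Type*} [Fintype Y] [Fintype B] (G : Game X A Y B L) {T : ℕ}
  {q₁ : ℕ → X → A → X → ℝ} {q₂ : ℕ → Y → B → Y → ℝ} {N D₁ D₂ : ℝ}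

/-- The regret of the iterates and their distance from the executed occupancy measures control the
regret. -/
lemma Game.regret_le {s₁ : X → A → X → ℝ} {s₂ : Y → B → Y → ℝ}
    (hs₁ : IsLayered G.S₁ (marginal s₁)) (hs₂ : IsLayered G.S₂ (marginal s₂))
    (hN : ∑ t ∈ Finset.Icc 1 T, (reward G.S₁ G.S₂ (q₁ t) s₂ (G.r t) -
      reward G.S₁ G.S₂ s₁ (q₂ t) (G.r t)) ≤ N)
    (hD₁ : ∑ i ∈ Finset.range T, l1Dist G.S₁
      (marginal (occupancy G.S₁ G.P₁ (policy (q₁ (i + 1))))) (marginal (q₁ (i + 1))) ≤ D₁)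
    (hD₂ : ∑ i ∈ Finset.range T, l1Dist G.S₂
      (marginal (occupancy G.S₂ G.P₂ (policy (q₂ (i + 1))))) (marginal (q₂ (i + 1))) ≤ D₂) :
    G.regret T s₁ s₂ (fun t => policy (q₁ t)) (fun t => policy (q₂ t)) ≤ N + D₁ + D₂ := by
  refine le_trans ?_ (add_le_add (add_le_add hN hD₁) hD₂)
  rw [Game.regret, sum_Icc_one_eq_sum_range, sum_Icc_one_eq_sum_range, ← Finset.sum_add_distrib,
    ← Finset.sum_add_distrib]
  refine Finset.sum_le_sum fun i _ => ?_
  have h1 := utility_sub_le (S := G.S₁) (W := 1)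
    (q := occupancy G.S₁ G.P₁ (policy (q₁ (i + 1)))) (q' := q₁ (i + 1))
    (f := rewardAgainst₂ G.S₁ G.S₂ s₂ (G.r (i + 1))) fun x a hx => by
      have := rewardAgainst₂_mem hs₂ (G.r_mem (i + 1)) hx a
      rw [abs_of_nonneg this.1]; exact this.2
  have h2 := utility_sub_le (S := G.S₂) (W := 1) (q := q₂ (i + 1))
    (q' := occupancy G.S₂ G.P₂ (policy (q₂ (i + 1))))
    (f := rewardAgainst₁ G.S₁ G.S₂ s₁ (G.r (i + 1))) fun y b hy => by
      have := rewardAgainst₁_mem hs₁ (G.r_mem (i + 1)) hy b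
      rw [abs_of_nonneg this.1]; exact this.2
  rw [← reward_eq_utility₁, ← reward_eq_utility₁, one_mul] at h1
  rw [← reward_eq_utility₂, ← reward_eq_utility₂, one_mul, l1Dist_comm] at h2
  linarith

lemma Game.violation_le {g : ℕ → X → A → ℝ} {h : ℕ → Y → B → ℝ}
    (hg : ∀ t x a, g t x a ∈ Set.Icc (0 : ℝ) 1) (hh : ∀ t y b, h t y b ∈ Set.Icc (0 : ℝ) 1)
    (hN0 : 0 ≤ N + D₁ + D₂)
    (hN : ∑ t ∈ Finset.Icc 1 T, (utility G.S₁ (q₁ t) (g t) + utility G.S₂ (q₂ t) (h t) -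
      G.budget) ≤ N)
    (hD₁ : ∑ i ∈ Finset.range T, l1Dist G.S₁
      (marginal (occupancy G.S₁ G.P₁ (policy (q₁ (i + 1))))) (marginal (q₁ (i + 1))) ≤ D₁)
    (hD₂ : ∑ i ∈ Finset.range T, l1Dist G.S₂
      (marginal (occupancy G.S₂ G.P₂ (policy (q₂ (i + 1))))) (marginal (q₂ (i + 1))) ≤ D₂) :
    G.violation T g h (fun t => policy (q₁ t)) (fun t => policy (q₂ t)) ≤ N + D₁ + D₂ := by
  refine max_le (le_trans ?_ (add_le_add (add_le_add hN hD₁) hD₂)) hN0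
  rw [sum_Icc_one_eq_sum_range, sum_Icc_one_eq_sum_range, ← Finset.sum_add_distrib,
    ← Finset.sum_add_distrib]
  refine Finset.sum_le_sum fun i _ => ?_
  have h1 := utility_sub_le (S := G.S₁) (W := 1)
    (q := occupancy G.S₁ G.P₁ (policy (q₁ (i + 1)))) (q' := q₁ (i + 1))
    (f := g (i + 1)) fun x a _ => by
      have := hg (i + 1) x a
      rw [abs_of_nonneg this.1]; exact this.2
  have h2 := utility_sub_le (S := G.S₂) (W := 1)
    (q := occupancy G.S₂ G.P₂ (policy (q₂ (i + 1)))) (q' := q₂ (i + 1))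
    (f := h (i + 1)) fun y b _ => by
      have := hh (i + 1) y b
      rw [abs_of_nonneg this.1]; exact this.2
  linarith

end Performance

/-! ### Logarithmic factors -/

section Logarithms

variable {T : ℕ} {p : ℝ}

lemma log_le_log_div (hT : 2 ≤ T) (hp0 : 0 < p) (hp1 : p < 1) :
    Real.log T ≤ Real.log (T / p) := by
  have hT' : (2 : ℝ) ≤ T := by exact_mod_cast hT
  rw [Real.log_div (by positivity) hp0.ne']
  linarith [Real.log_neg hp0 hp1]

lemma log_union_nonneg (hT : 2 ≤ T) (hp0 : 0 < p) (hp1 : p < 1) :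
    0 ≤ Real.log (16 * T ^ 2 / p) := by
  have hT' : (2 : ℝ) ≤ T := by exact_mod_cast hT
  refine Real.log_nonneg ?_
  rw [le_div_iff₀ hp0]
  nlinarith

lemma log_union_le (hT : 2 ≤ T) (hp0 : 0 < p) (hp1 : p < 1) :
    Real.log (16 * T ^ 2 / p) ≤ 6 * Real.log (T / p) := by
  have hT' : (2 : ℝ) ≤ T := by exact_mod_cast hT
  have h2 := Real.log_le_log (by norm_num) hT'
  have h16 : Real.log 16 = 4 * Real.log 2 := by
    rw [show (16 : ℝ) = 2 ^ 4 by norm_num, Real.log_pow]; norm_num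
  rw [Real.log_div (by positivity) hp0.ne', Real.log_div (by positivity) hp0.ne',
    Real.log_mul (by norm_num) (by positivity), Real.log_pow, h16]
  push_cast
  linarith [Real.log_neg hp0 hp1]

lemma exp_neg_log_union (hT : 2 ≤ T) (hp0 : 0 < p) :
    Real.exp (-Real.log (16 * T ^ 2 / p)) = p / (16 * T ^ 2) := by
  have hT' : (2 : ℝ) ≤ T := by exact_mod_cast hT
  rw [Real.exp_neg, Real.exp_log (by positivity), inv_div]

lemma log_width_le {n m : ℕ} (hn : 0 < n) (hm : 0 < m) (h : m * n ≤ T) (hT : 2 ≤ T) (hp0 : 0 < p)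
    (hp1 : p < 1) : Real.log (T * n * m / (p / (2 * T))) ≤ 4 * Real.log (T / p) := by
  have hT' : (2 : ℝ) ≤ T := by exact_mod_cast hT
  have hn' : (0 : ℝ) < n := by exact_mod_cast hn
  have hm' : (0 : ℝ) < m := by exact_mod_cast hm
  have h' : (m : ℝ) * n ≤ T := by exact_mod_cast h
  have h2 := Real.log_le_log (by norm_num) hT'
  have h3 := Real.log_le_log (by positivity) h'
  have h4 : (T : ℝ) * n * m / (p / (2 * T)) = 2 * T ^ 2 * (m * n) / p := by field_simp
  rw [h4, Real.log_div (by positivity) hp0.ne', Real.log_div (by positivity) hp0.ne',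
    Real.log_mul (by positivity) (by positivity), Real.log_mul (by norm_num) (by positivity),
    Real.log_pow]
  push_cast
  linarith [Real.log_neg hp0 hp1]

/-- The distance of the iterates from the executed occupancy measures is of order
`|X| L √(T |A|)`, as `L ≤ |X|`. -/
lemma distance_bound_le {L n m : ℕ} {ι ι₀ κ : ℝ} (hL : L ≤ m) (hn : 0 < n) (hι : 0 ≤ ι)
    (hκ : κ ≤ 4 * ι) (hι₀ : ι₀ ≤ 6 * ι) :
    (L : ℝ) * (12 * √κ * (m * √(T * n)) + 2 * L * √(2 * T * ι₀)) ≤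
      31 * √ι * (m * L * √(T * n)) := by
  have hn' : (1 : ℝ) ≤ n := by exact_mod_cast hn
  have hL' : (L : ℝ) ≤ m := by exact_mod_cast hL
  have h1 : √κ ≤ 2 * √ι := by
    rw [show (2 : ℝ) * √ι = √(2 ^ 2 * ι) by rw [Real.sqrt_mul (by positivity)]; norm_num]
    exact Real.sqrt_le_sqrt (by linarith)
  have h2 : √(2 * T * ι₀) ≤ 3.5 * √ι * √(T * n) := by
    have e : √(3.5 ^ 2 * ι) = 3.5 * √ι := by
      rw [Real.sqrt_mul (by norm_num), Real.sqrt_sq (by norm_num)]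
    rw [← e, ← Real.sqrt_mul (by positivity)]
    refine Real.sqrt_le_sqrt ?_
    have h3 : (T : ℝ) * ι ≤ T * ι * n := le_mul_of_one_le_right (by positivity) hn'
    have h4 : (T : ℝ) * ι₀ ≤ T * (6 * ι) := mul_le_mul_of_nonneg_left hι₀ (by positivity)
    nlinarith [show (0 : ℝ) ≤ T * ι by positivity]
  calc (L : ℝ) * (12 * √κ * (m * √(T * n)) + 2 * L * √(2 * T * ι₀))
      ≤ L * (12 * (2 * √ι) * (m * √(T * n)) + 2 * m * (3.5 * √ι * √(T * n))) := by gcongr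
    _ = 31 * √ι * (m * L * √(T * n)) := by ring

end Logarithms

/-! ### The performance of the algorithm -/

section Events

/-- The Lyapunov function dominates the dual variable. -/
lemma IsRun.abs_div_dualPotential_le_one {X A Y B : Type*} [Fintype X] [Fintype A] [Fintype Y]
    [Fintype B] {L : ℕ} {S₁ : Layering X L} {S₂ : Layering Y L} {b : ℝ} {T : ℕ} {δ : ℝ}
    {r : ℕ → X → Y → A → B → ℝ} {g : ℕ → X → A → ℝ} {h : ℕ → Y → B → ℝ}
    {u₁ : ℕ → Traj X A L} {u₂ : ℕ → Traj Y B L} {q₁ : ℕ → X → A → X → ℝ}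
    {q₂ : ℕ → Y → B → Y → ℝ} {lam : ℕ → ℝ} (run : IsRun S₁ S₂ b T δ r g h u₁ u₂ q₁ q₂ lam)
    {c₁ : X → A → X → ℝ} {c₂ : Y → B → Y → ℝ} (hc₁ : IsLayered S₁ (marginal c₁))
    (hc₂ : IsLayered S₂ (marginal c₂)) {t : ℕ} (ht : t ≤ T) :
    |lam t / dualPotential S₁ S₂ T c₁ c₂ (q₁ t) (q₂ t) (lam t)| ≤ 1 := by
  have h0 := run.lam_nonneg ht
  have h1 : 0 ≤ dualPotential S₁ S₂ T c₁ c₂ (q₁ t) (q₂ t) (lam t) := Real.sqrt_nonneg _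
  rw [abs_of_nonneg (div_nonneg h0 h1)]
  refine div_le_one_of_le₀ (Real.le_sqrt_of_sq_le ?_) h1
  have h2 := run.klDiv_nonneg₁ hc₁ ht
  have h3 := run.klDiv_nonneg₂ hc₂ ht
  have : (0 : ℝ) ≤ 2 * (T * L) * (klDiv S₁ (marginal c₁) (mixing S₁ (1 / T) (q₁ t)) +
    klDiv S₂ (marginal c₂) (mixing S₂ (1 / T) (q₂ t))) := by positivity
  linarith

variable {X A Y B Ω : Type*} [Fintype X] [Fintype A] [Fintype Y] [Fintype B]
  {mΩ : MeasurableSpace Ω} {μ : Measure Ω} {ℱ : Filtration ℕ mΩ} {L : ℕ} {G : Game X A Y B L}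
  {T : ℕ} {δ : ℝ} {g : ℕ → Ω → X → A → ℝ} {h : ℕ → Ω → Y → B → ℝ}
  {u₁ : ℕ → Ω → Traj X A L} {u₂ : ℕ → Ω → Traj Y B L}
  {q₁ : ℕ → Ω → X → A → X → ℝ} {q₂ : ℕ → Ω → Y → B → Y → ℝ} {lam : ℕ → Ω → ℝ}
  {c₁ : X → A → X → ℝ} {c₂ : Y → B → Y → ℝ}

namespace IsInteraction

lemma isRun (hI : IsInteraction G T (L * √T) (1 / (T * L)) (1 / T) δ μ ℱ g h u₁ u₂ q₁ q₂ lam)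
    (hL : 0 < L) (hT : 2 ≤ T) (hX : Fintype.card X * Fintype.card A ≤ T)
    (hY : Fintype.card Y * Fintype.card B ≤ T) (ω : Ω) :
    IsRun G.S₁ G.S₂ G.budget T δ G.r (fun t => g t ω) (fun t => h t ω) (fun t => u₁ t ω)
      (fun t => u₂ t ω) (fun t => q₁ t ω) (fun t => q₂ t ω) (fun t => lam t ω) where
  algorithm := hI.algorithm ω
  horizon_pos := hL
  two_le := hT
  card₁ := hX
  card₂ := hY
  r_mem := G.r_mem
  g_mem t x a := hI.g_mem t ω x a
  h_mem t y b := hI.h_mem t ω y b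
  budget_nonneg := G.budget_pos.le
  budget_le := G.budget_le

variable {V η θ : ℝ}

lemma isPolicy₁ (hI : IsInteraction G T V η θ δ μ ℱ g h u₁ u₂ q₁ q₂ lam) (hL : 0 < L) {t : ℕ}
    (ht : t < T) (ω : Ω) : IsPolicy (policy (q₁ (t + 1) ω)) := by
  have h1 := Counters.isLayered_of_mem_domain ((hI.algorithm ω).mem₁ t ht)
  have := Fintype.card_pos_iff.1 (h1.card_actions_pos hL)
  exact isPolicy_policy h1.nonneg

lemma isPolicy₂ (hI : IsInteraction G T V η θ δ μ ℱ g h u₁ u₂ q₁ q₂ lam) (hL : 0 < L) {t : ℕ}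
    (ht : t < T) (ω : Ω) : IsPolicy (policy (q₂ (t + 1) ω)) := by
  have h1 := Counters.isLayered_of_mem_domain ((hI.algorithm ω).mem₂ t ht)
  have := Fintype.card_pos_iff.1 (h1.card_actions_pos hL)
  exact isPolicy_policy h1.nonneg

lemma isPlayer₁ (hI : IsInteraction G T V η θ δ μ ℱ g h u₁ u₂ q₁ q₂ lam)
    [IsProbabilityMeasure μ] (hL : 0 < L) (hT : 2 ≤ T) :
    IsPlayer G.S₁ G.P₁ T δ μ ℱ u₁ q₁ where
  isTransition := G.isTransition₁
  horizon_pos := hL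
  two_le := hT
  mem ω t ht := (hI.algorithm ω).mem₁ t ht
  measurable_q := hI.measurable_q₁
  measurable_u := hI.measurable_u₁
  law t ht E hE v := measureReal_inter_eq_of_joint
    (fun v => ℱ.le _ _ (hI.measurable_u₁ t ht v)) (fun v => ℱ.le _ _ (hI.measurable_u₂ t ht v))
    (κ' := fun ω => trajProb G.S₂ G.P₂ (policy (q₂ (t + 1) ω)))
    (fun v => (measurable_trajProb (hI.measurable_q₁ t ht) v).mono (ℱ.le _) le_rfl)
    (fun v => (measurable_trajProb (hI.measurable_q₂ t ht) v).mono (ℱ.le _) le_rfl)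
    (fun ω => trajProb_nonneg G.isTransition₁ (hI.isPolicy₁ hL ht ω))
    (fun ω => trajProb_nonneg G.isTransition₂ (hI.isPolicy₂ hL ht ω))
    (fun ω => sum_trajProb G.isTransition₁ (hI.isPolicy₁ hL ht ω))
    (fun ω => sum_trajProb G.isTransition₂ (hI.isPolicy₂ hL ht ω))
    (ℱ.le _ _ hE) (hI.trajectories t ht E (le_sup_left (a := ℱ t) E hE)) v

lemma isPlayer₂ (hI : IsInteraction G T V η θ δ μ ℱ g h u₁ u₂ q₁ q₂ lam)
    [IsProbabilityMeasure μ] (hL : 0 < L) (hT : 2 ≤ T) :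
    IsPlayer G.S₂ G.P₂ T δ μ ℱ u₂ q₂ where
  isTransition := G.isTransition₂
  horizon_pos := hL
  two_le := hT
  mem ω t ht := (hI.algorithm ω).mem₂ t ht
  measurable_q := hI.measurable_q₂
  measurable_u := hI.measurable_u₂
  law t ht E hE v := measureReal_inter_eq_of_joint
    (fun v => ℱ.le _ _ (hI.measurable_u₂ t ht v)) (fun v => ℱ.le _ _ (hI.measurable_u₁ t ht v))
    (κ' := fun ω => trajProb G.S₁ G.P₁ (policy (q₁ (t + 1) ω)))
    (fun v => (measurable_trajProb (hI.measurable_q₂ t ht) v).mono (ℱ.le _) le_rfl)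
    (fun v => (measurable_trajProb (hI.measurable_q₁ t ht) v).mono (ℱ.le _) le_rfl)
    (fun ω => trajProb_nonneg G.isTransition₂ (hI.isPolicy₂ hL ht ω))
    (fun ω => trajProb_nonneg G.isTransition₁ (hI.isPolicy₁ hL ht ω))
    (fun ω => sum_trajProb G.isTransition₂ (hI.isPolicy₂ hL ht ω))
    (fun ω => sum_trajProb G.isTransition₁ (hI.isPolicy₁ hL ht ω))
    (ℱ.le _ _ hE) (fun v v' => by
      simp only [mul_comm (trajProb G.S₂ _ _ _), and_comm (a := u₂ (t + 1) _ = _)]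
      exact hI.trajectories t ht E (le_sup_left (a := ℱ t) E hE) v' v) v

/-- With high probability the noise in the drift of the dual potential is small over all windows of
episodes. -/
lemma exists_drift_event
    (hI : IsInteraction G T (L * √T) (1 / (T * L)) (1 / T) δ μ ℱ g h u₁ u₂ q₁ q₂ lam)
    [IsProbabilityMeasure μ] (hL : 0 < L) (hT : 2 ≤ T)
    (hX : Fintype.card X * Fintype.card A ≤ T) (hY : Fintype.card Y * Fintype.card B ≤ T)
    (hc₁ : IsLayered G.S₁ (marginal c₁)) (hc₂ : IsLayered G.S₂ (marginal c₂)) {ι : ℝ}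
    (hι : 0 ≤ ι) :
    ∃ bad : Set Ω, μ.real bad ≤ (T + 1) ^ 2 * Real.exp (-ι) ∧ ∀ ω ∉ bad, ∀ s t, s ≤ t → t ≤ T →
      ∑ i ∈ Finset.Ico s t, lam i ω /
        dualPotential G.S₁ G.S₂ T c₁ c₂ (q₁ i ω) (q₂ i ω) (lam i ω) *
        (utility G.S₁ c₁ (zeroAtZero (fun i => g i ω) i) +
          utility G.S₂ c₂ (zeroAtZero (fun i => h i ω) i) -
          (utility G.S₁ c₁ G.g + utility G.S₂ c₂ G.h)) ≤ 2 * L * √(2 * (t - s : ℕ) * ι) := by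
  set W : ℕ → Ω → ℝ := fun i ω => lam i ω /
    dualPotential G.S₁ G.S₂ T c₁ c₂ (q₁ i ω) (q₂ i ω) (lam i ω) with hW
  set E : ℕ → ℕ → Set Ω := fun s t => {ω | s ≤ t ∧ 1 * (2 * L) * √(2 * (t - s : ℕ) * ι) <
    ∑ i ∈ Finset.Ico s t, W i ω * (utility G.S₁ c₁ (zeroAtZero (fun i => g i ω) i) +
          utility G.S₂ c₂ (zeroAtZero (fun i => h i ω) i) -
          (utility G.S₁ c₁ G.g + utility G.S₂ c₂ G.h))} with hE
  have hbound : ∀ s ∈ Finset.range (T + 1), ∀ t ∈ Finset.range (T + 1),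
      μ.real (E s t) ≤ Real.exp (-ι) := by
    intro s _ t ht
    by_cases hst : s ≤ t
    · refine le_trans (measureReal_mono (fun ω hω => hω.2) (measure_ne_top _ _))
        (hI.measureReal_weighted_utility_le hL hc₁ hc₂ (w := W) ?_ ?_ one_pos ?_ hst
          (by simpa [Nat.lt_succ_iff] using ht) hι)
      · intro i hi
        have m1 := hI.measurable_q₁_pred hi.le
        have m2 := hI.measurable_q₂_pred hi.le
        have m3 := hI.measurable_lam_pred hi.le
        exact m3.div (Real.continuous_sqrt.measurable.comp ((m3.pow_const 2).add
          (((measurable_klDiv_mixing m1 c₁ _).add (measurable_klDiv_mixing m2 c₂ _)).const_mul _)))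
      · intro ω
        simp only [hW, (hI.algorithm ω).init_dual, zero_div]
      · exact fun i hi ω => (hI.isRun hL hT hX hY ω).abs_div_dualPotential_le_one hc₁ hc₂ hi.le
    · have : E s t = ∅ := Set.eq_empty_of_forall_notMem fun ω hω => hst hω.1
      rw [this]
      simp [Real.exp_nonneg]
  refine ⟨⋃ s ∈ Finset.range (T + 1), ⋃ t ∈ Finset.range (T + 1), E s t, ?_, ?_⟩
  · calc _ ≤ ∑ s ∈ Finset.range (T + 1), ∑ t ∈ Finset.range (T + 1), Real.exp (-ι) :=
          (measureReal_biUnion_finset_le _ _).trans (Finset.sum_le_sum fun s hs =>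
            (measureReal_biUnion_finset_le _ _).trans (Finset.sum_le_sum fun t ht =>
              hbound s hs t ht))
      _ = (T + 1) ^ 2 * Real.exp (-ι) := by simp; ring
  · intro ω hω s t hst ht
    simp only [Set.mem_iUnion, not_exists] at hω
    have := hω s (by simp; omega) t (by simp; omega)
    simp only [hE, Set.mem_ofPred_eq, not_and, not_lt, one_mul] at this
    exact this hst

/-- With high probability the utilities of feasible comparators, weighted by the dual variables,
do not exceed the budget by much as long as the dual variables are at most `M`. -/
lemma exists_weighted_utility_event
    (hI : IsInteraction G T (L * √T) (1 / (T * L)) (1 / T) δ μ ℱ g h u₁ u₂ q₁ q₂ lam)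
    [IsProbabilityMeasure μ] (hL : 0 < L) (hT : 2 ≤ T)
    (hX : Fintype.card X * Fintype.card A ≤ T) (hY : Fintype.card Y * Fintype.card B ≤ T)
    (hc : G.Feasible c₁ c₂) {ι : ℝ} (hι : 0 ≤ ι) {M : ℝ} (hM : 0 < M) :
    ∃ bad : Set Ω, μ.real bad ≤ Real.exp (-ι) ∧ ∀ ω ∉ bad, (∀ t ≤ T, lam t ω ≤ M) →
      ∑ t ∈ Finset.range T, lam t ω * (utility G.S₁ c₁ (zeroAtZero (fun i => g i ω) t) +
          utility G.S₂ c₂ (zeroAtZero (fun i => h i ω) t) - G.budget) ≤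
        L * √T * (2 * M * √(2 * ι)) := by
  obtain ⟨hc₁, hc₂, hb⟩ := hc
  refine ⟨{ω | M * (2 * L) * √(2 * (T - 0 : ℕ) * ι) < ∑ i ∈ Finset.Ico 0 T, min (lam i ω) M *
      (utility G.S₁ c₁ (zeroAtZero (fun i => g i ω) i) +
        utility G.S₂ c₂ (zeroAtZero (fun i => h i ω) i) -
        (utility G.S₁ c₁ G.g + utility G.S₂ c₂ G.h))}, ?_, ?_⟩
  · refine hI.measureReal_weighted_utility_le hL hc₁.1.isLayered hc₂.1.isLayered
      (w := fun i ω => min (lam i ω) M) ?_ ?_ hM ?_ (Nat.zero_le T) le_rfl hι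
    · exact fun i hi => (hI.measurable_lam_pred hi.le).min measurable_const
    · intro ω
      simp only [(hI.algorithm ω).init_dual, min_eq_left hM.le]
    · intro i hi ω
      rw [abs_of_nonneg (le_min ((hI.isRun hL hT hX hY ω).lam_nonneg hi.le) hM.le)]
      exact min_le_right _ _
  · intro ω hω hlam
    simp only [Set.mem_ofPred_eq, not_lt, Nat.sub_zero, ← Finset.range_eq_Ico] at hω
    have e : √(2 * T * ι) = √T * √(2 * ι) := by
      rw [← Real.sqrt_mul (by positivity)]; congr 1; ring
    rw [e] at hω
    refine le_trans (Finset.sum_le_sum fun t ht => ?_) (hω.trans (le_of_eq (by ring)))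
    have ht := (Finset.mem_range.1 ht).le
    rw [min_eq_left (hlam t ht)]
    exact mul_le_mul_of_nonneg_left (by linarith) ((hI.isRun hL hT hX hY ω).lam_nonneg ht)

end IsInteraction

end Events

section Main

/-- Comparison of the powers of a logarithm `ι ≥ log 2` with `ι ^ 2`. -/
lemma powers_le_sq {ι : ℝ} (hι : 0.69 ≤ ι) : √ι ≤ 2 * ι ^ 2 ∧
    ι * √ι ≤ 5 / 4 * ι ^ 2 ∧ ι ≤ 3 / 2 * ι ^ 2 ∧ 1 ≤ 9 / 4 * ι ^ 2 := by
  have h1 : √ι * √ι = ι := Real.mul_self_sqrt (by linarith)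
  have h2 : (0.8 : ℝ) ≤ √ι := Real.le_sqrt_of_sq_le (by linarith)
  have h3 : √ι ≤ 5 / 4 * ι := by nlinarith
  exact ⟨by nlinarith, by nlinarith, by nlinarith, by nlinarith⟩

lemma card_mul_le_sqrt {n m T : ℕ} (hm : 0 < m) (h : m * n ≤ T) : (m : ℝ) * n ≤ m * √(T * n) := by
  have h1 : (n : ℝ) ≤ T := by exact_mod_cast (Nat.le_mul_of_pos_left n hm).trans h
  refine mul_le_mul_of_nonneg_left (Real.le_sqrt_of_sq_le ?_) (Nat.cast_nonneg _)
  nlinarith [show (0 : ℝ) ≤ n from Nat.cast_nonneg n]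

/-- The terms of the bounds for the regret and the violation are dominated by the common rate. -/
lemma rate_bounds {L T m m' n n' : ℕ} {ι ι₀ ℓ K R W D₁ D₂ z₁ z₂ : ℝ} (hL : 0 < L) (hLm : L ≤ m)
    (hLm' : L ≤ m') (hn : 0 < n) (hn' : 0 < n') (h : m * n ≤ T) (h' : m' * n' ≤ T) (hT : 1 ≤ T)
    (hℓ0 : 0 ≤ ℓ) (hℓ : ℓ ≤ ι) (hι1 : 0.69 ≤ ι) (hι₀ : ι₀ ≤ 6 * ι) (hK : 0 ≤ K)
    (hD₁ : D₁ ≤ 31 * √ι * (m * L * √(T * n))) (hD₂ : D₂ ≤ 31 * √ι * (m' * L * √(T * n')))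
    (hz₁ : z₁ ≤ m * n * (3 * ℓ)) (hz₂ : z₂ ≤ m' * n' * (3 * ℓ))
    (hR : R ≤ 2 * (K * (L ^ 2 * √T * ι)) * √(2 * ι₀) + 4 * (L * √T) * ℓ + 12 * (L * √T) + L +
      D₁ + D₂)
    (hW : W ≤ 30 * (L * √T) + 13 * (K * (L ^ 2 * √T * ι)) + 2 * L * (z₁ + z₂) + D₁ + D₂) :
    R ≤ (400 + 24 * K) * ((m + m') * L * √(T * (n + n'))) * ι ^ 2 ∧
      W ≤ (400 + 24 * K) * ((m + m') * L * √(T * (n + n'))) * ι ^ 2 := by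
  have hL' : (1 : ℝ) ≤ L := by exact_mod_cast hL
  have hT' : (1 : ℝ) ≤ T := by exact_mod_cast hT
  have hn1 : (1 : ℝ) ≤ n := by exact_mod_cast hn
  have hn1' : (1 : ℝ) ≤ n' := by exact_mod_cast hn'
  have hLX' : (L : ℝ) ≤ m := by exact_mod_cast hLm
  -- Each term is at most a multiple of `Q`, since `L ≤ m` and `T ≥ m n`, `T ≥ m' n'`.
  set Q : ℝ := (m + m') * L * √(T * (n + n')) with hQ
  have hsA : √(T * n) ≤ √(T * (n + n')) :=
    Real.sqrt_le_sqrt (mul_le_mul_of_nonneg_left (by linarith) (Nat.cast_nonneg T))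
  have hsB : √(T * n') ≤ √(T * (n + n')) :=
    Real.sqrt_le_sqrt (mul_le_mul_of_nonneg_left (by linarith) (Nat.cast_nonneg T))
  have hsT : √T ≤ √(T * n) :=
    Real.sqrt_le_sqrt (le_mul_of_one_le_right (Nat.cast_nonneg T) hn1)
  have hQ1 : m * L * √(T * n) + m' * L * √(T * n') ≤ Q := by
    calc _ ≤ m * L * √(T * (n + n')) + m' * L * √(T * (n + n')) := by gcongr
      _ = Q := by rw [hQ]; ring
  have hQ2 : (L : ℝ) ^ 2 * √T ≤ Q := by
    refine le_trans ?_ hQ1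
    calc (L : ℝ) ^ 2 * √T = L * L * √T := by ring
      _ ≤ m * L * √(T * n) := by gcongr
      _ ≤ _ := le_add_of_nonneg_right (by positivity)
  have hQ3 : (L : ℝ) * √T ≤ Q := by
    refine le_trans ?_ hQ2
    rw [sq]
    exact mul_le_mul_of_nonneg_right (le_mul_of_one_le_left (by positivity) hL')
      (Real.sqrt_nonneg _)
  have hQ4 : (L : ℝ) ≤ Q :=
    (le_mul_of_one_le_right (by positivity) (Real.one_le_sqrt.2 (by linarith))).trans hQ3
  have hQ5 : L * (m * n * (3 * ℓ) + m' * n' * (3 * ℓ)) ≤ 3 * ι * Q := by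
    have a1 : m * n ≤ m * √(T * n) := card_mul_le_sqrt (hL.trans_le hLm) h
    have a2 : m' * n' ≤ m' * √(T * n') := card_mul_le_sqrt (hL.trans_le hLm') h'
    calc L * (m * n * (3 * ℓ) + m' * n' * (3 * ℓ))
        ≤ L * (m * √(T * n) * (3 * ι) + m' * √(T * n') * (3 * ι)) := by gcongr
      _ = 3 * ι * (m * L * √(T * n) + m' * L * √(T * n')) := by ring
      _ ≤ 3 * ι * Q := mul_le_mul_of_nonneg_left hQ1 (by linarith)
  have hQ0 : 0 ≤ Q := by linarith
  obtain ⟨hι2, hι3, hι4, hι5⟩ := powers_le_sq hι1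
  have f1 : √ι * Q ≤ 2 * (ι ^ 2 * Q) :=
    (mul_le_mul_of_nonneg_right hι2 hQ0).trans_eq (by ring)
  have f2 : ι * Q ≤ 3 / 2 * (ι ^ 2 * Q) :=
    (mul_le_mul_of_nonneg_right hι4 hQ0).trans_eq (by ring)
  have f3 : Q ≤ 9 / 4 * (ι ^ 2 * Q) := by
    linarith [mul_le_mul_of_nonneg_right hι5 hQ0]
  have hN : 2 * (K * (L ^ 2 * √T * ι)) * √(2 * ι₀) ≤ 9 * K * (ι ^ 2 * Q) := by
    have a1 : √(2 * ι₀) ≤ 3.5 * √ι := by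
      have e : √(3.5 ^ 2 * ι) = 3.5 * √ι := by
        rw [Real.sqrt_mul (by norm_num), Real.sqrt_sq (by norm_num)]
      rw [← e]
      exact Real.sqrt_le_sqrt (by linarith)
    calc 2 * (K * (L ^ 2 * √T * ι)) * √(2 * ι₀)
        ≤ 2 * (K * (L ^ 2 * √T * ι)) * (3.5 * √ι) := by gcongr
      _ = 7 * K * (ι * √ι) * (L ^ 2 * √T) := by ring
      _ ≤ 7 * K * (5 / 4 * ι ^ 2) * Q := by gcongr
      _ ≤ 9 * K * (ι ^ 2 * Q) := by
          have : 0 ≤ K * (ι ^ 2 * Q) := by positivity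
          linarith
  have hD : 31 * √ι * (m * L * √(T * n)) + 31 * √ι * (m' * L * √(T * n')) ≤
      62 * (ι ^ 2 * Q) := by
    have := mul_le_mul_of_nonneg_left hQ1 (show 0 ≤ 31 * √ι by positivity)
    linarith
  have hKQ : 0 ≤ K * (ι ^ 2 * Q) := by positivity
  have hιQ : 0 ≤ ι ^ 2 * Q := by positivity
  constructor
  · refine hR.trans ?_
    have a1 : 4 * (L * √T) * ℓ ≤ 4 * (ι * Q) := by
      calc 4 * (L * √T) * ℓ ≤ 4 * Q * ι := by gcongr
        _ = 4 * (ι * Q) := by ring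
    linarith
  · refine hW.trans ?_
    have a1 : 13 * (K * (L ^ 2 * √T * ι)) ≤ 20 * K * (ι ^ 2 * Q) := by
      calc 13 * (K * (L ^ 2 * √T * ι)) = 13 * K * ι * (L ^ 2 * √T) := by ring
        _ ≤ 13 * K * ι * Q := mul_le_mul_of_nonneg_left hQ2 (by
            have : 0 ≤ ι := by linarith
            positivity)
        _ = 13 * K * (ι * Q) := by ring
        _ ≤ 13 * K * (3 / 2 * (ι ^ 2 * Q)) := mul_le_mul_of_nonneg_left f2 (by positivity)
        _ ≤ 20 * K * (ι ^ 2 * Q) := by linarith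
    have a2 := mul_le_mul_of_nonneg_left (add_le_add hz₁ hz₂)
      (show (0 : ℝ) ≤ 2 * L by positivity)
    linarith

lemma one_sub_le_measureReal {Ω : Type*} {mΩ : MeasurableSpace Ω} {μ : Measure Ω}
    [IsProbabilityMeasure μ] {s t : Set Ω} {p : ℝ} (hs : μ.real s ≤ p) (h : sᶜ ⊆ t) :
    1 - p ≤ μ.real t := by
  have h1 := measureReal_mono (μ := μ) h (measure_ne_top _ _)
  have h2 := measureReal_union_le (μ := μ) s sᶜ
  rw [Set.union_compl_self, probReal_univ] at h2
  linarith

variable {X A Y B Ω : Type*} [Fintype X] [Fintype A] [Fintype Y] [Fintype B]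
  {mΩ : MeasurableSpace Ω} {μ : Measure Ω} {ℱ : Filtration ℕ mΩ} {L : ℕ} {G : Game X A Y B L}
  {T : ℕ} {p : ℝ} {g : ℕ → Ω → X → A → ℝ} {h : ℕ → Ω → Y → B → ℝ}
  {u₁ : ℕ → Ω → Traj X A L} {u₂ : ℕ → Ω → Traj Y B L}
  {q₁ : ℕ → Ω → X → A → X → ℝ} {q₂ : ℕ → Ω → Y → B → Y → ℝ} {lam : ℕ → Ω → ℝ}
  {s₁ : X → A → X → ℝ} {s₂ : Y → B → Y → ℝ}

open Classical in
/-- The bounds for the regret and the violation, against an arbitrary feasible pair. -/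
lemma IsInteraction.performance {ξ : ℝ} (hξ : 0 < ξ) [IsProbabilityMeasure μ]
    (hG : G.StrictlyFeasible ξ) (hp0 : 0 < p) (hp1 : p < 1)
    (hX : Fintype.card X * Fintype.card A ≤ T) (hY : Fintype.card Y * Fintype.card B ≤ T)
    (hI : IsInteraction G T (L * √T) (1 / (T * L)) (1 / T) (p / (2 * T)) μ ℱ g h u₁ u₂ q₁ q₂ lam)
    (hs : G.Feasible s₁ s₂) :
    1 - p ≤ μ.real {ω |
      G.regret T s₁ s₂ (fun t => policy (q₁ t ω)) (fun t => policy (q₂ t ω)) ≤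
        (400 + 24 * (10 + 125 / ξ)) * ((Fintype.card X + Fintype.card Y) * L *
          √(T * (Fintype.card A + Fintype.card B))) * Real.log (T / p) ^ 2 ∧
      G.violation T (fun t => g t ω) (fun t => h t ω)
          (fun t => policy (q₁ t ω)) (fun t => policy (q₂ t ω)) ≤
        (400 + 24 * (10 + 125 / ξ)) * ((Fintype.card X + Fintype.card Y) * L *
          √(T * (Fintype.card A + Fintype.card B))) * Real.log (T / p) ^ 2} := by
  obtain ⟨c₁, hc₁, c₂, hc₂, hslack⟩ := hG
  have hL : 0 < L := by
    have := G.budget_pos.trans_le G.budget_le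
    exact_mod_cast (by linarith : (0 : ℝ) < L)
  have hA := hc₁.1.isLayered.card_actions_pos hL
  have hB := hc₂.1.isLayered.card_actions_pos hL
  have hLX := hc₁.1.isLayered.horizon_le_card
  have hLY := hc₂.1.isLayered.horizon_le_card
  have hX2 := G.S₁.two_le_card hL
  have hY2 := G.S₂.two_le_card hL
  have hT : 2 ≤ T := hX2.trans ((Nat.le_mul_of_pos_right _ hA).trans hX)
  have hT' : (2 : ℝ) ≤ T := by exact_mod_cast hT
  have hL' : (1 : ℝ) ≤ L := by exact_mod_cast hL
  have run := hI.isRun hL hT hX hY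
  set ι := Real.log (T / p) with hι
  -- The exponent of the deviation bounds, chosen so that `exp (-ι₀) = p / (16 T²)`.
  set ι₀ := Real.log (16 * T ^ 2 / p) with hι₀
  have hlogT : Real.log T ≤ ι := log_le_log_div hT hp0 hp1
  have hlog0 : 0 ≤ Real.log T := Real.log_nonneg (by linarith)
  have hι1 : 0.69 ≤ ι := by
    obtain ⟨ω₀⟩ := μ.nonempty_of_neZero
    exact (run ω₀).log_two_le.trans hlogT
  have hι₀0 : 0 ≤ ι₀ := log_union_nonneg hT hp0 hp1
  have hι₀ι : ι₀ ≤ 6 * ι := log_union_le hT hp0 hp1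
  have hexp : Real.exp (-ι₀) = p / (16 * T ^ 2) := exp_neg_log_union hT hp0
  set K := 10 + 125 / ξ with hK
  have hK0 : 0 < K := by positivity
  have hM0 : 0 < K * (L ^ 2 * √T * ι) := by
    have : 0 < ι := by linarith
    positivity
  obtain ⟨bad₁, hbad₁, hgood₁⟩ := (hI.isPlayer₁ hL hT).exists_bad_event hp0 hp1 hι₀0
  obtain ⟨bad₂, hbad₂, hgood₂⟩ := (hI.isPlayer₂ hL hT).exists_bad_event hp0 hp1 hι₀0
  obtain ⟨bad₃, hbad₃, hgood₃⟩ := hI.exists_drift_event hL hT hX hY hc₁.1.isLayered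
    hc₂.1.isLayered hι₀0
  obtain ⟨bad₄, hbad₄, hgood₄⟩ := hI.exists_weighted_utility_event hL hT hX hY hs hι₀0 hM0
  have hbad : μ.real (bad₁ ∪ bad₂ ∪ bad₃ ∪ bad₄) ≤ p := by
    have h1 := measureReal_union_le (μ := μ) (bad₁ ∪ bad₂ ∪ bad₃) bad₄
    have h2 := measureReal_union_le (μ := μ) (bad₁ ∪ bad₂) bad₃
    have h3 := measureReal_union_le (μ := μ) bad₁ bad₂
    rw [hexp] at hbad₁ hbad₂ hbad₃ hbad₄
    have e : (T + 1 : ℝ) ^ 2 * (p / (16 * T ^ 2)) + 3 * (p / (16 * T ^ 2)) ≤ p / 2 := by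
      rw [← add_mul, ← mul_div_assoc, div_le_iff₀ (by positivity)]
      nlinarith [mul_le_mul_of_nonneg_left (show (T + 1 : ℝ) ^ 2 + 3 ≤ 8 * T ^ 2 by nlinarith)
        hp0.le]
    linarith
  refine one_sub_le_measureReal hbad fun ω hω => ?_
  simp only [Set.mem_compl_iff, Set.mem_union, not_or] at hω
  obtain ⟨⟨⟨hω₁, hω₂⟩, hω₃⟩, hω₄⟩ := hω
  obtain ⟨hleg₁, hconf₁, hdist₁⟩ := hgood₁ ω hω₁
  obtain ⟨hleg₂, hconf₂, hdist₂⟩ := hgood₂ ω hω₂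
  -- Both the regret and the violation bound need the dual variables to be bounded.
  have hmean₁ := fun x a => (hI.mean_g_mem (by omega) x a).1
  have hmean₂ := fun y b => (hI.mean_h_mem (by omega) y b).1
  have hlam : ∀ t ≤ T, lam t ω ≤ K * (L ^ 2 * √T * ι) :=
    (run ω).lam_le hξ (add_nonneg (utility_nonneg hc₁.1.isLayered fun x a _ => hmean₁ x a)
      (utility_nonneg hc₂.1.isLayered fun y b _ => hmean₂ y b)) hslack
      (fun t ht => ⟨_, hconf₁ t ht, hc₁⟩) (fun t ht => ⟨_, hconf₂ t ht, hc₂⟩) hlogT hι₀0 hι₀ι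
      (hgood₃ ω hω₃)
  have hreg := Game.regret_le G hs.1.1.isLayered hs.2.1.1.isLayered
    ((run ω).sum_reward_sub_le (fun t ht => ⟨_, hconf₁ t ht, hs.1⟩)
      (fun t ht => ⟨_, hconf₂ t ht, hs.2.1⟩) (hgood₄ ω hω₄ hlam)) le_rfl le_rfl
  have hD₁ := distance_bound_le (T := T) hLX hA (ι := ι) (by linarith)
    (log_width_le hA (by omega) hX hT hp0 hp1) hι₀ι
  have hD₂ := distance_bound_le (T := T) hLY hB (ι := ι) (by linarith)
    (log_width_le hB (by omega) hY hT hp0 hp1) hι₀ι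
  have hviol := Game.violation_le G (fun t x a => hI.g_mem t ω x a)
    (fun t y b => hI.h_mem t ω y b) (add_nonneg (add_nonneg (by positivity)
      (Finset.sum_nonneg fun _ _ => l1Dist_nonneg)) (Finset.sum_nonneg fun _ _ => l1Dist_nonneg))
    ((run ω).sum_utility_le hlam) le_rfl le_rfl
  have hchg₁ := card_domain_changes_le (S := G.S₁) (u := fun i => u₁ i ω) hT hleg₁ (p / (2 * T))
  have hchg₂ := card_domain_changes_le (S := G.S₂) (u := fun i => u₂ i ω) hT hleg₂ (p / (2 * T))
  exact rate_bounds hL hLX hLY hA hB hX hY (by omega) hlog0 hlogT hι1 hι₀ι hK0.le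
    (hdist₁.trans hD₁) (hdist₂.trans hD₂) hchg₁ hchg₂ hreg hviol

end Main

end CMG

end

/-- The implied constants `k` (universal) and `C` (depending on the slack `ξ` only) and the
factor `log (T / p) ^ k` make up the `Õ`; recall `T ≥ |X||A|`, `T ≥ |Y||B|` and `L ≤ |X|`. -/
theorem theorem1 :
    ∃ k : ℕ, ∀ ξ : ℝ, 0 < ξ → ∃ C : ℝ, 0 < C ∧
      ∀ (X A Y B Ω : Type*) [Fintype X] [Fintype A] [Fintype Y] [Fintype B]
        (mΩ : MeasurableSpace Ω) (μ : Measure Ω) [IsProbabilityMeasure μ] (ℱ : Filtration ℕ mΩ)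
        (L : ℕ) (G : CMG.Game X A Y B L) (T : ℕ) (p : ℝ)
        (g : ℕ → Ω → X → A → ℝ) (h : ℕ → Ω → Y → B → ℝ)
        (u₁ : ℕ → Ω → CMG.Traj X A L) (u₂ : ℕ → Ω → CMG.Traj Y B L)
        (q₁ : ℕ → Ω → X → A → X → ℝ) (q₂ : ℕ → Ω → Y → B → Y → ℝ) (lam : ℕ → Ω → ℝ),
        G.StrictlyFeasible ξ →
        0 < p → p < 1 →
        Fintype.card X * Fintype.card A ≤ T →
        Fintype.card Y * Fintype.card B ≤ T →
        CMG.IsInteraction G T (V := L * Real.sqrt T) (η := 1 / (T * L)) (θ := 1 / T)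
          (δ := p / (2 * T)) μ ℱ g h u₁ u₂ q₁ q₂ lam →
        ∀ (s₁ : X → A → X → ℝ) (s₂ : Y → B → Y → ℝ), G.IsConstrainedNash T s₁ s₂ →
          1 - p ≤ μ.real {ω |
            G.regret T s₁ s₂ (fun t => CMG.policy (q₁ t ω)) (fun t => CMG.policy (q₂ t ω)) ≤
              C * ((Fintype.card X + Fintype.card Y) * L *
                Real.sqrt (T * (Fintype.card A + Fintype.card B))) * Real.log (T / p) ^ k ∧
            G.violation T (fun t => g t ω) (fun t => h t ω)
                (fun t => CMG.policy (q₁ t ω)) (fun t => CMG.policy (q₂ t ω)) ≤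
              C * ((Fintype.card X + Fintype.card Y) * L *
                Real.sqrt (T * (Fintype.card A + Fintype.card B))) * Real.log (T / p) ^ k} := by
  refine ⟨2, fun ξ hξ => ⟨400 + 24 * (10 + 125 / ξ), by positivity, ?_⟩⟩
  intro X A Y B Ω _ _ _ _ mΩ μ _ ℱ L G T p g h u₁ u₂ q₁ q₂ lam hG hp0 hp1 hX hY hI s₁ s₂ hs
  exact CMG.IsInteraction.performance hξ hG hp0 hp1 hX hY hI hs.feasible
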